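/- **Theorem (stability of the $c^p$-BATCH policy).** Tasks arrive according to a Poisson process with intensity $\lambda>0$. Their locations are i.i.d. with an arbitrary law concentrated on a bounded region $E\subset\mathbb{R}^2$ (in particular, any bounded connected region of finite perimeter is allowed). The service times of the tasks are i.i.d., nonnegative, with mean $\bar s>0$ and finite second moment. Arrival times, locations and service times are independent of each other. At time $0$ there are finitely many given outstanding tasks in $E$, each having already waited a given finite time, and their service times are distributed as and independent of the others. A single vehicle starts at an arbitrary point, moves in straight lines at unit speed, and serves a task by travelling to its location and staying there for its service time. For a real $p\ge 1$, the cost of a tour that starts at $x_0$ and visits, in this order, tasks at $x_1,\dots,x_n$ which have already waited for times $t_1,\dots,t_n\ge 0$ is $$c^p=\Big(\sum_{i=1}^n\Big(t_i+\sum_{j=1}^i\big(\|x_j-x_{j-1}\|+\bar s\big)\Big)^p\Big)^{1/p}.$$ Let $\eta>0$. The $c^p$-BATCH policy works in iterations. At the beginning of an iteration with $n\ge 1$ outstanding tasks, it computes a tour from the current position of the vehicle through all of them with minimal $c^p$, based only on the vehicle position and the locations and waiting times of the outstanding tasks listed in a fixed order (given initial order, then order of arrival), ties being resolved by any measurable rule;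 the vehicle then serves the first $\min(n,\lceil\eta n\rceil)$ tasks of this tour in order, after which the next iteration begins, the tasks that have arrived in the meantime being outstanding. If there are no outstanding tasks, the vehicle moves towards a fixed waiting position, where it stays, until the next task arrives, and then the next iteration begins. If the load factor $\rho=\lambda\bar s$ satisfies $\rho<1$, then for every $p\ge1$ and every $\eta>0$ the $c^p$-BATCH policy is stable: the number $N(t)$ of tasks that have arrived by time $t$ and whose service is not completed by time $t$ satisfies $$\sup_{t\ge 0}\mathbb{E}[N(t)]<\infty .$$ -/

import Mathlib

open MeasureTheory ProbabilityTheory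
open scoped ENNReal

noncomputable section

namespace DVRP

/-- The Euclidean plane. -/
abbrev Plane : Type := EuclideanSpace ℝ (Fin 2)

/-! ### The cost of a tour -/

/-- Sum of the `p`-th powers of the predicted system times along a tour. A task is a pair
(latent wait time, location); the vehicle moves at unit speed, and every service is predicted to
take the mean service time `sbar`. The argument `e` is the time that has elapsed since the start
of the tour, and `x` is the current position of the vehicle. -/
def costSum (p sbar : ℝ) : ℝ → Plane → List (ℝ × Plane) → ℝ
  | _, _, [] => 0
  | e, x, (t, y) :: l =>
      (t + (e + dist x y + sbar)) ^ p + costSum p sbar (e + dist x y + sbar) y l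

/-- The cost `c^p` of the tour that starts at `x` and visits the tasks of `l` in order. -/
def cost (p sbar : ℝ) (x : Plane) (l : List (ℝ × Plane)) : ℝ :=
  (costSum p sbar 0 x l) ^ (1 / p)

/-- A planner: given the position of the vehicle and the `n` outstanding tasks (latent wait time
and location of each), it returns a tour, that is, an order in which to visit the tasks. -/
abbrev Planner : Type :=
  (n : ℕ) → Plane → (Fin n → ℝ × Plane) → Equiv.Perm (Fin n)

/-- The planner always returns a `c^p`-minimizing tour. -/
def Planner.Minimizes (pl : Planner) (p sbar : ℝ) : Prop :=
  ∀ (n : ℕ) (x : Plane) (T : Fin n → ℝ × Plane), (∀ i, 0 ≤ (T i).1) →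
    ∀ π : Equiv.Perm (Fin n),
      cost p sbar x (List.ofFn fun i => T (pl n x T i)) ≤
        cost p sbar x (List.ofFn fun i => T (π i))

/-- The planner resolves ties between optimal tours in a measurable way. -/
def Planner.IsMeasurable (pl : Planner) : Prop :=
  ∀ (n : ℕ) (π : Equiv.Perm (Fin n)),
    MeasurableSet {z : Plane × (Fin n → ℝ × Plane) | pl n z.1 z.2 = π}

/-! ### The policy on one realization of the tasks -/

/-- One realization of the tasks: arrival time, location and service time of each task. -/
structure Scenario where
  arr : ℕ → ℝ
  loc : ℕ → Plane
  serv : ℕ → ℝ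

/-- The number of tasks that have arrived by time `t`. -/
def Scenario.numArrived (w : Scenario) (t : ℝ) : ℕ := {j : ℕ | w.arr j ≤ t}.ncard

/-- The time at which the vehicle has served the tasks of a list, in order, when it leaves the
position `x` at time `t`. -/
def Scenario.endTime (w : Scenario) : ℝ → Plane → List ℕ → ℝ
  | t, _, [] => t
  | t, x, j :: l => w.endTime (t + dist x (w.loc j) + w.serv j) (w.loc j) l

/-- The position of the vehicle after it has served the tasks of a list, in order. -/
def Scenario.endPos (w : Scenario) : Plane → List ℕ → Plane
  | x, [] => x
  | _, j :: l => w.endPos (w.loc j) l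

/-- The state at the beginning of an iteration of the policy. -/
structure State where
  time : ℝ
  pos : Plane
  served : Finset ℕ

/-- The outstanding tasks at the beginning of an iteration, in the order of their labels. -/
def Scenario.queue (w : Scenario) (s : State) : List ℕ :=
  (List.range (w.numArrived s.time)).filter fun j => j ∉ s.served

/-- The tour computed at the beginning of an iteration. -/
def Scenario.tour (w : Scenario) (pl : Planner) (s : State) : List ℕ :=
  List.ofFn fun i : Fin (w.queue s).length =>
    (w.queue s).get (pl (w.queue s).length s.pos
      (fun i => (s.time - w.arr ((w.queue s).get i), w.loc ((w.queue s).get i))) i)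

/-- The part of the tour that is executed before the next planning: its first `⌈η n⌉` tasks
(all of them if `⌈η n⌉ ≥ n`), where `n` is the number of outstanding tasks. -/
def Scenario.fragment (w : Scenario) (pl : Planner) (η : ℝ) (s : State) : List ℕ :=
  (w.tour pl s).take ⌈η * (w.queue s).length⌉₊

/-- One iteration. If there are outstanding tasks, the fragment is served. Otherwise the vehicle
heads for the waiting position `xw` at unit speed and stays there once it has reached it; the next
iteration begins as soon as the next task arrives. -/
def Scenario.step (w : Scenario) (pl : Planner) (η : ℝ) (xw : Plane) (s : State) : State :=
  if w.queue s = [] then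
    { time := w.arr (w.numArrived s.time)
      pos := AffineMap.lineMap s.pos xw
        (min 1 ((w.arr (w.numArrived s.time) - s.time) / dist s.pos xw))
      served := s.served }
  else
    { time := w.endTime s.time s.pos (w.fragment pl η s)
      pos := w.endPos s.pos (w.fragment pl η s)
      served := s.served ∪ (w.fragment pl η s).toFinset }

/-- The state at the beginning of iteration `k`; at time `0` the vehicle is at `x₀`. -/
def Scenario.state (w : Scenario) (pl : Planner) (η : ℝ) (x₀ xw : Plane) (k : ℕ) : State :=
  (w.step pl η xw)^[k] { time := 0, pos := x₀, served := ∅ }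

/-- The service of task `j` has been completed by time `t`: in some iteration, `j` is a task of
the fragment, and the vehicle has served the fragment up to and including `j` by time `t`. -/
def Scenario.CompletedBy (w : Scenario) (pl : Planner) (η : ℝ) (x₀ xw : Plane) (j : ℕ) (t : ℝ) :
    Prop :=
  ∃ (k : ℕ) (l : List ℕ),
    (l ++ [j]) <+: w.fragment pl η (w.state pl η x₀ xw k) ∧
      w.endTime (w.state pl η x₀ xw k).time (w.state pl η x₀ xw k).pos (l ++ [j]) ≤ t

/-- The number of tasks that are outstanding at time `t`: they have arrived, and their service
has not been completed. -/
def Scenario.numOutstanding (w : Scenario) (pl : Planner) (η : ℝ) (x₀ xw : Plane) (t : ℝ) : ℕ∞ :=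
  {j : ℕ | w.arr j ≤ t ∧ ¬ w.CompletedBy pl η x₀ xw j t}.encard

/-! ### The stochastic model -/

/-- The random data `Z i = (interarrival time, location, service time)` are independent of each
other and identically distributed, with independent components: interarrival times are exponential
with rate `lam` (so that tasks arrive according to a Poisson process with intensity `lam`),
locations have law `φ` and service times have law `ν`. -/
structure IsTaskStream {Ω : Type*} [MeasurableSpace Ω] (P : Measure Ω) (lam : ℝ)
    (φ : Measure Plane) (ν : Measure ℝ) (Z : ℕ → Ω → ℝ × Plane × ℝ) : Prop where
  measurable : ∀ i, Measurable (Z i)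
  indep : iIndepFun Z P
  law : ∀ i, P.map (Z i) = (expMeasure lam).prod (φ.prod ν)

/-- The realization of the tasks obtained from `n₀` tasks that are present at time `0` (each given
by its latent wait time and its location; their labels are `0, …, n₀ - 1`) and from a realization
`z` of the random data: task `n₀ + i` arrives at the sum of the first `i + 1` interarrival times,
and `(z j).2.2` is the service time of the task with label `j`. -/
def scenario {n₀ : ℕ} (init : Fin n₀ → ℝ × Plane) (z : ℕ → ℝ × Plane × ℝ) : Scenario where
  arr j := if h : j < n₀ then -(init ⟨j, h⟩).1 else ∑ i ∈ Finset.range (j - n₀ + 1), (z i).1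
  loc j := if h : j < n₀ then (init ⟨j, h⟩).2 else (z (j - n₀)).2.1
  serv j := (z j).2.2

/-- A random number of outstanding tasks is stable if its expectation is bounded uniformly in
time. -/
def IsStable {Ω : Type*} [MeasurableSpace Ω] (P : Measure Ω) (N : ℝ → Ω → ℕ∞) : Prop :=
  ∃ C : ℝ≥0∞, C < ⊤ ∧ ∀ t : ℝ, 0 ≤ t → ∫⁻ ω, (N t ω : ℝ≥0∞) ∂P ≤ C

end DVRP

end

noncomputable section

namespace DVRP

/-! ### Inequalities between powers -/

/-! The proof is a drift argument, carried out first along each realization and then in expectation.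
Optimality of the tours enters through two exchange arguments. Serving a task earlier by `d` lowers
its term `u ^ p` by at least `d * u ^ (p - 1)`, and delaying it by `h` raises the term by at most `p
* h` times a `(p - 1)`-th power. Sums of `(p - 1)`-th powers are therefore the natural weights.

For the first exchange, cut an optimal tour into blocks of a fixed number of tasks. A block much
longer than a cluster-by-cluster path through its points could be reordered, and everything after it
would be served at least one time unit earlier. Optimality then forces the block to carry a fixed
proportion of the weight that remains. This happens only logarithmically often, so the travel is at
most `ε` per task plus a logarithm of the weight (`exists_pathLen_le_log`). For the second exchange,
move the fragment to be executed to the end of the tour. Optimality shows that the fragment carries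
a fixed proportion of the weight (`exists_powSum_le_of_isOptimal`). One iteration thus contracts
`weightRoot`, up to a term linear in its duration, the queue length and the number of new tasks
(`exists_weightRoot_step_le`).

The Lyapunov function is the outstanding work, with a surcharge `ε` per task, plus a small multiple
of `weightRoot` (`exists_drift`). Elapsed time is service plus travel; the surcharges and the
contraction of the weight absorb the travel, and also the remaining constant unless the state is
small. Going back to the last small state yields `exists_pathwise_bound`: the number of outstanding
tasks is controlled by a constant, the services of the few tasks outstanding at that small state,
and the work that has arrived since, minus almost the full elapsed time.

The small state begins at a random time, so each of these terms has to be bounded uniformly over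
starting times. Service times, centred slightly above their mean, are dominated by a reflected
random walk with bounded expectation (`exists_integral_lindley_le`), evaluated at an index
independent of it. The excess of the arrival count over a faster linear function has exponential
tails, which can be summed over the integer parts of the elapsed time; `lam * sbar < 1` leaves room
for such a function. Finally, planning uses no realized service times, so the service time of an
unserved task is independent of the state (`AgreeOff.state_eq`). In expectation boundedly many small
iterations begin per unit time, and discounting by the elapsed time leaves a series that converges
by the second moment. -/

theorem rpow_eq_mul_rpow_sub_one {u p : ℝ} (hu : 0 ≤ u) (hp : 1 ≤ p) : u ^ p = u * u ^ (p - 1) := by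
  rcases hu.eq_or_lt with rfl | hu
  · rw [Real.zero_rpow (by linarith), zero_mul]
  · rw [Real.rpow_sub_one hu.ne']
    field_simp

/-- Replacing `v ^ (p - 1)` by the larger `u ^ (p - 1)` leaves `(u - v) * u ^ (p - 1)`. This is the
gain from serving a task earlier, measured at the original, later time. -/
theorem mul_rpow_sub_one_le_rpow_sub_rpow {u v d p : ℝ} (hp : 1 ≤ p) (hv : 0 ≤ v) (hd : 0 ≤ d)
    (h : v + d ≤ u) : d * u ^ (p - 1) ≤ u ^ p - v ^ p := by
  have hu : 0 ≤ u := by linarith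
  rw [rpow_eq_mul_rpow_sub_one hu hp, rpow_eq_mul_rpow_sub_one hv hp]
  have h1 : v ^ (p - 1) ≤ u ^ (p - 1) := Real.rpow_le_rpow hv (by linarith) (by linarith)
  have h2 : 0 ≤ u ^ (p - 1) := Real.rpow_nonneg hu _
  nlinarith [mul_le_mul_of_nonneg_left h1 hv, mul_le_mul_of_nonneg_right h h2]

/-- Bernoulli's inequality for the ratio `a / (a + h)`. This is the loss caused by a delay. -/
theorem add_rpow_sub_rpow_le {a h p : ℝ} (hp : 1 ≤ p) (ha : 0 ≤ a) (hh : 0 ≤ h) :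
    (a + h) ^ p - a ^ p ≤ p * h * (a + h) ^ (p - 1) := by
  rcases (add_nonneg ha hh).eq_or_lt with h0 | h0
  · have ha' : a = 0 := by linarith
    have hh' : h = 0 := by linarith
    simp [ha', hh']
  · have h1 := one_add_mul_self_le_rpow_one_add (s := -h / (a + h))
      (by rw [le_div_iff₀ h0]; linarith) hp
    have h2 : 1 + -h / (a + h) = a / (a + h) := by field_simp; ring
    rw [h2, Real.div_rpow ha h0.le, le_div_iff₀ (Real.rpow_pos_of_pos h0 p)] at h1
    have h3 := rpow_eq_mul_rpow_sub_one h0.le hp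
    have h4 : (1 + p * (-h / (a + h))) * (a + h) ^ p = (a + h) ^ p - p * h * (a + h) ^ (p - 1) := by
      rw [h3]; field_simp; ring
    linarith

/-- If `b ≤ θ * a`, the factor `(1 + θ) ^ q` is at most `1 + d`; otherwise `a` is at most `b / θ`
and the second term suffices. Ages can thus be shifted at the price of a factor close to one. -/
theorem exists_add_rpow_le {q d : ℝ} (hq : 0 ≤ q) (hd : 0 < d) :
    ∃ C : ℝ, 0 ≤ C ∧ ∀ a b : ℝ, 0 ≤ a → 0 ≤ b → (a + b) ^ q ≤ (1 + d) * a ^ q + C * b ^ q := by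
  obtain ⟨θ, hθ, hθd⟩ : ∃ θ : ℝ, 0 < θ ∧ (1 + θ) ^ q ≤ 1 + d := by
    rcases hq.eq_or_lt with rfl | hq
    · exact ⟨1, one_pos, by simp [hd.le]⟩
    · refine ⟨(1 + d) ^ q⁻¹ - 1, ?_, ?_⟩
      · linarith [Real.one_lt_rpow (show (1 : ℝ) < 1 + d by linarith) (inv_pos.2 hq)]
      · rw [add_sub_cancel, ← Real.rpow_mul (by linarith), inv_mul_cancel₀ hq.ne', Real.rpow_one]
  refine ⟨(1 / θ + 1) ^ q, by positivity, fun a b ha hb => ?_⟩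
  have h1 : 0 ≤ a ^ q := Real.rpow_nonneg ha q
  have h2 : 0 ≤ b ^ q := Real.rpow_nonneg hb q
  have h3 : 0 ≤ (1 / θ + 1) ^ q := by positivity
  rcases le_total b (θ * a) with h | h
  · calc (a + b) ^ q ≤ ((1 + θ) * a) ^ q := Real.rpow_le_rpow (by positivity) (by linarith) hq
      _ = (1 + θ) ^ q * a ^ q := Real.mul_rpow (by positivity) ha
      _ ≤ (1 + d) * a ^ q := by gcongr
      _ ≤ _ := by nlinarith
  · have hab : a ≤ 1 / θ * b := by
      rw [div_mul_eq_mul_div, one_mul, le_div_iff₀ hθ]; linarith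
    calc (a + b) ^ q ≤ ((1 / θ + 1) * b) ^ q :=
          Real.rpow_le_rpow (by positivity) (by linarith) hq
      _ = (1 / θ + 1) ^ q * b ^ q := Real.mul_rpow (by positivity) hb
      _ ≤ _ := by nlinarith

/-! ### Length and cost of a tour -/

/-- The length of the path that starts at `x` and visits the tasks of a list in order. -/
def pathLen : Plane → List (ℝ × Plane) → ℝ
  | _, [] => 0
  | x, (_, y) :: l => dist x y + pathLen y l

/-- The last position of the path that starts at `x` and visits the tasks of a list in order. -/
def lastPos : Plane → List (ℝ × Plane) → Plane
  | x, [] => x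
  | _, (_, y) :: l => lastPos y l

/-- The sum of the `q`-th powers of the waiting times, all of them increased by `a`. -/
def powSum (q a : ℝ) (l : List (ℝ × Plane)) : ℝ := (l.map fun z => (z.1 + a) ^ q).sum

@[simp] theorem powSum_nil (q a : ℝ) : powSum q a [] = 0 := rfl

@[simp] theorem powSum_cons (q a : ℝ) (z : ℝ × Plane) (l : List (ℝ × Plane)) :
    powSum q a (z :: l) = (z.1 + a) ^ q + powSum q a l := by simp [powSum]

@[simp] theorem powSum_append (q a : ℝ) (l l' : List (ℝ × Plane)) :
    powSum q a (l ++ l') = powSum q a l + powSum q a l' := by simp [powSum]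

theorem powSum_perm (q a : ℝ) {l l' : List (ℝ × Plane)} (h : l.Perm l') :
    powSum q a l = powSum q a l' := (h.map _).sum_eq

/-- The tasks of a list lie in `A` and have waited for nonnegative times. -/
def Admissible (A : Set Plane) (l : List (ℝ × Plane)) : Prop := ∀ z ∈ l, 0 ≤ z.1 ∧ z.2 ∈ A

theorem admissible_cons {A : Set Plane} {z : ℝ × Plane} {l : List (ℝ × Plane)} :
    Admissible A (z :: l) ↔ (0 ≤ z.1 ∧ z.2 ∈ A) ∧ Admissible A l := by simp [Admissible]

theorem admissible_append {A : Set Plane} {l l' : List (ℝ × Plane)} :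
    Admissible A (l ++ l') ↔ Admissible A l ∧ Admissible A l' := by
  simp only [Admissible, List.mem_append]
  constructor
  · exact fun h => ⟨fun z hz => h z (.inl hz), fun z hz => h z (.inr hz)⟩
  · rintro ⟨h1, h2⟩ z (hz | hz)
    exacts [h1 z hz, h2 z hz]

theorem Admissible.perm {A : Set Plane} {l l' : List (ℝ × Plane)} (h : Admissible A l)
    (hl : l'.Perm l) : Admissible A l' := fun z hz => h z (hl.mem_iff.1 hz)

theorem powSum_nonneg {A : Set Plane} {q a : ℝ} (ha : 0 ≤ a) {l : List (ℝ × Plane)}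
    (hl : Admissible A l) : 0 ≤ powSum q a l :=
  List.sum_nonneg fun _ hx => by
    obtain ⟨z, hz, rfl⟩ := List.mem_map.1 hx
    exact Real.rpow_nonneg (add_nonneg (hl z hz).1 ha) _

theorem powSum_le_mul {A : Set Plane} {q q' a b c : ℝ} {l : List (ℝ × Plane)}
    (hl : Admissible A l) (h : ∀ t : ℝ, 0 ≤ t → (t + a) ^ q ≤ c * (t + b) ^ q') :
    powSum q a l ≤ c * powSum q' b l := by
  induction l with
  | nil => simp
  | cons z l ih =>
    rw [admissible_cons] at hl
    simp only [powSum_cons, mul_add]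
    exact add_le_add (h _ hl.1.1) (ih hl.2)

theorem powSum_sub_le {A : Set Plane} {p a h : ℝ} (hp : 1 ≤ p) (ha : 0 ≤ a) (hh : 0 ≤ h)
    {l : List (ℝ × Plane)} (hl : Admissible A l) :
    powSum p (a + h) l - powSum p a l ≤ p * h * powSum (p - 1) (a + h) l := by
  induction l with
  | nil => simp
  | cons z l ih =>
    rw [admissible_cons] at hl
    simp only [powSum_cons, mul_add]
    have := add_rpow_sub_rpow_le hp (add_nonneg hl.1.1 ha) hh
    rw [add_assoc] at this
    linarith [ih hl.2]

theorem pathLen_append (x : Plane) (l l' : List (ℝ × Plane)) :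
    pathLen x (l ++ l') = pathLen x l + pathLen (lastPos x l) l' := by
  induction l generalizing x with
  | nil => simp [pathLen, lastPos]
  | cons z l ih => simp [pathLen, lastPos, ih, add_assoc]

theorem pathLen_nonneg (x : Plane) (l : List (ℝ × Plane)) : 0 ≤ pathLen x l := by
  induction l generalizing x with
  | nil => simp [pathLen]
  | cons z l ih => exact add_nonneg dist_nonneg (ih _)

theorem lastPos_mem {A : Set Plane} {x : Plane} (hx : x ∈ A) {l : List (ℝ × Plane)}
    (hl : Admissible A l) : lastPos x l ∈ A := by
  induction l generalizing x with
  | nil => exact hx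
  | cons z l ih =>
    rw [admissible_cons] at hl
    exact ih hl.1.2 hl.2

theorem pathLen_le {A : Set Plane} {D : ℝ} (hD : ∀ a ∈ A, ∀ b ∈ A, dist a b ≤ D) {x : Plane}
    (hx : x ∈ A) {l : List (ℝ × Plane)} (hl : Admissible A l) : pathLen x l ≤ l.length * D := by
  induction l generalizing x with
  | nil => simp [pathLen]
  | cons z l ih =>
    rw [admissible_cons] at hl
    have := ih hl.1.2 hl.2
    have := hD x hx z.2 hl.1.2
    simp only [pathLen, List.length_cons]
    push_cast
    linarith

theorem dist_lastPos_le (x : Plane) (l : List (ℝ × Plane)) : dist x (lastPos x l) ≤ pathLen x l := by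
  induction l generalizing x with
  | nil => simp [pathLen, lastPos]
  | cons z l ih =>
    have := ih z.2
    have := dist_triangle x z.2 (lastPos z.2 l)
    simp only [pathLen, lastPos]
    linarith

theorem costSum_append (p s e : ℝ) (x : Plane) (l l' : List (ℝ × Plane)) :
    costSum p s e x (l ++ l') = costSum p s e x l +
      costSum p s (e + (pathLen x l + l.length * s)) (lastPos x l) l' := by
  induction l generalizing e x with
  | nil => simp [pathLen, lastPos, costSum]
  | cons z l ih =>
    simp only [List.cons_append, costSum, ih, pathLen, lastPos, List.length_cons, add_assoc]
    congr 4
    push_cast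
    ring

theorem costSum_nonneg {A : Set Plane} {p s e : ℝ} {x : Plane} {l : List (ℝ × Plane)}
    (hs : 0 ≤ s) (he : 0 ≤ e) (hl : Admissible A l) : 0 ≤ costSum p s e x l := by
  induction l generalizing e x with
  | nil => simp [costSum]
  | cons z l ih =>
    rw [admissible_cons] at hl
    have h : 0 ≤ e + dist x z.2 + s := by positivity
    exact add_nonneg (Real.rpow_nonneg (add_nonneg hl.1.1 h) _) (ih h hl.2)

/-- All completions happen within `l.length * (D + s)` of the elapsed time. Together with
`powSum_le_costSum` this sandwiches the cost between sums that ignore the order of the tasks. -/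
theorem costSum_le_powSum {A : Set Plane} {D : ℝ} (hD : ∀ a ∈ A, ∀ b ∈ A, dist a b ≤ D)
    {q s e a : ℝ} (hq : 0 ≤ q) (hs : 0 ≤ s) (he : 0 ≤ e) {x : Plane} (hx : x ∈ A)
    {l : List (ℝ × Plane)} (hl : Admissible A l) (ha : e + l.length * (D + s) ≤ a) :
    costSum q s e x l ≤ powSum q a l := by
  induction l generalizing e x with
  | nil => simp [costSum]
  | cons z l ih =>
    rw [admissible_cons] at hl
    have h : 0 ≤ e + dist x z.2 + s := by positivity
    have h1 := hD x hx z.2 hl.1.2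
    have hD0 : 0 ≤ D := dist_nonneg.trans h1
    simp only [List.length_cons] at ha
    push_cast at ha
    simp only [costSum, powSum_cons]
    have h2 : 0 ≤ (l.length : ℝ) * (D + s) := by positivity
    refine add_le_add (Real.rpow_le_rpow (add_nonneg hl.1.1 h) (by linarith) hq)
      (ih h hl.1.2 hl.2 (by linarith))

theorem powSum_le_costSum {A : Set Plane} {q s e a : ℝ} (hq : 0 ≤ q) (hs : 0 ≤ s) {x : Plane}
    {l : List (ℝ × Plane)} (hl : Admissible A l) (ha0 : 0 ≤ a) (ha : a ≤ e + s) :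
    powSum q a l ≤ costSum q s e x l := by
  induction l generalizing e x with
  | nil => simp [costSum]
  | cons z l ih =>
    rw [admissible_cons] at hl
    have h1 : 0 ≤ dist x z.2 := dist_nonneg
    simp only [costSum, powSum_cons]
    exact add_le_add (Real.rpow_le_rpow (add_nonneg hl.1.1 ha0) (by linarith) hq)
      (ih hl.2 (by linarith))

/-- If every task of a list is served earlier by `d`, then the cost decreases accordingly. -/
theorem mul_costSum_le_costSum_sub_costSum {A : Set Plane} {p s e e' d : ℝ} {x x' : Plane}
    {l : List (ℝ × Plane)} (hp : 1 ≤ p) (hs : 0 ≤ s) (he' : 0 ≤ e') (hd : 0 ≤ d)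
    (hl : Admissible A l) (h : e' + dist x' x + d ≤ e) :
    d * costSum (p - 1) s e x l ≤ costSum p s e x l - costSum p s e' x' l := by
  induction l generalizing e e' x x' with
  | nil => simp [costSum]
  | cons z l ih =>
    rw [admissible_cons] at hl
    have h1 := dist_triangle x' x z.2
    have h2 : 0 ≤ e' + dist x' z.2 + s := by positivity
    have h3 := mul_rpow_sub_one_le_rpow_sub_rpow (u := z.1 + (e + dist x z.2 + s))
      (v := z.1 + (e' + dist x' z.2 + s)) hp (add_nonneg hl.1.1 h2) hd (by linarith)
    -- After the first common task both paths are at the same point, so the gap `d` simply persists.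
    have h4 := ih (x := z.2) (x' := z.2) (e := e + dist x z.2 + s) h2 hl.2
      (by rw [dist_self]; linarith)
    simp only [costSum, mul_add]
    linarith

/-! ### Short paths through many points of a bounded set -/

/-- Visit the sets of the cover one after the other: one jump of length at most `D` per set, then at
most `ε` per task. The order does not depend on the starting point. -/
theorem exists_perm_pathLen_le_of_cover {A : Set Plane} {D ε : ℝ} (hε : 0 ≤ ε)
    (hD : ∀ a ∈ A, ∀ b ∈ A, dist a b ≤ D) (F : List (Set Plane))
    (hF : ∀ U ∈ F, ∀ a ∈ U, ∀ b ∈ U, dist a b ≤ ε) (l : List (ℝ × Plane)) (hl : Admissible A l)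
    (hc : ∀ z ∈ l, ∃ U ∈ F, z.2 ∈ U) :
    ∃ l' : List (ℝ × Plane), l'.Perm l ∧ ∀ x ∈ A, pathLen x l' ≤ ε * l.length + F.length * D := by
  induction F generalizing l with
  | nil =>
    have : l = [] := List.eq_nil_iff_forall_not_mem.2 fun z hz => by simpa using hc z hz
    subst this
    exact ⟨[], .refl _, fun x _ => by simp [pathLen]⟩
  | cons U F ih =>
    classical
    have key : ∀ (m : List (ℝ × Plane)), (∀ z ∈ m, z.2 ∈ U) → ∀ x ∈ U, pathLen x m ≤ ε * m.length := by
      intro m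
      induction m with
      | nil => simp [pathLen]
      | cons z m ihm =>
        intro hm x hx
        have h1 := hF U (by simp) x hx z.2 (hm z (by simp))
        have h2 := ihm (fun y hy => hm y (by simp [hy])) z.2 (hm z (by simp))
        simp only [pathLen, List.length_cons]
        push_cast
        linarith
    have hperm := List.filter_append_perm (fun z : ℝ × Plane => decide (z.2 ∈ U)) l
    set l1 := l.filter fun z => decide (z.2 ∈ U) with hl1
    set l2 := l.filter fun z => !decide (z.2 ∈ U) with hl2
    have h12 : Admissible A (l1 ++ l2) := hl.perm hperm
    rw [admissible_append] at h12
    obtain ⟨l2', hp2, hlen2⟩ := ih (fun V hV => hF V (by simp [hV])) l2 h12.2 (by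
      intro z hz
      simp only [hl2, List.mem_filter] at hz
      obtain ⟨V, hV, hzV⟩ := hc z hz.1
      rcases List.mem_cons.1 hV with rfl | hV
      · simp [hzV] at hz
      · exact ⟨V, hV, hzV⟩)
    refine ⟨l1 ++ l2', (hp2.append_left l1).trans hperm, fun x hx => ?_⟩
    have hlen : (l.length : ℝ) = l1.length + l2.length := by
      rw [← hperm.length_eq]; simp
    have h1 : pathLen x l1 ≤ D + ε * l1.length := by
      rcases hm : l1 with _ | ⟨z, m⟩
      · simpa [pathLen] using dist_nonneg.trans (hD x hx x hx)
      · have hmem : ∀ y ∈ z :: m, y.2 ∈ U := fun y hy => by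
          rw [← hm] at hy
          simpa using (List.mem_filter.1 hy).2
        have h3 := key m (fun y hy => hmem y (by simp [hy])) z.2 (hmem z (by simp))
        have h4 := hD x hx z.2 (h12.1 z (by simp [hm])).2
        simp only [pathLen, List.length_cons]
        push_cast
        linarith
    have h2 := hlen2 _ (lastPos_mem hx h12.1)
    rw [pathLen_append, hlen, List.length_cons]
    push_cast
    linarith

theorem exists_perm_pathLen_le {A : Set Plane} {D ε : ℝ} (hA : Bornology.IsBounded A) (hε : 0 < ε)
    (hD : ∀ a ∈ A, ∀ b ∈ A, dist a b ≤ D) :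
    ∃ C : ℝ, 0 ≤ C ∧ ∀ l : List (ℝ × Plane), Admissible A l →
      ∃ l' : List (ℝ × Plane), l'.Perm l ∧ ∀ x ∈ A, pathLen x l' ≤ ε * l.length + C := by
  have htb : TotallyBounded A := hA.isCompact_closure.totallyBounded.subset subset_closure
  obtain ⟨t, ht, hcov⟩ := Metric.totallyBounded_iff.1 htb (ε / 2) (by positivity)
  set F : List (Set Plane) := ht.toFinset.toList.map fun y => Metric.ball y (ε / 2)
  -- The number of jumps depends on the cover alone, not on the tour. The absolute value allows for
  -- a negative `D`, which is possible when `A` is empty.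
  refine ⟨F.length * |D|, by positivity, fun l hl => ?_⟩
  obtain ⟨l', h1, h2⟩ := exists_perm_pathLen_le_of_cover (D := |D|) hε.le
    (fun a ha b hb => (hD a ha b hb).trans (le_abs_self D)) F
    (by
      intro U hU a ha b hb
      obtain ⟨y, -, rfl⟩ := List.mem_map.1 hU
      have := dist_triangle_right a b y
      rw [Metric.mem_ball] at ha hb
      linarith) l hl
    (by
      intro z hz
      obtain ⟨y, hy, hzy⟩ := Set.mem_iUnion₂.1 (hcov (hl z hz).2)
      exact ⟨Metric.ball y (ε / 2), List.mem_map.2 ⟨y, by simpa using hy, rfl⟩, hzy⟩)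
  exact ⟨l', h1, h2⟩

section

/-! ### Optimal tours -/

/-- The tour `l`, started at `x` when the time `e` has elapsed, has minimal cost among all
orderings of its tasks. -/
def IsOptimal (p s e : ℝ) (x : Plane) (l : List (ℝ × Plane)) : Prop :=
  ∀ l' : List (ℝ × Plane), l'.Perm l → costSum p s e x l ≤ costSum p s e x l'

/-- Principle of optimality. It is the reason why the elapsed time is a parameter of `IsOptimal`. -/
theorem IsOptimal.of_append {p s e : ℝ} {x : Plane} {l l' : List (ℝ × Plane)}
    (h : IsOptimal p s e x (l ++ l')) :
    IsOptimal p s (e + (pathLen x l + l.length * s)) (lastPos x l) l' := fun m hm => by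
  have := h (l ++ m) (hm.append_left l)
  rw [costSum_append, costSum_append] at this
  linarith

section

variable {A : Set Plane} {D : ℝ}

/-- If the first block of an optimal tour is much longer than necessary, then it carries a
definite proportion of the weight of the tour. -/
theorem IsOptimal.costSum_le_of_long_block (hD : ∀ a ∈ A, ∀ b ∈ A, dist a b ≤ D) {p s e c : ℝ}
    (hp : 1 ≤ p) (hs : 0 < s) (he : 0 ≤ e) {x : Plane} (hx : x ∈ A) {B B' J : List (ℝ × Plane)}
    (hB : Admissible A B) (hJ : Admissible A J) (hopt : IsOptimal p s e x (B ++ J))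
    (hB' : B'.Perm B) (hlen : pathLen x B' ≤ c) (hlong : c + D + 1 ≤ pathLen x B) :
    costSum (p - 1) s (e + (pathLen x B + B.length * s)) (lastPos x B) J ≤
      p * (B.length * (D + s)) * (1 + B.length * (D + s) / s) ^ (p - 1) *
        costSum (p - 1) s e x B := by
  have hD0 : 0 ≤ D := dist_nonneg.trans (hD x hx x hx)
  have hBA' := hB.perm hB'
  have h1 := hopt (B' ++ J) (hB'.append_right J)
  rw [costSum_append, costSum_append] at h1
  -- Of the saved length `D + 1`, the part `D` covers the distance between the end points of the two
  -- orders of the block. The remaining unit is gained by every task of `J`.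
  have h2 := mul_costSum_le_costSum_sub_costSum (p := p) (s := s) (d := 1)
    (e := e + (pathLen x B + B.length * s)) (e' := e + (pathLen x B' + B'.length * s))
    (x := lastPos x B) (x' := lastPos x B') hp hs.le
    (by have := pathLen_nonneg x B'; positivity) zero_le_one hJ (by
      have := hD _ (lastPos_mem hx hBA') _ (lastPos_mem hx hB)
      rw [hB'.length_eq]
      linarith)
  set H := B.length * (D + s) with hH
  have hH0 : 0 ≤ H := by positivity
  have h3 : costSum p s e x B' ≤ powSum p (e + H) B := by
    rw [← powSum_perm p _ hB']
    exact costSum_le_powSum hD (by linarith) hs.le he hx hBA' (by rw [hB'.length_eq])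
  have h4 : powSum p e B ≤ costSum p s e x B :=
    powSum_le_costSum (by linarith) hs.le hB he (by linarith)
  have h5 := powSum_sub_le hp he hH0 hB
  -- Here `t + e + H ≤ (1 + H / s) * (t + e + s)`, so changing the shift costs a constant factor
  -- only.
  have h6 : powSum (p - 1) (e + H) B ≤ (1 + H / s) ^ (p - 1) * powSum (p - 1) (e + s) B := by
    refine powSum_le_mul hB fun t ht => ?_
    rw [← Real.mul_rpow (by positivity) (by positivity)]
    refine Real.rpow_le_rpow (by positivity) ?_ (by linarith)
    have : H / s * s = H := by field_simp
    have : 0 ≤ H / s * (t + e) := by positivity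
    nlinarith
  have h7 : powSum (p - 1) (e + s) B ≤ costSum (p - 1) s e x B :=
    powSum_le_costSum (by linarith) hs.le hB (by positivity) le_rfl
  have h8 : p * H * powSum (p - 1) (e + H) B ≤
      p * H * ((1 + H / s) ^ (p - 1) * costSum (p - 1) s e x B) := by
    gcongr
    exact h6.trans (by gcongr)
  linarith

/-- The length of an optimal tour is small compared with the number of tasks, up to a term that
is logarithmic in the weight of the tour. -/
theorem exists_pathLen_le_log (hA : Bornology.IsBounded A)
    (hD : ∀ a ∈ A, ∀ b ∈ A, dist a b ≤ D) {p s ε : ℝ} (hp : 1 ≤ p) (hs : 0 < s) (hε : 0 < ε) :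
    ∃ K₀ K₁ : ℝ, 0 ≤ K₀ ∧ 0 ≤ K₁ ∧ ∀ (l : List (ℝ × Plane)) (e : ℝ) (x : Plane), 0 ≤ e → x ∈ A →
      Admissible A l → IsOptimal p s e x l → l ≠ [] → pathLen x l ≤
        ε * l.length + K₀ + K₁ * Real.log (costSum (p - 1) s e x l / s ^ (p - 1)) := by
  rcases A.eq_empty_or_nonempty with rfl | ⟨a₀, ha₀⟩
  · exact ⟨0, 0, le_rfl, le_rfl, fun _ _ _ _ hx => hx.elim⟩
  have hD0 : 0 ≤ D := dist_nonneg.trans (hD a₀ ha₀ a₀ ha₀)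
  obtain ⟨C₁, hC₁, hshort⟩ := exists_perm_pathLen_le hA (half_pos hε) hD
  -- The blocks are so long that the overhead `C₁ + D + 1` is at most `ε / 2` per task.
  obtain ⟨k, hk⟩ := exists_nat_gt ((C₁ + D + 1) / (ε / 2))
  have hk' : C₁ + D + 1 ≤ ε / 2 * k := by
    rw [div_lt_iff₀ (by positivity)] at hk; linarith
  have hk0 : 0 < k := by
    rcases Nat.eq_zero_or_pos k with rfl | h
    · simp at hk'; linarith
    · exact h
  set q := p - 1 with hq
  have hq0 : 0 ≤ q := by linarith
  set C := p * (k * (D + s)) * (1 + k * (D + s) / s) ^ q + 1 with hC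
  have hCpos : 0 < C := by positivity
  have hlogC : 0 < Real.log (1 + 1 / C) := Real.log_pos (by linarith [one_div_pos.2 hCpos])
  have hsq : 0 < s ^ q := Real.rpow_pos_of_pos hs q
  -- Every completion takes at least `s`, so the normalized weight of a nonempty tour is at least
  -- one and its logarithm is nonnegative.
  have hlow : ∀ (l : List (ℝ × Plane)) (e : ℝ) (x : Plane), 0 ≤ e → Admissible A l → l ≠ [] →
      s ^ q ≤ costSum q s e x l := by
    intro l e x he hl hne
    refine le_trans ?_ (powSum_le_costSum (a := s) hq0 hs.le hl hs.le (by linarith))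
    obtain ⟨z, m, rfl⟩ := List.exists_cons_of_ne_nil hne
    rw [admissible_cons] at hl
    rw [powSum_cons]
    have := powSum_nonneg (q := q) hs.le hl.2
    have := Real.rpow_le_rpow hs.le (show s ≤ z.1 + s by linarith [hl.1.1]) hq0
    linarith
  -- The first constant pays for a last piece of at most `k` tasks. The second is chosen so that a
  -- decrease of the logarithm by `log (1 + 1 / C)` pays for one long block.
  refine ⟨k * D, k * D / Real.log (1 + 1 / C), by positivity, by positivity, fun l => ?_⟩
  induction hn : l.length using Nat.strong_induction_on generalizing l with
  | _ n ih =>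
  intro e x he hx hl hopt hne
  have hS := hlow l e x he hl hne
  have hlogS : 0 ≤ Real.log (costSum q s e x l / s ^ q) :=
    Real.log_nonneg (by rwa [le_div_iff₀ hsq, one_mul])
  rcases le_or_gt n k with hnk | hnk
  · have h1 := pathLen_le hD hx hl
    have h2 : (l.length : ℝ) * D ≤ k * D := by
      gcongr; omega
    have h3 : 0 ≤ k * D / Real.log (1 + 1 / C) * Real.log (costSum q s e x l / s ^ q) := by
      positivity
    have : 0 ≤ ε * n := by positivity
    linarith
  · obtain ⟨B, J, rfl, hBk⟩ : ∃ B J, l = B ++ J ∧ B.length = k :=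
      ⟨l.take k, l.drop k, (List.take_append_drop k l).symm, by simp; omega⟩
    have hl' := admissible_append.1 hl
    have hJlen : J.length = n - k := by simp at hn; omega
    have hJne : J ≠ [] := by rintro rfl; simp at hJlen; omega
    set e₁ := e + (pathLen x B + B.length * s) with he₁
    have he₁0 : 0 ≤ e₁ := by have := pathLen_nonneg x B; positivity
    have hIH := ih (n - k) (by omega) J hJlen e₁ (lastPos x B) he₁0 (lastPos_mem hx hl'.1) hl'.2
      hopt.of_append hJne
    have hSJ := hlow J e₁ (lastPos x B) he₁0 hl'.2 hJne
    have hSB : 0 ≤ costSum q s e x B := costSum_nonneg hs.le he hl'.1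
    have hsum : costSum q s e x (B ++ J) = costSum q s e x B + costSum q s e₁ (lastPos x B) J :=
      costSum_append q s e x B J
    set SB := costSum q s e x B
    set SJ := costSum q s e₁ (lastPos x B) J
    have hSJpos : 0 < SJ := hsq.trans_le hSJ
    rw [pathLen_append, hsum]
    have hnk' : ((n - k : ℕ) : ℝ) = n - k := by push_cast [hnk.le]; ring
    rw [hnk'] at hIH
    obtain ⟨B', hB', hlen⟩ := hshort B hl'.1
    have hlenx := hlen x hx
    rw [hBk] at hlenx
    -- Removing a long block divides the weight by at least `1 + 1 / C`; any other block has length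
    -- at most `ε * k`.
    rcases le_or_gt (ε / 2 * k + C₁ + D + 1) (pathLen x B) with hlong | hgood
    · have h1 := hopt.costSum_le_of_long_block hD hp hs he hx hl'.1 hl'.2 hB' hlenx hlong
      rw [hBk] at h1
      have h2 : SJ ≤ C * SB := by
        have : C * SB = p * (k * (D + s)) * (1 + k * (D + s) / s) ^ q * SB + SB := by
          rw [hC]; ring
        rw [this]
        have h1' : SJ ≤ p * (k * (D + s)) * (1 + k * (D + s) / s) ^ q * SB := by
          simpa only [SJ, he₁, hBk] using h1
        linarith
      have h3 : (1 + 1 / C) * (SJ / s ^ q) ≤ (SB + SJ) / s ^ q := by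
        rw [← mul_div_assoc, div_le_div_iff_of_pos_right hsq, add_mul, one_mul, add_comm SB SJ]
        gcongr
        rw [div_mul_eq_mul_div, one_mul, div_le_iff₀ hCpos]
        linarith
      have h4 : Real.log (1 + 1 / C) + Real.log (SJ / s ^ q) ≤ Real.log ((SB + SJ) / s ^ q) := by
        rw [← Real.log_mul (by positivity) (by positivity)]
        exact Real.log_le_log (by positivity) h3
      have h5 := pathLen_le hD hx hl'.1
      rw [hBk] at h5
      have h6 : k * D / Real.log (1 + 1 / C) * (Real.log (1 + 1 / C) + Real.log (SJ / s ^ q)) ≤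
          k * D / Real.log (1 + 1 / C) * Real.log ((SB + SJ) / s ^ q) := by gcongr
      rw [mul_add, div_mul_cancel₀ _ hlogC.ne'] at h6
      have : 0 ≤ ε * k := by positivity
      linarith
    · have h4 : Real.log (SJ / s ^ q) ≤ Real.log ((SB + SJ) / s ^ q) :=
        Real.log_le_log (by positivity) (by gcongr; linarith)
      have h6 : k * D / Real.log (1 + 1 / C) * Real.log (SJ / s ^ q) ≤
          k * D / Real.log (1 + 1 / C) * Real.log ((SB + SJ) / s ^ q) := by gcongr
      linarith

/-- The first part of an optimal tour carries a definite proportion of the weight. -/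
theorem exists_powSum_le_of_isOptimal (hD : ∀ a ∈ A, ∀ b ∈ A, dist a b ≤ D) {p s η : ℝ}
    (hp : 1 ≤ p) (hs : 0 < s) (hη : 0 < η) :
    ∃ C : ℝ, 0 ≤ C ∧ ∀ (x : Plane) (F G : List (ℝ × Plane)), x ∈ A → Admissible A F →
      Admissible A G → IsOptimal p s 0 x (F ++ G) → η * (F ++ G).length ≤ F.length →
        powSum (p - 1) (F ++ G).length G ≤ C * powSum (p - 1) (F ++ G).length F := by
  rcases A.eq_empty_or_nonempty with rfl | ⟨a₀, ha₀⟩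
  · exact ⟨0, le_rfl, fun _ _ _ hx => hx.elim⟩
  have hD0 : 0 ≤ D := dist_nonneg.trans (hD a₀ ha₀ a₀ ha₀)
  set q := p - 1 with hq
  have hq0 : 0 ≤ q := by linarith
  set c := (1 + 1 / (η * s)) ^ q with hc
  have hcpos : 0 < c := by positivity
  set d := (1 + (D + s)) ^ q with hd
  have hdpos : 0 < d := by positivity
  refine ⟨c * (p * (D + s) * d) / (η * s), by positivity, fun x F G hx hF hG hopt hlen => ?_⟩
  set n : ℝ := ((F ++ G).length : ℝ) with hn
  rcases Nat.eq_zero_or_pos (F ++ G).length with h0 | hpos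
  · rw [List.length_eq_zero_iff, List.append_eq_nil_iff] at h0
    simp [h0.1, h0.2]
  have hnpos : 0 < n := by rw [hn]; exact_mod_cast hpos
  have hnFG : n = F.length + G.length := by simp [hn]
  have h1 := hopt (G ++ F) List.perm_append_comm
  rw [costSum_append, costSum_append] at h1
  set e₁ := 0 + (pathLen x F + F.length * s) with he₁
  set e₂ := 0 + (pathLen x G + G.length * s) with he₂
  -- When `G` goes first, each of its tasks is served earlier by at least the predicted services of
  -- `F`.
  have h2 := mul_costSum_le_costSum_sub_costSum (p := p) (s := s) (d := F.length * s)
    (e := e₁) (e' := 0) (x := lastPos x F) (x' := x) hp hs.le le_rfl (by positivity) hG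
    (by have := dist_lastPos_le x F; linarith)
  have hGlen := pathLen_le hD hx hG
  have h3 : costSum p s e₂ (lastPos x G) F ≤ powSum p (0 + n * (D + s)) F :=
    costSum_le_powSum hD (by linarith) hs.le
      (by have := pathLen_nonneg x G; positivity) (lastPos_mem hx hG) hF
      (by rw [hnFG, he₂]; nlinarith)
  have h4 : powSum p 0 F ≤ costSum p s 0 x F :=
    powSum_le_costSum (by linarith) hs.le hF le_rfl (by linarith)
  have h5 := powSum_sub_le (h := n * (D + s)) hp le_rfl (by positivity) hF
  have h6 : powSum q (0 + n * (D + s)) F ≤ d * powSum q n F := by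
    refine powSum_le_mul hF fun t ht => ?_
    rw [hd, ← Real.mul_rpow (by positivity) (by positivity)]
    refine Real.rpow_le_rpow (by positivity) ?_ hq0
    have : 0 ≤ (D + s) * t := by positivity
    nlinarith
  have h7 : powSum q (F.length * s) G ≤ costSum q s e₁ (lastPos x F) G :=
    powSum_le_costSum hq0 hs.le hG (by positivity)
      (by have := pathLen_nonneg x F; linarith)
  have h8 : powSum q n G ≤ c * powSum q (F.length * s) G := by
    refine powSum_le_mul hG fun t ht => ?_
    rw [hc, ← Real.mul_rpow (by positivity) (by positivity)]
    refine Real.rpow_le_rpow (by positivity) ?_ hq0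
    have e1 : 1 / (η * s) * (η * n * s) = n := by field_simp
    have e2 : 1 / (η * s) * (η * n * s) ≤ 1 / (η * s) * (F.length * s) := by gcongr
    have e3 : 0 ≤ 1 / (η * s) * t := by positivity
    have e4 : 0 ≤ (F.length : ℝ) * s := by positivity
    nlinarith
  have h9 : η * n * s * costSum q s e₁ (lastPos x F) G ≤
      F.length * s * costSum q s e₁ (lastPos x F) G := by
    have : 0 ≤ costSum q s e₁ (lastPos x F) G :=
      costSum_nonneg hs.le (by have := pathLen_nonneg x F; positivity) hG
    gcongr
  have h10 : p * (n * (D + s)) * powSum q (0 + n * (D + s)) F ≤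
      p * (n * (D + s)) * (d * powSum q n F) := by gcongr
  -- Gain and loss are both proportional to `n`, which cancels. Shifting the ages by `n` is what
  -- makes the powers comparable, since the delays involved are of order `n`.
  have h11 : n * (η * s * costSum q s e₁ (lastPos x F) G) ≤
      n * (p * (D + s) * (d * powSum q n F)) := by linarith
  have h12 := le_of_mul_le_mul_left h11 hnpos
  calc powSum q n G ≤ c * costSum q s e₁ (lastPos x F) G := h8.trans (by gcongr)
    _ = c * (η * s * costSum q s e₁ (lastPos x F) G) / (η * s) := by field_simp
    _ ≤ c * (p * (D + s) * (d * powSum q n F)) / (η * s) := by gcongr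
    _ = _ := by ring

end

end

section

/-! ### Rearrangements of a tuple -/

/-- Different tasks may carry equal data, so a rearrangement of the data does not determine one of
the tasks; induction along the permutation chooses one. -/
theorem exists_perm_map_eq {α β : Type*} {f : α → β} {l' l : List β} (h : l'.Perm l) :
    ∀ m : List α, l = m.map f → ∃ m' : List α, m'.Perm m ∧ m'.map f = l' := by
  induction h with
  | nil => exact fun m _ => ⟨[], by simp_all, rfl⟩
  | cons x _ ih =>
    intro m hm
    obtain ⟨a, m₁, rfl, rfl, hm₁⟩ := List.map_eq_cons_iff.1 hm.symm
    obtain ⟨m', h1, h2⟩ := ih m₁ hm₁.symm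
    exact ⟨a :: m', h1.cons a, by simp [h2]⟩
  | swap x y l =>
    intro m hm
    obtain ⟨a, m₁, rfl, rfl, hm₁⟩ := List.map_eq_cons_iff.1 hm.symm
    obtain ⟨b, m₂, rfl, rfl, hm₂⟩ := List.map_eq_cons_iff.1 hm₁
    exact ⟨b :: a :: m₂, .swap _ _ _, by simp [hm₂]⟩
  | trans _ _ ih₁ ih₂ =>
    intro m hm
    obtain ⟨m', h1, h2⟩ := ih₂ m hm
    obtain ⟨m'', h3, h4⟩ := ih₁ m' h2.symm
    exact ⟨m'', h3.trans h1, h4⟩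

/-- The exchange arguments rearrange lists, whereas a planner minimizes over `Equiv.Perm`; this
passes from one to the other. -/
theorem exists_equiv_of_perm_ofFn {β : Type*} {n : ℕ} {T : Fin n → β} {l : List β}
    (h : l.Perm (List.ofFn T)) : ∃ π : Equiv.Perm (Fin n), l = List.ofFn fun i => T (π i) := by
  rw [List.ofFn_eq_map] at h
  obtain ⟨m, hm, rfl⟩ := exists_perm_map_eq h _ rfl
  have hlen : m.length = n := by simpa using hm.length_eq
  have hnd : m.Nodup := hm.nodup_iff.2 (List.nodup_finRange n)
  refine ⟨(finCongr hlen.symm).trans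
    (hnd.getEquivOfForallMemList m fun i => hm.mem_iff.2 (List.mem_finRange i)), ?_⟩
  apply List.ext_getElem
  · simp [hlen]
  · intro i h1 h2
    simp [List.Nodup.getEquivOfForallMemList]

/-! ### The queue and the tour -/

namespace Scenario

variable (w : Scenario) (pl : Planner) (η : ℝ)

/-- The data of the tasks that are passed to the planner: latent wait time and location. -/
def data (s : State) (j : ℕ) : ℝ × Plane := (s.time - w.arr j, w.loc j)

theorem nodup_queue (s : State) : (w.queue s).Nodup := List.nodup_range.filter _

theorem tour_perm (s : State) : (w.tour pl s).Perm (w.queue s) := by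
  have := Equiv.Perm.ofFn_comp_perm (pl (w.queue s).length s.pos
      (fun i => (s.time - w.arr ((w.queue s).get i), w.loc ((w.queue s).get i)))) (w.queue s).get
  rwa [List.ofFn_get] at this

theorem nodup_tour (s : State) : (w.tour pl s).Nodup :=
  (w.tour_perm pl s).nodup_iff.2 (w.nodup_queue s)

theorem tour_eq_fragment_append (s : State) :
    w.tour pl s = w.fragment pl η s ++ (w.tour pl s).drop ⌈η * (w.queue s).length⌉₊ :=
  (List.take_append_drop _ _).symm

theorem nodup_fragment (s : State) : (w.fragment pl η s).Nodup :=
  (w.nodup_tour pl s).sublist (List.take_sublist _ _)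

theorem mem_queue_of_mem_fragment {s : State} {j : ℕ} (h : j ∈ w.fragment pl η s) :
    j ∈ w.queue s := (w.tour_perm pl s).mem_iff.1 (List.mem_of_mem_take h)

theorem length_fragment (s : State) :
    (w.fragment pl η s).length = min ⌈η * (w.queue s).length⌉₊ (w.queue s).length := by
  simp [fragment, (w.tour_perm pl s).length_eq]

theorem min_mul_length_le (s : State) :
    min 1 η * (w.queue s).length ≤ (w.fragment pl η s).length := by
  have h0 : (0 : ℝ) ≤ (w.queue s).length := by positivity
  rw [length_fragment, Nat.cast_min, le_min_iff]
  exact ⟨(mul_le_mul_of_nonneg_right (min_le_right _ _) h0).trans (Nat.le_ceil _),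
    (mul_le_mul_of_nonneg_right (min_le_left _ _) h0).trans (one_mul _).le⟩

theorem fragment_ne_nil (hη : 0 < η) {s : State} (h : w.queue s ≠ []) :
    w.fragment pl η s ≠ [] := by
  intro h0
  have h1 := w.min_mul_length_le pl η s
  have h2 : 0 < (w.queue s).length := List.length_pos_iff.2 h
  rw [h0, List.length_nil, Nat.cast_zero] at h1
  have : 0 < min 1 η * ((w.queue s).length : ℝ) := by positivity
  linarith

/-- The power `1 / p` is strictly increasing on nonnegative numbers, so it can be dropped from the
minimization. -/
theorem isOptimal_tour {p sbar : ℝ} (hp : 1 ≤ p) (hs : 0 ≤ sbar) (hpl : pl.Minimizes p sbar)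
    {s : State} (hage : ∀ j ∈ w.queue s, 0 ≤ s.time - w.arr j) :
    IsOptimal p sbar 0 s.pos ((w.tour pl s).map (w.data s)) := by
  intro l' hl'
  set T : Fin (w.queue s).length → ℝ × Plane := fun i => w.data s ((w.queue s).get i) with hT
  have h1 : (w.tour pl s).map (w.data s) = List.ofFn fun i => T (pl _ s.pos T i) := by
    simp only [tour, List.map_ofFn]
    rfl
  have h2 : l'.Perm (List.ofFn T) := by
    refine hl'.trans ?_
    rw [h1]
    exact Equiv.Perm.ofFn_comp_perm _ T
  obtain ⟨π, rfl⟩ := exists_equiv_of_perm_ofFn h2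
  have h3 := hpl _ s.pos T (fun i => hage _ (List.get_mem _ i)) π
  rw [h1]
  have hT0 : ∀ σ : Equiv.Perm (Fin (w.queue s).length),
      0 ≤ costSum p sbar 0 s.pos (List.ofFn fun i => T (σ i)) := fun σ =>
    costSum_nonneg (A := Set.univ) hs le_rfl fun z hz => by
      obtain ⟨i, rfl⟩ := List.mem_ofFn.1 hz
      exact ⟨hage _ (List.get_mem _ _), trivial⟩
  exact (Real.rpow_le_rpow_iff (hT0 _) (hT0 _) (by positivity)).1 h3

theorem endTime_eq (s : State) (t : ℝ) (x : Plane) (l : List ℕ) :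
    w.endTime t x l = t + pathLen x (l.map (w.data s)) + (l.map w.serv).sum := by
  induction l generalizing t x with
  | nil => simp [endTime, pathLen]
  | cons j l ih =>
    simp only [endTime, ih, List.map_cons, pathLen, List.sum_cons, data]
    ring

theorem endPos_eq (s : State) (x : Plane) (l : List ℕ) :
    w.endPos x l = lastPos x (l.map (w.data s)) := by
  induction l generalizing x with
  | nil => rfl
  | cons j l ih => simpa [endPos, lastPos, data] using ih _

/-! ### Regular realizations -/

/-- Properties that almost all realizations have. -/
structure IsRegular (A : Set Plane) : Prop where
  serv_nonneg : ∀ j, 0 ≤ w.serv j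
  loc_mem : ∀ j, w.loc j ∈ A
  arr_lt : ∀ i j, i < j → w.arr i ≤ 0 ∨ w.arr i < w.arr j
  finite : ∀ t, {j | w.arr j ≤ t}.Finite

/-- The vehicle is in `A`, and the served tasks have arrived. -/
structure IsValid (A : Set Plane) (s : State) : Prop where
  time_nonneg : 0 ≤ s.time
  pos_mem : s.pos ∈ A
  arr_le : ∀ j ∈ s.served, w.arr j ≤ s.time

variable {w} {A : Set Plane}

/-- Labels may be out of order only among arrivals at nonpositive times. From time zero on, the
labels that have arrived therefore form an initial segment. -/
theorem IsRegular.arr_le_iff (hw : w.IsRegular A) {t : ℝ} (ht : 0 ≤ t) (j : ℕ) :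
    w.arr j ≤ t ↔ j < w.numArrived t := by
  have hfin := hw.finite t
  have hex : ∃ n, ¬ w.arr n ≤ t := by
    by_contra! h
    exact Set.infinite_univ (hfin.subset fun n _ => h n)
  obtain ⟨n, hf, hmin⟩ : ∃ n, ¬ w.arr n ≤ t ∧ ∀ m < n, w.arr m ≤ t := by
    classical
    exact ⟨Nat.find hex, Nat.find_spec hex, fun m hm => not_not.1 (Nat.find_min hex hm)⟩
  have hset : {j | w.arr j ≤ t} = Set.Iio n := by
    ext j
    simp only [Set.mem_ofPred_eq, Set.mem_Iio]
    refine ⟨fun hj => ?_, hmin j⟩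
    by_contra! hlt
    rcases hlt.eq_or_lt with rfl | h
    · exact hf hj
    · rcases hw.arr_lt _ _ h with h | h <;> exact hf (by linarith)
  have hn : w.numArrived t = n := by
    rw [numArrived, hset, ← Finset.coe_Iio, Set.ncard_coe_finset, Nat.card_Iio]
  rw [hn, ← Set.mem_Iio, ← hset, Set.mem_ofPred_eq]

theorem IsRegular.numArrived_mono (hw : w.IsRegular A) : Monotone w.numArrived := fun _ t h =>
  Set.ncard_le_ncard (fun _ hj => le_trans hj h) (hw.finite t)

theorem IsRegular.lt_arr_numArrived (hw : w.IsRegular A) {t : ℝ} (ht : 0 ≤ t) :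
    t < w.arr (w.numArrived t) := by
  by_contra! h
  exact lt_irrefl _ ((hw.arr_le_iff ht _).1 h)

theorem IsRegular.mem_queue (hw : w.IsRegular A) {s : State} (hs : w.IsValid A s) {j : ℕ} :
    j ∈ w.queue s ↔ w.arr j ≤ s.time ∧ j ∉ s.served := by
  simp [queue, hw.arr_le_iff hs.time_nonneg]

theorem IsRegular.age_nonneg (hw : w.IsRegular A) {s : State} (hs : w.IsValid A s) {j : ℕ}
    (hj : j ∈ w.queue s) : 0 ≤ s.time - w.arr j :=
  sub_nonneg.2 ((hw.mem_queue hs).1 hj).1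

theorem IsRegular.admissible (hw : w.IsRegular A) {s : State} (hs : w.IsValid A s) {l : List ℕ}
    (hl : ∀ j ∈ l, j ∈ w.queue s) : Admissible A (l.map (w.data s)) := fun z hz => by
  obtain ⟨j, hj, rfl⟩ := List.mem_map.1 hz
  exact ⟨hw.age_nonneg hs (hl j hj), hw.loc_mem j⟩

variable {pl η}

theorem IsRegular.serv_sum_nonneg (hw : w.IsRegular A) (l : List ℕ) : 0 ≤ (l.map w.serv).sum :=
  List.sum_nonneg fun _ hx => by
    obtain ⟨j, -, rfl⟩ := List.mem_map.1 hx
    exact hw.serv_nonneg j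

theorem IsRegular.le_endTime (hw : w.IsRegular A) (t : ℝ) (x : Plane) (l : List ℕ) :
    t ≤ w.endTime t x l := by
  rw [w.endTime_eq ⟨0, x, ∅⟩]
  have := pathLen_nonneg x (l.map (w.data ⟨0, x, ∅⟩))
  have := hw.serv_sum_nonneg l
  linarith

variable {xw : Plane}

theorem IsRegular.time_le_time_step (hw : w.IsRegular A) {s : State} (hs : w.IsValid A s) :
    s.time ≤ (w.step pl η xw s).time := by
  rw [step]
  split_ifs with h
  · exact (hw.lt_arr_numArrived hs.time_nonneg).le
  · exact hw.le_endTime _ _ _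

theorem IsRegular.isValid_step (hw : w.IsRegular A) (hA : Convex ℝ A) (hxw : xw ∈ A) {s : State}
    (hs : w.IsValid A s) : w.IsValid A (w.step pl η xw s) := by
  have hle := hw.time_le_time_step (pl := pl) (η := η) (xw := xw) hs
  refine ⟨hs.time_nonneg.trans hle, ?_, ?_⟩
  · rw [step]
    split_ifs with h
    · have h1 := (hw.lt_arr_numArrived hs.time_nonneg).le
      exact hA.lineMap_mem hs.pos_mem hxw
        ⟨le_min zero_le_one (div_nonneg (sub_nonneg.2 h1) dist_nonneg), min_le_left _ _⟩
    · dsimp only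
      rw [w.endPos_eq s]
      exact lastPos_mem hs.pos_mem
        (hw.admissible hs fun j hj => w.mem_queue_of_mem_fragment pl η hj)
  · intro j hj
    refine le_trans ?_ hle
    rw [step] at hj
    split_ifs at hj with h
    · exact hs.arr_le j hj
    · rcases Finset.mem_union.1 hj with hj | hj
      · exact hs.arr_le j hj
      · exact ((hw.mem_queue hs).1
          (w.mem_queue_of_mem_fragment pl η (List.mem_toFinset.1 hj))).1

variable {x₀ : Plane}

theorem state_succ (w : Scenario) (pl : Planner) (η : ℝ) (x₀ xw : Plane) (k : ℕ) :
    w.state pl η x₀ xw (k + 1) = w.step pl η xw (w.state pl η x₀ xw k) :=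
  Function.iterate_succ_apply' _ _ _

theorem IsRegular.isValid_state (hw : w.IsRegular A) (hA : Convex ℝ A) (hxw : xw ∈ A)
    (hx₀ : x₀ ∈ A) (k : ℕ) : w.IsValid A (w.state pl η x₀ xw k) := by
  induction k with
  | zero => exact ⟨le_rfl, hx₀, fun _ h => by simp [state] at h⟩
  | succ k ih => rw [state_succ]; exact hw.isValid_step hA hxw ih

/-- The set of outstanding tasks at the beginning of an iteration. -/
def outstanding (w : Scenario) (s : State) : Finset ℕ := (w.queue s).toFinset

theorem card_outstanding (w : Scenario) (s : State) :
    (w.outstanding s).card = (w.queue s).length :=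
  List.toFinset_card_of_nodup (w.nodup_queue s)

theorem outstanding_eq (w : Scenario) (s : State) :
    w.outstanding s = Finset.range (w.numArrived s.time) \ s.served := by
  ext j; simp [outstanding, queue]

theorem outstanding_eq_empty {s : State} : w.outstanding s = ∅ ↔ w.queue s = [] := by
  simp [outstanding]

theorem fragment_subset (w : Scenario) (pl : Planner) (η : ℝ) (s : State) :
    (w.fragment pl η s).toFinset ⊆ w.outstanding s := fun j hj => by
  rw [List.mem_toFinset] at hj
  exact List.mem_toFinset.2 (w.mem_queue_of_mem_fragment pl η hj)

theorem IsRegular.outstanding_step (hw : w.IsRegular A) {s : State} (hs : w.IsValid A s)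
    (h : w.queue s ≠ []) :
    w.outstanding (w.step pl η xw s) = (w.outstanding s \ (w.fragment pl η s).toFinset) ∪
      Finset.Ico (w.numArrived s.time) (w.numArrived (w.step pl η xw s).time) := by
  have hle := hw.numArrived_mono (hw.time_le_time_step (pl := pl) (η := η) (xw := xw) hs)
  have hserved : (w.step pl η xw s).served = s.served ∪ (w.fragment pl η s).toFinset := by
    rw [step, if_neg h]
  rw [outstanding_eq, outstanding_eq, hserved]
  ext j
  simp only [Finset.mem_sdiff, Finset.mem_range, Finset.mem_union, Finset.mem_Ico, List.mem_toFinset]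
  have h1 : j ∈ s.served → j < w.numArrived s.time := fun hj =>
    (hw.arr_le_iff hs.time_nonneg j).1 (hs.arr_le j hj)
  have h2 : j ∈ w.fragment pl η s → j < w.numArrived s.time := fun hj =>
    (hw.arr_le_iff hs.time_nonneg j).1
      ((hw.mem_queue hs).1 (w.mem_queue_of_mem_fragment pl η hj)).1
  constructor
  · rintro ⟨h3, h4⟩
    push Not at h4
    by_cases h5 : j < w.numArrived s.time
    · exact .inl ⟨⟨h5, h4.1⟩, h4.2⟩
    · exact .inr ⟨not_lt.1 h5, h3⟩
  · rintro (⟨⟨h3, h4⟩, h5⟩ | ⟨h3, h4⟩)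
    · exact ⟨h3.trans_le hle, not_or.2 ⟨h4, h5⟩⟩
    · exact ⟨h4, fun h => (not_lt.2 h3) (h.elim h1 h2)⟩

theorem IsRegular.sum_outstanding_step (hw : w.IsRegular A) {s : State} (hs : w.IsValid A s)
    (h : w.queue s ≠ []) (g : ℕ → ℝ) :
    ∑ j ∈ w.outstanding (w.step pl η xw s), g j =
      ∑ j ∈ w.outstanding s, g j - ((w.fragment pl η s).map g).sum +
        ∑ j ∈ Finset.Ico (w.numArrived s.time) (w.numArrived (w.step pl η xw s).time), g j := by
  rw [hw.outstanding_step hs h, Finset.sum_union, ← Finset.sum_sdiff (w.fragment_subset pl η s),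
    List.sum_toFinset g (w.nodup_fragment pl η s)]
  · ring
  · rw [Finset.disjoint_left]
    intro j hj hj'
    have := (Finset.mem_sdiff.1 hj).1
    rw [outstanding_eq, Finset.mem_sdiff, Finset.mem_range] at this
    exact (not_lt.2 (Finset.mem_Ico.1 hj').1) this.1

/-- If the queue is empty, then it consists of a single task at the beginning of the next
iteration, which has just arrived. -/
theorem IsRegular.outstanding_step_of_queue_eq_nil (hw : w.IsRegular A) {s : State}
    (hs : w.IsValid A s) (h : w.queue s = []) :
    (w.step pl η xw s).time = w.arr (w.numArrived s.time) ∧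
      w.outstanding (w.step pl η xw s) = {w.numArrived s.time} := by
  have h1 : w.step pl η xw s = { time := w.arr (w.numArrived s.time)
                                 pos := AffineMap.lineMap s.pos xw
                                  (min 1 ((w.arr (w.numArrived s.time) - s.time) / dist s.pos xw))
                                 served := s.served } := by
    rw [step, if_pos h]
  have hlt := hw.lt_arr_numArrived hs.time_nonneg
  have h2 := outstanding_eq_empty.2 h
  refine ⟨by rw [h1], ?_⟩
  rw [outstanding_eq, h1]
  dsimp only
  have h0 : 0 ≤ w.arr (w.numArrived s.time) := hs.time_nonneg.trans hlt.le
  ext j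
  rw [Finset.mem_sdiff, Finset.mem_range, Finset.mem_singleton, ← hw.arr_le_iff h0]
  constructor
  · rintro ⟨h3, h4⟩
    have h5 : ¬ j < w.numArrived s.time := fun h5 => by
      have : j ∈ w.outstanding s := by
        rw [outstanding_eq, Finset.mem_sdiff, Finset.mem_range]; exact ⟨h5, h4⟩
      simp [h2] at this
    rcases (not_lt.1 h5).eq_or_lt with h6 | h6
    · exact h6.symm
    · have := hs.time_nonneg
      rcases hw.arr_lt _ _ h6 with h7 | h7 <;> linarith
  · rintro rfl
    exact ⟨le_rfl, fun h3 => by linarith [hs.arr_le _ h3]⟩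

end Scenario

end

section

namespace Scenario

/-! ### The weight of a state -/

/-- The sum of the `q`-th powers of the waiting times of the outstanding tasks, all of them
increased by the number of outstanding tasks. -/
def weight (w : Scenario) (q : ℝ) (s : State) : ℝ :=
  powSum q (w.queue s).length ((w.queue s).map (w.data s))

/-- The weight with exponent `p - 1`, normalized to degree one. -/
def weightRoot (w : Scenario) (p : ℝ) (s : State) : ℝ := (w.weight (p - 1) s) ^ (1 / p)

theorem weight_eq_sum (w : Scenario) (q : ℝ) (s : State) :
    w.weight q s =
      ∑ j ∈ w.outstanding s, (s.time - w.arr j + ((w.outstanding s).card : ℝ)) ^ q := by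
  rw [outstanding, List.sum_toFinset _ (w.nodup_queue s), ← outstanding, card_outstanding, weight,
    powSum, List.map_map]
  rfl

variable {w : Scenario} {pl : Planner} {η : ℝ} {A : Set Plane} {xw x₀ : Plane} {D p sbar : ℝ}

theorem IsRegular.weight_nonneg (hw : w.IsRegular A) {s : State} (hs : w.IsValid A s) (q : ℝ) :
    0 ≤ w.weight q s :=
  powSum_nonneg (Nat.cast_nonneg _) (hw.admissible hs fun _ h => h)

theorem IsRegular.weightRoot_nonneg (hw : w.IsRegular A) {s : State} (hs : w.IsValid A s)
    (p : ℝ) : 0 ≤ w.weightRoot p s := Real.rpow_nonneg (hw.weight_nonneg hs _) _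

theorem weight_eq_tour (w : Scenario) (pl : Planner) (q : ℝ) (s : State) :
    w.weight q s = powSum q (w.queue s).length ((w.tour pl s).map (w.data s)) :=
  (powSum_perm _ _ ((w.tour_perm pl s).map _)).symm

/-- The distance that the vehicle travels during one iteration is small compared with the
number of outstanding tasks and the weight of the state. -/
theorem exists_pathLen_fragment_le (hA : Bornology.IsBounded A)
    (hD : ∀ a ∈ A, ∀ b ∈ A, dist a b ≤ D) (hp : 1 ≤ p) (hs : 0 < sbar)
    (hpl : pl.Minimizes p sbar) (η : ℝ) {ε δ : ℝ} (hε : 0 < ε) (hδ : 0 < δ) :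
    ∃ C : ℝ, 0 ≤ C ∧ ∀ (w : Scenario) (s : State), w.IsRegular A → w.IsValid A s →
      w.queue s ≠ [] → pathLen s.pos ((w.fragment pl η s).map (w.data s)) ≤
        ε * (w.queue s).length + δ * w.weightRoot p s + C := by
  obtain ⟨K₀, K₁, hK₀, hK₁, hK⟩ := exists_pathLen_le_log hA hD hp hs hε
  set q := p - 1 with hq
  have hq0 : 0 ≤ q := by linarith
  -- The inequality `log y ≤ a * y + |log a|` trades the logarithm for a small multiple of
  -- `weightRoot`; this slope gives `K₁ * p * a ≤ δ`.
  set a := δ / (K₁ * p + 1) with ha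
  have hden : 0 < K₁ * p + 1 := by positivity
  have ha0 : 0 < a := by positivity
  set c := (1 + (|D| + sbar)) ^ q / sbar ^ q with hc
  have hc0 : 0 < c := by positivity
  refine ⟨K₀ + K₁ * (|Real.log c| + p * |Real.log a|), by positivity, fun w s hw hv hne => ?_⟩
  set l := (w.tour pl s).map (w.data s) with hl
  have hadm : Admissible A l :=
    hw.admissible hv fun j hj => (w.tour_perm pl s).mem_iff.1 hj
  have hopt := w.isOptimal_tour pl hp hs.le hpl fun j hj => hw.age_nonneg hv hj
  have hlen : l.length = (w.queue s).length := by
    rw [hl, List.length_map, (w.tour_perm pl s).length_eq]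
  have hlne : l ≠ [] := by
    rw [← List.length_pos_iff, hlen]; exact List.length_pos_iff.2 hne
  have h1 := hK l 0 s.pos le_rfl hv.pos_mem hadm hopt hlne
  have h2 : pathLen s.pos ((w.fragment pl η s).map (w.data s)) ≤ pathLen s.pos l := by
    rw [hl, w.tour_eq_fragment_append pl η s, List.map_append, pathLen_append]
    linarith [pathLen_nonneg (lastPos s.pos ((w.fragment pl η s).map (w.data s)))
      (((w.tour pl s).drop ⌈η * (w.queue s).length⌉₊).map (w.data s))]
  set W := w.weight q s with hW
  set n : ℝ := ((w.queue s).length : ℝ) with hn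
  have hn0 : 0 ≤ n := Nat.cast_nonneg _
  have hsq : 0 < sbar ^ q := Real.rpow_pos_of_pos hs q
  have h3 : costSum q sbar 0 s.pos l ≤ (1 + (|D| + sbar)) ^ q * W := by
    refine (costSum_le_powSum (D := |D|) (a := n * (|D| + sbar))
      (fun a ha b hb => (hD a ha b hb).trans (le_abs_self D)) hq0 hs.le
      le_rfl hv.pos_mem hadm (by rw [hlen, zero_add])).trans ?_
    rw [hW, w.weight_eq_tour pl]
    refine powSum_le_mul hadm fun t ht => ?_
    rw [← Real.mul_rpow (by positivity) (by positivity)]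
    refine Real.rpow_le_rpow (by positivity) ?_ hq0
    have : 0 ≤ (|D| + sbar) * t := by positivity
    nlinarith
  have h4 : 0 < costSum q sbar 0 s.pos l := by
    refine lt_of_lt_of_le ?_ (powSum_le_costSum (a := sbar) hq0 hs.le hadm hs.le (by linarith))
    obtain ⟨z, m, hzm⟩ := List.exists_cons_of_ne_nil hlne
    rw [hzm] at hadm ⊢
    rw [admissible_cons] at hadm
    rw [powSum_cons]
    have := powSum_nonneg (q := q) hs.le hadm.2
    have := Real.rpow_pos_of_pos (show 0 < z.1 + sbar by linarith [hadm.1.1]) q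
    linarith
  have hWpos : 0 < W := by
    by_contra! h
    have : (1 + (|D| + sbar)) ^ q * W ≤ 0 := mul_nonpos_of_nonneg_of_nonpos (by positivity) h
    linarith
  set y := w.weightRoot p s with hy
  have hy0 : 0 < y := Real.rpow_pos_of_pos hWpos _
  have h5 : Real.log W = p * Real.log y := by
    rw [hy, weightRoot, Real.log_rpow hWpos]
    field_simp
  have h6 : Real.log y ≤ a * y + |Real.log a| := by
    have := Real.log_le_sub_one_of_pos (mul_pos ha0 hy0)
    rw [Real.log_mul ha0.ne' hy0.ne'] at this
    linarith [neg_abs_le (Real.log a)]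
  have h7 : Real.log (costSum q sbar 0 s.pos l / sbar ^ q) ≤
      |Real.log c| + p * (a * y + |Real.log a|) := by
    calc Real.log (costSum q sbar 0 s.pos l / sbar ^ q) ≤ Real.log (c * W) := by
          refine Real.log_le_log (by positivity) ?_
          rw [hc, div_mul_eq_mul_div]
          gcongr
      _ = Real.log c + p * Real.log y := by rw [Real.log_mul hc0.ne' hWpos.ne', h5]
      _ ≤ _ := by gcongr; exact le_abs_self _
  have h8 : K₁ * Real.log (costSum q sbar 0 s.pos l / sbar ^ q) ≤
      K₁ * (|Real.log c| + p * (a * y + |Real.log a|)) := by gcongr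
  have h9 : K₁ * p * a * y ≤ δ * y := by
    gcongr
    rw [ha, mul_div_assoc', div_le_iff₀ hden]
    nlinarith
  rw [hlen] at h1
  linarith

/-- The weight decreases geometrically, up to a term that is linear in the duration of the
iteration, the number of outstanding tasks and the number of new tasks. -/
theorem exists_weightRoot_step_le (hcv : Convex ℝ A) (hD : ∀ a ∈ A, ∀ b ∈ A, dist a b ≤ D) (hp : 1 ≤ p)
    (hs : 0 < sbar) (hpl : pl.Minimizes p sbar) (hη : 0 < η) :
    ∃ r C : ℝ, 0 ≤ r ∧ r < 1 ∧ 0 ≤ C ∧ ∀ (w : Scenario) (xw : Plane) (s : State), w.IsRegular A →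
      xw ∈ A → w.IsValid A s → w.queue s ≠ [] →
        w.weightRoot p (w.step pl η xw s) ≤ r * w.weightRoot p s +
          C * ((w.step pl η xw s).time - s.time + (w.queue s).length +
            (Finset.Ico (w.numArrived s.time)
              (w.numArrived (w.step pl η xw s).time)).card) := by
  have hη' : 0 < min 1 η := by positivity
  obtain ⟨C, hC, hfrac⟩ := exists_powSum_le_of_isOptimal hD hp hs hη'
  set q := p - 1 with hq
  have hq0 : 0 ≤ q := by linarith
  -- The unserved part has at most the proportion `C / (1 + C)` of the weight; `d` is so small that
  -- a factor `1 + d` keeps this below one.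
  obtain ⟨d, hd⟩ : ∃ d, d = 1 / (2 * (1 + C)) := ⟨_, rfl⟩
  have hd0 : 0 < d := by rw [hd]; positivity
  obtain ⟨C', hC', hadd⟩ := exists_add_rpow_le hq0 hd0
  obtain ⟨r₀, hr₀⟩ : ∃ r₀, r₀ = (1 + d) * (C / (1 + C)) := ⟨_, rfl⟩
  have hr₀0 : 0 ≤ r₀ := by rw [hr₀]; positivity
  have hr₀1 : r₀ < 1 := by
    rw [hr₀, hd, mul_div_assoc', div_lt_one (by positivity)]
    have : (1 + 1 / (2 * (1 + C))) * C = C + C / (2 * (1 + C)) := by ring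
    have : C / (2 * (1 + C)) ≤ 1 / 2 := by
      rw [div_le_div_iff₀ (by positivity) (by positivity)]; linarith
    linarith
  have hp0 : 0 < 1 / p := by positivity
  refine ⟨r₀ ^ (1 / p), (C' + 1) ^ (1 / p), by positivity, Real.rpow_lt_one hr₀0 hr₀1 hp0,
    by positivity, fun w xw s hw hxw hv hne => ?_⟩
  set s' := w.step pl η xw s with hs'
  set I := Finset.Ico (w.numArrived s.time) (w.numArrived s'.time) with hI
  set n : ℝ := ((w.queue s).length : ℝ) with hn
  have hn0 : 0 ≤ n := Nat.cast_nonneg _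
  set τ := s'.time - s.time with hτ
  have hτ0 : 0 ≤ τ := sub_nonneg.2 (hw.time_le_time_step hv)
  obtain ⟨Y, hY⟩ : ∃ Y : ℝ, Y = τ + n + I.card := ⟨_, rfl⟩
  have hY0 : 0 ≤ Y := by rw [hY]; positivity
  rw [← hY]
  set F := w.fragment pl η s with hF
  set G := (w.tour pl s).drop ⌈η * (w.queue s).length⌉₊ with hG
  have hFG : w.tour pl s = F ++ G := w.tour_eq_fragment_append pl η s
  have hmemFG : ∀ j ∈ F ++ G, j ∈ w.queue s := fun j hj => by
    rw [← hFG] at hj; exact (w.tour_perm pl s).mem_iff.1 hj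
  have hFA : Admissible A (F.map (w.data s)) :=
    hw.admissible hv fun j hj => hmemFG j (List.mem_append_left _ hj)
  have hGA : Admissible A (G.map (w.data s)) :=
    hw.admissible hv fun j hj => hmemFG j (List.mem_append_right _ hj)
  have hopt := w.isOptimal_tour pl hp hs.le hpl fun j hj => hw.age_nonneg hv hj
  have hlen : (F ++ G).length = (w.queue s).length := by
    rw [← hFG, (w.tour_perm pl s).length_eq]
  rw [hFG, List.map_append] at hopt
  have hlen' : ((F.map (w.data s) ++ G.map (w.data s)).length : ℝ) = n := by
    rw [← List.map_append, List.length_map, hlen]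
  have h1 := hfrac s.pos (F.map (w.data s)) (G.map (w.data s)) hv.pos_mem hFA hGA hopt (by
    rw [hlen', List.length_map]
    exact w.min_mul_length_le pl η s)
  rw [hlen'] at h1
  have h2 : w.weight q s = powSum q n (F.map (w.data s)) + powSum q n (G.map (w.data s)) := by
    rw [w.weight_eq_tour pl, hFG, List.map_append, powSum_append]
  set WG := powSum q n (G.map (w.data s)) with hWG
  have h3 : WG ≤ C / (1 + C) * w.weight q s := by
    rw [div_mul_eq_mul_div, le_div_iff₀ (by positivity), h2]
    linarith
  obtain ⟨n', hn'⟩ : ∃ n' : ℝ, n' = ((w.outstanding s').card : ℝ) := ⟨_, rfl⟩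
  have hn'0 : 0 ≤ n' := hn' ▸ Nat.cast_nonneg _
  have hn'le : n' ≤ n + I.card := by
    have : n' = ∑ j ∈ w.outstanding s', (1 : ℝ) := by simp [hn']
    rw [this, hw.sum_outstanding_step hv hne]
    have h4 : 0 ≤ (F.map fun _ => (1 : ℝ)).sum := List.sum_nonneg fun x hx => by
      obtain ⟨j, -, rfl⟩ := List.mem_map.1 hx
      exact zero_le_one
    simp only [Finset.sum_const, nsmul_eq_mul, mul_one, w.card_outstanding]
    linarith
  -- In the new weight an unserved old task contributes its old age increased by `X`, and a new task
  -- contributes at most `X`.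
  obtain ⟨X, hX⟩ : ∃ X, X = τ + n' := ⟨_, rfl⟩
  have hX0 : 0 ≤ X := hX ▸ add_nonneg hτ0 hn'0
  have hXY : X ^ q ≤ Y ^ q := Real.rpow_le_rpow hX0 (by linarith) hq0
  have h4 : w.weight q s' = powSum q X (G.map (w.data s)) +
      ∑ j ∈ I, (s'.time - w.arr j + n') ^ q := by
    rw [weight_eq_sum, ← hn', hw.sum_outstanding_step hv hne, outstanding,
      List.sum_toFinset _ (w.nodup_queue s), ← ((w.tour_perm pl s).map _).sum_eq, hFG,
      List.map_append, List.sum_append, add_sub_cancel_left, powSum, List.map_map]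
    congr 2
    refine List.map_congr_left fun j _ => ?_
    simp only [Function.comp, data]
    congr 1
    rw [hX]
    ring
  have h5 : ∑ j ∈ I, (s'.time - w.arr j + n') ^ q ≤ I.card * Y ^ q := by
    rw [← nsmul_eq_mul]
    refine Finset.sum_le_card_nsmul _ _ _ fun j hj => le_trans ?_ hXY
    rw [hI, Finset.mem_Ico, ← not_lt, ← hw.arr_le_iff hv.time_nonneg,
      ← hw.arr_le_iff (hv.time_nonneg.trans (hw.time_le_time_step hv))] at hj
    exact Real.rpow_le_rpow (by linarith) (by linarith) hq0
  have h6 : ∀ l : List (ℝ × Plane), Admissible A l →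
      powSum q X l ≤ (1 + d) * powSum q n l + C' * l.length * Y ^ q := by
    intro l hl
    induction l with
    | nil => simp
    | cons z l ih =>
      rw [admissible_cons] at hl
      have e1 := hadd z.1 X hl.1.1 hX0
      have e2 : z.1 ^ q ≤ (z.1 + n) ^ q := Real.rpow_le_rpow hl.1.1 (by linarith) hq0
      have e3 := ih hl.2
      have e4 : (1 + d) * z.1 ^ q ≤ (1 + d) * (z.1 + n) ^ q := by gcongr
      have e5 : C' * X ^ q ≤ C' * Y ^ q := by gcongr
      simp only [powSum_cons, List.length_cons]
      push_cast
      linarith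
  have h7 := h6 _ hGA
  have hGn : ((G.map (w.data s)).length : ℝ) ≤ n := by
    rw [List.length_map, hn, ← hlen, List.length_append]
    push_cast
    linarith [(Nat.cast_nonneg F.length : (0 : ℝ) ≤ F.length)]
  have hYq : 0 ≤ Y ^ q := Real.rpow_nonneg hY0 q
  have h8 : w.weight q s' ≤ r₀ * w.weight q s + (C' + 1) * Y ^ p := by
    rw [rpow_eq_mul_rpow_sub_one hY0 hp, ← hq]
    have e1 : (1 + d) * WG ≤ r₀ * w.weight q s := by
      rw [hr₀, mul_assoc]; gcongr
    have e2 : C' * ((G.map (w.data s)).length : ℝ) * Y ^ q ≤ C' * n * Y ^ q := by gcongr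
    have e3 : (C' * n + I.card) * Y ^ q ≤ ((C' + 1) * Y) * Y ^ q := by
      gcongr
      have : 0 ≤ C' * (τ + I.card) := mul_nonneg hC' (add_nonneg hτ0 (Nat.cast_nonneg _))
      rw [hY]
      nlinarith
    linarith
  have hW0 := hw.weight_nonneg hv q
  -- Subadditivity of the power `1 / p` separates the two terms and turns `Y ^ p` into the linear
  -- error `Y`.
  calc w.weightRoot p s' ≤ (r₀ * w.weight q s + (C' + 1) * Y ^ p) ^ (1 / p) :=
        Real.rpow_le_rpow (hw.weight_nonneg (hw.isValid_step hcv hxw hv) _) h8 hp0.le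
    _ ≤ (r₀ * w.weight q s) ^ (1 / p) + ((C' + 1) * Y ^ p) ^ (1 / p) :=
        Real.rpow_add_le_add_rpow (by positivity) (by positivity) hp0.le
          (by rw [div_le_one (by linarith)]; exact hp)
    _ = _ := by
        rw [Real.mul_rpow hr₀0 hW0, Real.mul_rpow (by positivity) (by positivity),
          ← Real.rpow_mul hY0, mul_one_div_cancel (by linarith), Real.rpow_one]
        rfl

end Scenario

end

section

namespace Scenario

/-! ### The drift of the workload -/

/-- The total service time of the outstanding tasks, each increased by `b`. -/
def workload (w : Scenario) (b : ℝ) (s : State) : ℝ := ∑ j ∈ w.outstanding s, (w.serv j + b)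

/-- The total service time of the tasks that arrive between the times `t` and `t'`, each
increased by `b`. -/
def newWork (w : Scenario) (b t t' : ℝ) : ℝ :=
  ∑ j ∈ Finset.Ico (w.numArrived t) (w.numArrived t'), (w.serv j + b)

variable {w : Scenario} {pl : Planner} {η : ℝ} {A : Set Plane} {xw x₀ : Plane} {D p sbar : ℝ}

theorem newWork_eq (w : Scenario) (b b' t t' : ℝ) :
    w.newWork (b + b') t t' = w.newWork b t t' +
      (Finset.Ico (w.numArrived t) (w.numArrived t')).card * b' := by
  simp only [newWork, ← add_assoc]
  rw [Finset.sum_add_distrib, Finset.sum_const, nsmul_eq_mul]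

theorem IsRegular.newWork_add (hw : w.IsRegular A) (b : ℝ) {t t' t'' : ℝ} (h : t ≤ t')
    (h' : t' ≤ t'') : w.newWork b t t' + w.newWork b t' t'' = w.newWork b t t'' :=
  Finset.sum_Ico_consecutive _ (hw.numArrived_mono h) (hw.numArrived_mono h')

theorem sum_map_serv_add (w : Scenario) (b : ℝ) (l : List ℕ) :
    (l.map fun j => w.serv j + b).sum = (l.map w.serv).sum + l.length * b := by
  induction l with
  | nil => simp
  | cons j l ih =>
    simp only [List.map_cons, List.sum_cons, ih, List.length_cons]
    push_cast
    ring

theorem workload_eq (w : Scenario) (b : ℝ) (s : State) :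
    w.workload b s = ∑ j ∈ w.outstanding s, w.serv j + (w.queue s).length * b := by
  rw [workload, Finset.sum_add_distrib, Finset.sum_const, nsmul_eq_mul, w.card_outstanding]

theorem IsRegular.sum_fragment_le (hw : w.IsRegular A) (s : State) :
    ((w.fragment pl η s).map w.serv).sum ≤ ∑ j ∈ w.outstanding s, w.serv j := by
  rw [← List.sum_toFinset w.serv (w.nodup_fragment pl η s)]
  exact Finset.sum_le_sum_of_subset_of_nonneg (w.fragment_subset pl η s)
    fun j _ _ => hw.serv_nonneg j

theorem time_step_eq {s : State} (h : w.queue s ≠ []) :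
    (w.step pl η xw s).time = s.time + pathLen s.pos ((w.fragment pl η s).map (w.data s)) +
      ((w.fragment pl η s).map w.serv).sum := by
  rw [step, if_neg h, ← endTime_eq]

/-- The workload loses the services of the fragment, which equal the duration minus the travel.
Travel and the linear error of the weight are charged to the surcharges `ε`, to a fraction `ε` of
the duration and to the contraction of the weight. The separate travel bound serves times in the
middle of an iteration. -/
theorem exists_drift (hAb : Bornology.IsBounded A) (hcv : Convex ℝ A)
    (hD : ∀ a ∈ A, ∀ b ∈ A, dist a b ≤ D) (hp : 1 ≤ p) (hs : 0 < sbar)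
    (hpl : pl.Minimizes p sbar) (hη : 0 < η) {ε : ℝ} (hε : 0 < ε) :
    ∃ κ δ C : ℝ, 0 < δ ∧ δ ≤ κ ∧ 0 ≤ C ∧ ∀ (w : Scenario) (xw : Plane) (s : State),
      w.IsRegular A → xw ∈ A → w.IsValid A s → w.queue s ≠ [] →
      (w.workload ε (w.step pl η xw s) + κ * w.weightRoot p (w.step pl η xw s) ≤
        w.workload ε s + κ * w.weightRoot p s +
          w.newWork (2 * ε) s.time (w.step pl η xw s).time -
          (1 - ε) * ((w.step pl η xw s).time - s.time) -
          ε / 2 * (w.fragment pl η s).length - δ * w.weightRoot p s + C) ∧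
      pathLen s.pos ((w.fragment pl η s).map (w.data s)) ≤
        ε / 2 * (w.fragment pl η s).length + δ * w.weightRoot p s + C := by
  have hη' : 0 < min 1 η := by positivity
  obtain ⟨η', hη'def⟩ : ∃ η', η' = min 1 η := ⟨_, rfl⟩
  rw [← hη'def] at hη'
  have hη'1 : η' ≤ 1 := hη'def ▸ min_le_left _ _
  obtain ⟨r, C₃, hr0, hr1, hC₃, hweight⟩ := exists_weightRoot_step_le hcv hD hp hs hpl hη
  -- With this `κ` the error of the weight due to the old queue costs at most `ε / 4` per task of
  -- the fragment, because the fragment has at least the proportion `η'` of the queue.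
  obtain ⟨κ, hκ⟩ : ∃ κ, κ = η' * ε / (4 * (C₃ + 1)) := ⟨_, rfl⟩
  have hκ0 : 0 < κ := by rw [hκ]; positivity
  have hκC : κ * C₃ ≤ η' * ε / 4 := by
    rw [hκ, div_mul_eq_mul_div, div_le_div_iff₀ (by positivity) (by norm_num)]
    have : 0 ≤ η' * ε := by positivity
    nlinarith
  -- Half of the contraction of the weight pays for the travel; the other half is left as negative
  -- drift.
  have hδ : 0 < κ * (1 - r) / 2 := by
    have : 0 < 1 - r := by linarith
    positivity
  obtain ⟨C, hC, htravel⟩ := exists_pathLen_fragment_le hAb hD hp hs hpl η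
    (show 0 < η' * ε / 4 by positivity) hδ
  refine ⟨κ, κ * (1 - r) / 2, C, hδ, by nlinarith, hC, fun w xw s hw hxw hv hne => ?_⟩
  have h1 := htravel w s hw hv hne
  have h2 := hweight w xw s hw hxw hv hne
  have h3 := w.min_mul_length_le pl η s
  rw [← hη'def] at h3
  have h4 := time_step_eq (pl := pl) (η := η) (xw := xw) hne
  have h5 := hw.sum_outstanding_step (pl := pl) (η := η) (xw := xw) hv hne fun j => w.serv j + ε
  rw [sum_map_serv_add] at h5
  have h6 := hw.time_le_time_step (pl := pl) (η := η) (xw := xw) hv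
  have h7 := w.newWork_eq ε ε s.time (w.step pl η xw s).time
  rw [← two_mul] at h7
  change w.workload ε (w.step pl η xw s) = w.workload ε s - _ +
    w.newWork ε s.time (w.step pl η xw s).time at h5
  generalize w.step pl η xw s = s' at *
  generalize pathLen s.pos ((w.fragment pl η s).map (w.data s)) = L at *
  generalize ((w.fragment pl η s).map w.serv).sum = F at *
  generalize ((w.fragment pl η s).length : ℝ) = m at *
  generalize w.weightRoot p s = y at *
  generalize w.weightRoot p s' = y' at *
  have hn0 : (0 : ℝ) ≤ (w.queue s).length := Nat.cast_nonneg _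
  generalize ((w.queue s).length : ℝ) = n at *
  have hN0 : (0 : ℝ) ≤ ((Finset.Ico (w.numArrived s.time) (w.numArrived s'.time)).card : ℝ) :=
    Nat.cast_nonneg _
  generalize ((Finset.Ico (w.numArrived s.time) (w.numArrived s'.time)).card : ℝ) = N at *
  have h8 : η' * ε / 4 * n ≤ ε / 4 * m := by nlinarith
  have h9 : η' * ε / 4 ≤ ε := by nlinarith
  have h10 : κ * y' ≤ κ * (r * y + C₃ * (s'.time - s.time + n + N)) := by gcongr
  have h11 : κ * C₃ * (s'.time - s.time) ≤ ε * (s'.time - s.time) :=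
    mul_le_mul_of_nonneg_right (hκC.trans h9) (by linarith)
  have h12 : κ * C₃ * n ≤ η' * ε / 4 * n := mul_le_mul_of_nonneg_right hκC hn0
  -- Charging this to the new tasks raises their surcharge from `ε` to `2 * ε`.
  have h13 : κ * C₃ * N ≤ ε * N := mul_le_mul_of_nonneg_right (hκC.trans h9) hN0
  have hm : 0 ≤ ε * m := by
    have : 0 ≤ η' * ε / 4 * n := by positivity
    linarith
  constructor <;> nlinarith

/-! ### Completed tasks -/

theorem IsRegular.endTime_prefix_le (hw : w.IsRegular A) {l l' : List ℕ} (h : l <+: l')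
    (t : ℝ) (x : Plane) : w.endTime t x l ≤ w.endTime t x l' := by
  obtain ⟨m, rfl⟩ := h
  rw [w.endTime_eq ⟨0, x, ∅⟩, w.endTime_eq ⟨0, x, ∅⟩, List.map_append, pathLen_append,
    List.map_append, List.sum_append]
  have := pathLen_nonneg (lastPos x (l.map (w.data ⟨0, x, ∅⟩))) (m.map (w.data ⟨0, x, ∅⟩))
  have := hw.serv_sum_nonneg m
  linarith

theorem IsRegular.completedBy (hw : w.IsRegular A) (hcv : Convex ℝ A) (hxw : xw ∈ A)
    (hx₀ : x₀ ∈ A) {k j : ℕ} {t : ℝ} (hj : j ∈ (w.state pl η x₀ xw k).served)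
    (ht : (w.state pl η x₀ xw k).time ≤ t) : w.CompletedBy pl η x₀ xw j t := by
  induction k with
  | zero => simp [state] at hj
  | succ k ih =>
    have hle := hw.time_le_time_step (pl := pl) (η := η) (xw := xw)
      (hw.isValid_state (pl := pl) (η := η) hcv hxw hx₀ k)
    rw [state_succ] at hj ht
    have hk := hle.trans ht
    by_cases h : w.queue (w.state pl η x₀ xw k) = []
    · rw [step, if_pos h] at hj
      exact ih hj hk
    · rw [step, if_neg h] at hj ht
      rcases Finset.mem_union.1 hj with hj | hj
      · exact ih hj hk
      · obtain ⟨l, l', hl⟩ := List.append_of_mem (List.mem_toFinset.1 hj)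
        have hpre : l ++ [j] <+: w.fragment pl η (w.state pl η x₀ xw k) := ⟨l', by simp [hl]⟩
        exact ⟨k, l, hpre, (hw.endTime_prefix_le hpre _ _).trans ht⟩

/-! ### The number of iterations -/

theorem IsRegular.card_served_lt_step (hw : w.IsRegular A) (hη : 0 < η) {s : State}
    (hs : w.IsValid A s) (h : w.queue s ≠ []) :
    s.served.card < (w.step pl η xw s).served.card := by
  rw [step, if_neg h]
  dsimp only
  have h4 : Disjoint s.served (w.fragment pl η s).toFinset := by
    rw [Finset.disjoint_left]
    intro j hj hj'
    exact ((hw.mem_queue hs).1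
      (w.mem_queue_of_mem_fragment pl η (List.mem_toFinset.1 hj'))).2 hj
  have h5 : 0 < (w.fragment pl η s).toFinset.card := by
    rw [Finset.card_pos, List.toFinset_nonempty_iff]
    exact w.fragment_ne_nil pl η hη h
  rw [Finset.card_union_of_disjoint h4]
  omega

theorem served_subset_step (w : Scenario) (pl : Planner) (η : ℝ) (xw : Plane) (s : State) :
    s.served ⊆ (w.step pl η xw s).served := by
  rw [step]
  split_ifs
  exacts [subset_rfl, Finset.subset_union_left]

/-- An idle iteration ends with an arrival, so no two consecutive iterations serve nothing. Hence
only finitely many iterations can begin within a bounded time. -/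
theorem IsRegular.le_card_served (hw : w.IsRegular A) (hcv : Convex ℝ A) (hxw : xw ∈ A)
    (hx₀ : x₀ ∈ A) (hη : 0 < η) (k : ℕ) :
    k ≤ 2 * (w.state pl η x₀ xw k).served.card +
      (if w.queue (w.state pl η x₀ xw k) = [] then 0 else 1) := by
  induction k with
  | zero => simp
  | succ k ih =>
    have hv := hw.isValid_state (pl := pl) (η := η) hcv hxw hx₀ k
    rw [state_succ]
    generalize w.state pl η x₀ xw k = s at *
    by_cases h : w.queue s = []
    · rw [if_pos h] at ih
      have h1 := (hw.outstanding_step_of_queue_eq_nil (pl := pl) (η := η) (xw := xw) hv h).2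
      have h2 : w.queue (w.step pl η xw s) ≠ [] := by
        rw [ne_eq, ← outstanding_eq_empty, h1]; simp
      have h3 : (w.step pl η xw s).served = s.served := by rw [step, if_pos h]
      rw [if_neg h2, h3]
      omega
    · rw [if_neg h] at ih
      have := hw.card_served_lt_step (pl := pl) (xw := xw) hη hv h
      split_ifs <;> omega

theorem IsRegular.exists_lt_time (hw : w.IsRegular A) (hcv : Convex ℝ A) (hxw : xw ∈ A)
    (hx₀ : x₀ ∈ A) (hη : 0 < η) (t : ℝ) : ∃ k, t < (w.state pl η x₀ xw k).time := by
  by_contra! h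
  set k := 2 * w.numArrived t + 2 with hk
  have h1 := hw.le_card_served (pl := pl) hcv hxw hx₀ hη k
  have hv := hw.isValid_state (pl := pl) (η := η) hcv hxw hx₀ k
  have h2 : (w.state pl η x₀ xw k).served.card ≤ w.numArrived t := by
    rw [← Finset.card_range (w.numArrived t)]
    refine Finset.card_le_card fun j hj => ?_
    rw [Finset.mem_range, ← hw.arr_le_iff (hv.time_nonneg.trans (h k))]
    exact (hv.arr_le j hj).trans (h k)
  split_ifs at h1 <;> omega

theorem IsRegular.exists_time_le_lt (hw : w.IsRegular A) (hcv : Convex ℝ A) (hxw : xw ∈ A)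
    (hx₀ : x₀ ∈ A) (hη : 0 < η) {t : ℝ} (ht : 0 ≤ t) :
    ∃ k, (w.state pl η x₀ xw k).time ≤ t ∧ t < (w.state pl η x₀ xw (k + 1)).time := by
  classical
  have hex := hw.exists_lt_time (pl := pl) hcv hxw hx₀ hη t
  have hpos : Nat.find hex ≠ 0 := fun h0 => by
    have := Nat.find_spec hex
    rw [h0] at this
    exact not_lt.2 ht this
  obtain ⟨k, hk⟩ := Nat.exists_eq_succ_of_ne_zero hpos
  refine ⟨k, not_lt.1 (Nat.find_min hex (by omega)), ?_⟩
  have := Nat.find_spec hex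
  rwa [hk] at this

/-! ### The pathwise bound -/

/-- The state has few outstanding tasks, but at least one, and small weight. -/
def IsSmall (w : Scenario) (p : ℝ) (N : ℕ) (c : ℝ) (s : State) : Prop :=
  w.queue s ≠ [] ∧ (w.queue s).length < N ∧ w.weightRoot p s < c

/-- At any time, either no task is outstanding, or the number of outstanding tasks is controlled
by the work that was present at the beginning of an iteration with small state and that has
arrived since then. -/
theorem exists_pathwise_bound (hAb : Bornology.IsBounded A) (hcv : Convex ℝ A)
    (hp : 1 ≤ p) (hs : 0 < sbar)
    (hpl : pl.Minimizes p sbar) (hη : 0 < η) (hxw : xw ∈ A) (hx₀ : x₀ ∈ A) {ε : ℝ} (hε : 0 < ε)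
    (N₀ : ℕ) (c₀ : ℝ) :
    ∃ (N : ℕ) (c C : ℝ), 0 ≤ C ∧ ∀ w : Scenario, w.IsRegular A →
      (w.queue (w.state pl η x₀ xw 0)).length ≤ N₀ →
      w.weightRoot p (w.state pl η x₀ xw 0) ≤ c₀ → ∀ t : ℝ, 0 ≤ t →
      w.numOutstanding pl η x₀ xw t = 0 ∨
      ∃ n k : ℕ, w.numOutstanding pl η x₀ xw t ≤ n ∧ w.IsSmall p N c (w.state pl η x₀ xw k) ∧
        (w.state pl η x₀ xw k).time ≤ t ∧
        ε / 2 * n ≤ C + ∑ j ∈ w.outstanding (w.state pl η x₀ xw k), w.serv j +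
          w.newWork (2 * ε) (w.state pl η x₀ xw k).time t -
            (1 - ε) * (t - (w.state pl η x₀ xw k).time) := by
  obtain ⟨κ, δ, C, hδ, hδκ, hC, hdrift⟩ := exists_drift hAb hcv
    (D := Metric.diam A) (fun a ha b hb => Metric.dist_le_diam_of_mem hAb ha hb) hp hs hpl hη hε
  have hη' : 0 < min 1 η := by positivity
  obtain ⟨N₁, hN₁⟩ := exists_nat_gt (C / (ε / 2 * min 1 η))
  rw [div_lt_iff₀ (by positivity)] at hN₁
  -- The bounds `N₀ + 1` and `c₀ + 1` make a nonempty initial state small, and the bounds `2` do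
  -- this for the single task of age zero after an idle period. The bounds `N₁` and `C / δ` let
  -- every other nonempty state absorb the constant `C`.
  set N := max (max (N₀ + 1) 2) N₁ with hN
  set c := max (max (c₀ + 1) 2) (C / δ) with hc
  have hκ : 0 < κ := hδ.trans_le hδκ
  have hc0 : 0 < c := lt_of_lt_of_le two_pos ((le_max_right _ _).trans (le_max_left _ _))
  refine ⟨N, c, ε * N + κ * c + C + C, by positivity, fun w hw hq₀ hw₀ t ht => ?_⟩
  set S := w.state pl η x₀ xw with hS
  have hv : ∀ k, w.IsValid A (S k) := hw.isValid_state hcv hxw hx₀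
  have hsucc : ∀ k, S (k + 1) = w.step pl η xw (S k) := w.state_succ pl η x₀ xw
  have hmono : ∀ k, (S k).time ≤ (S (k + 1)).time := fun k => by
    rw [hsucc]; exact hw.time_le_time_step (hv k)
  have hsmall : ∀ k, w.IsSmall p N c (S k) → w.workload ε (S k) + κ * w.weightRoot p (S k) ≤
      ε * N + κ * c + ∑ j ∈ w.outstanding (S k), w.serv j := by
    rintro k ⟨-, h1, h2⟩
    rw [workload_eq]
    have h3 : ((w.queue (S k)).length : ℝ) ≤ N := by exact_mod_cast h1.le
    have := mul_le_mul_of_nonneg_left h3 hε.le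
    have := mul_le_mul_of_nonneg_left h2.le hκ.le
    linarith
  have hchain : ∀ k, w.queue (S k) = [] ∨ ∃ i ≤ k, w.IsSmall p N c (S i) ∧
      (S i).time ≤ (S k).time ∧
      w.workload ε (S k) + κ * w.weightRoot p (S k) ≤ ε * N + κ * c + C +
        ∑ j ∈ w.outstanding (S i), w.serv j + w.newWork (2 * ε) (S i).time (S k).time -
          (1 - ε) * ((S k).time - (S i).time) := by
    have hself : ∀ k, w.IsSmall p N c (S k) → ∃ i ≤ k, w.IsSmall p N c (S i) ∧
        (S i).time ≤ (S k).time ∧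
        w.workload ε (S k) + κ * w.weightRoot p (S k) ≤ ε * N + κ * c + C +
          ∑ j ∈ w.outstanding (S i), w.serv j + w.newWork (2 * ε) (S i).time (S k).time -
            (1 - ε) * ((S k).time - (S i).time) := fun k hk => by
      refine ⟨k, le_rfl, hk, le_rfl, ?_⟩
      have := hsmall k hk
      simp only [newWork, Finset.Ico_self, Finset.sum_empty, sub_self, mul_zero]
      linarith
    intro k
    induction k with
    | zero =>
      rw [or_iff_not_imp_left]
      intro h
      refine hself 0 ⟨h, ?_, ?_⟩
      · have : N₀ + 1 ≤ N := (le_max_left _ _).trans (le_max_left _ _)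
        omega
      · have : c₀ + 1 ≤ c := (le_max_left _ _).trans (le_max_left _ _)
        linarith
    | succ k ih =>
      by_cases h : w.queue (S k) = []
      · obtain ⟨h1, h2⟩ := hw.outstanding_step_of_queue_eq_nil (pl := pl) (η := η) (xw := xw)
          (hv k) h
        rw [← hsucc] at h1 h2
        have h3 : (w.queue (S (k + 1))).length = 1 := by
          rw [← w.card_outstanding, h2, Finset.card_singleton]
        refine .inr (hself (k + 1) ⟨by rw [← List.length_pos_iff, h3]; exact one_pos, ?_, ?_⟩)
        · have : 2 ≤ N := (le_max_right _ _).trans (le_max_left _ _)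
          omega
        · have : 2 ≤ c := (le_max_right _ _).trans (le_max_left _ _)
          rw [weightRoot, weight_eq_sum, h2, Finset.sum_singleton, h1]
          simp only [Finset.card_singleton, sub_self, Nat.cast_one, zero_add, Real.one_rpow]
          linarith
      · obtain ⟨h1, -⟩ := hdrift w xw (S k) hw hxw (hv k) h
        rw [← hsucc] at h1
        have hm0 : 0 ≤ ε / 2 * ((w.fragment pl η (S k)).length : ℝ) := by positivity
        have hy0 := mul_nonneg hδ.le (hw.weightRoot_nonneg (hv k) p)
        -- At a small state the account restarts and `C` is paid once; otherwise the negative drift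
        -- covers `C` and the previous small state is kept.
        by_cases hk : w.IsSmall p N c (S k)
        · have := hsmall k hk
          exact .inr ⟨k, k.le_succ, hk, hmono k, by linarith⟩
        · obtain ⟨i, hik, hi, hti, hbound⟩ := ih.resolve_left h
          refine .inr ⟨i, hik.trans k.le_succ, hi, hti.trans (hmono k), ?_⟩
          have h2 := hw.newWork_add (2 * ε) hti (hmono k)
          have h3 : C ≤ ε / 2 * ((w.fragment pl η (S k)).length : ℝ) +
              δ * w.weightRoot p (S k) := by
            simp only [IsSmall, not_and, not_lt] at hk
            by_cases hn : (w.queue (S k)).length < N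
            · have h4 : C / δ ≤ w.weightRoot p (S k) := (le_max_right _ _).trans (hk h hn)
              rw [div_le_iff₀ hδ] at h4
              linarith
            · have h4 : (N₁ : ℝ) ≤ (w.queue (S k)).length := by
                exact_mod_cast (le_max_right _ _).trans (not_lt.1 hn)
              have h5 := w.min_mul_length_le pl η (S k)
              have h6 : ε / 2 * (min 1 η * N₁) ≤
                  ε / 2 * (min 1 η * (w.queue (S k)).length) := by gcongr
              have h7 := mul_le_mul_of_nonneg_left h5 (half_pos hε).le
              linarith
          linarith
  obtain ⟨k, hk, hk'⟩ := hw.exists_time_le_lt (pl := pl) hcv hxw hx₀ hη ht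
  have hsub : {j | w.arr j ≤ t ∧ ¬ w.CompletedBy pl η x₀ xw j t} ⊆
      ((w.outstanding (S k) ∪ Finset.Ico (w.numArrived (S k).time) (w.numArrived t) :
        Finset ℕ) : Set ℕ) := by
    rintro j ⟨h1, h2⟩
    have h3 : j ∉ (S k).served := fun h3 => h2 (hw.completedBy hcv hxw hx₀ h3 hk)
    rw [hw.arr_le_iff ht] at h1
    simp only [Finset.coe_union, Set.mem_union, Finset.mem_coe, Finset.mem_Ico, outstanding_eq,
      Finset.mem_sdiff, Finset.mem_range]
    by_cases h4 : j < w.numArrived (S k).time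
    · exact .inl ⟨h4, h3⟩
    · exact .inr ⟨not_lt.1 h4, h1⟩
  have hcard := Set.encard_le_encard hsub
  rw [Set.encard_coe_eq_coe_finsetCard] at hcard
  by_cases h : w.queue (S k) = []
  · left
    obtain ⟨h1, -⟩ := hw.outstanding_step_of_queue_eq_nil (pl := pl) (η := η) (xw := xw) (hv k) h
    have h2 : w.numArrived t ≤ w.numArrived (S k).time := by
      by_contra! h3
      rw [← hw.arr_le_iff ht, ← h1, ← hsucc] at h3
      exact absurd hk' (not_lt.2 h3)
    rw [outstanding_eq_empty.2 h, Finset.Ico_eq_empty_of_le h2] at hcard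
    simpa [numOutstanding] using hcard
  · right
    -- In the middle of an iteration the time since its beginning is less than travel plus services
    -- of the fragment, and these services are still part of the workload. What remains is at least
    -- `ε / 2` per queued task up to a constant; `δ ≤ κ` lets the weight pay its share of the
    -- travel.
    obtain ⟨i, -, hi, hti, hbound⟩ := (hchain k).resolve_left h
    refine ⟨_, i, hcard.trans (Nat.cast_le.2 (Finset.card_union_le _ _)), hi, hti.trans hk, ?_⟩
    obtain ⟨-, h1⟩ := hdrift w xw (S k) hw hxw (hv k) h
    have h2 := time_step_eq (pl := pl) (η := η) (xw := xw) h
    rw [← hsucc] at h2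
    change t < (S (k + 1)).time at hk'
    have h3 := hw.sum_fragment_le (pl := pl) (η := η) (S k)
    have h4 := w.workload_eq ε (S k)
    have h5 := hw.newWork_add (2 * ε) hti hk
    -- Part of the surcharge is set aside to count the tasks that arrived during the current
    -- iteration.
    have h6 := w.newWork_eq (2 * ε - ε / 2) (ε / 2) (S k).time t
    rw [sub_add_cancel] at h6
    have h7 : 0 ≤ w.newWork (2 * ε - ε / 2) (S k).time t :=
      Finset.sum_nonneg fun j _ => by linarith [hw.serv_nonneg j]
    have h8 : ((w.fragment pl η (S k)).length : ℝ) ≤ (w.queue (S k)).length := by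
      rw [length_fragment]
      exact_mod_cast min_le_right _ _
    have h9 := mul_le_mul_of_nonneg_right hδκ (hw.weightRoot_nonneg (hv k) p)
    have h10 := mul_le_mul_of_nonneg_left h8 (half_pos hε).le
    have h11 : 0 ≤ ε * (t - (S k).time) := mul_nonneg hε.le (sub_nonneg.2 hk)
    push_cast
    rw [w.card_outstanding]
    linarith

end Scenario

end

section

/-! ### Measurability of the states -/

section Countable

variable {Ω : Type*} [MeasurableSpace Ω]

/-- Queue, tour and fragment take countably many values. Measurability is expressed by level sets,
on each of which the next state is an explicit measurable function. -/
theorem measurableSet_comp_eq {ι κ : Type*} [Countable ι] {c : Ω → ι}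
    (hc : ∀ i, MeasurableSet {ω | c ω = i}) (f : ι → κ) (k : κ) :
    MeasurableSet {ω | f (c ω) = k} := by
  have : {ω | f (c ω) = k} = ⋃ i ∈ {i | f i = k}, {ω | c ω = i} := by ext; simp
  rw [this]
  exact MeasurableSet.biUnion (Set.to_countable _) fun i _ => hc i

theorem measurableSet_prodMk_eq {ι κ : Type*} {c : Ω → ι} {d : Ω → κ}
    (hc : ∀ i, MeasurableSet {ω | c ω = i}) (hd : ∀ i, MeasurableSet {ω | d ω = i}) (i : ι × κ) :
    MeasurableSet {ω | (c ω, d ω) = i} := by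
  have : {ω | (c ω, d ω) = i} = {ω | c ω = i.1} ∩ {ω | d ω = i.2} := by ext; simp [Prod.ext_iff]
  rw [this]
  exact (hc _).inter (hd _)

theorem measurable_of_countable_cases {ι β : Type*} [Countable ι] [MeasurableSpace β] {c : Ω → ι}
    (hc : ∀ i, MeasurableSet {ω | c ω = i}) {g : ι → Ω → β} (hg : ∀ i, Measurable (g i)) :
    Measurable fun ω => g (c ω) ω := by
  intro B hB
  have : (fun ω => g (c ω) ω) ⁻¹' B = ⋃ i, {ω | c ω = i} ∩ g i ⁻¹' B := by ext; simp
  rw [this]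
  exact MeasurableSet.iUnion fun i => (hc i).inter (hg i hB)

theorem measurableSet_of_countable_cases {ι : Type*} [Countable ι] {c : Ω → ι}
    (hc : ∀ i, MeasurableSet {ω | c ω = i}) {S : ι → Set Ω} (hS : ∀ i, MeasurableSet (S i)) :
    MeasurableSet {ω | ω ∈ S (c ω)} := by
  have : {ω | ω ∈ S (c ω)} = ⋃ i, {ω | c ω = i} ∩ S i := by ext; simp
  rw [this]
  exact MeasurableSet.iUnion fun i => (hc i).inter (hS i)

end Countable

namespace Scenario

section Measurable

variable {Ω : Type*} [MeasurableSpace Ω]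

/-- A random realization of the tasks is measurable if all its components are. -/
structure IsMeasurable (w : Ω → Scenario) : Prop where
  arr : ∀ j, Measurable fun ω => (w ω).arr j
  loc : ∀ j, Measurable fun ω => (w ω).loc j
  serv : ∀ j, Measurable fun ω => (w ω).serv j

/-- A random state is measurable if all its components are. -/
structure IsMeasurableState (s : Ω → State) : Prop where
  time : Measurable fun ω => (s ω).time
  pos : Measurable fun ω => (s ω).pos
  served : ∀ F, MeasurableSet {ω | (s ω).served = F}

variable {w : Ω → Scenario} {pl : Planner} {s : Ω → State}

theorem IsMeasurable.numArrived (hw : IsMeasurable w) {t : Ω → ℝ} (ht : Measurable t) :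
    Measurable fun ω => (w ω).numArrived (t ω) := by
  refine measurable_ncard.comp (measurable_set_iff.2 fun j => ?_)
  exact measurableSet_setOfPred.1 (measurableSet_le (hw.arr j) ht)

theorem IsMeasurable.queue_eq (hw : IsMeasurable w) (hs : IsMeasurableState s) (l : List ℕ) :
    MeasurableSet {ω | (w ω).queue (s ω) = l} :=
  measurableSet_comp_eq (c := fun ω => ((w ω).numArrived (s ω).time, (s ω).served))
    (measurableSet_prodMk_eq (fun n => hw.numArrived hs.time (measurableSet_singleton n)) hs.served)
    (fun c => (List.range c.1).filter fun j => j ∉ c.2) l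

theorem IsMeasurable.tour_eq (hw : IsMeasurable w) (hpl : pl.IsMeasurable)
    (hs : IsMeasurableState s) (l : List ℕ) :
    MeasurableSet {ω | (w ω).tour pl (s ω) = l} := by
  refine measurableSet_of_countable_cases (c := fun ω => (w ω).queue (s ω)) (hw.queue_eq hs)
    (S := fun q => {ω | (List.ofFn fun i : Fin q.length => q.get (pl q.length (s ω).pos
      (fun i => ((s ω).time - (w ω).arr (q.get i), (w ω).loc (q.get i))) i)) = l}) fun q => ?_
  refine measurableSet_comp_eq (c := fun ω => pl q.length (s ω).pos
      (fun i => ((s ω).time - (w ω).arr (q.get i), (w ω).loc (q.get i)))) (fun π => ?_)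
      (fun π => List.ofFn fun i : Fin q.length => q.get (π i)) l
  have hm : Measurable fun ω => ((s ω).pos, fun i : Fin q.length =>
      ((s ω).time - (w ω).arr (q.get i), (w ω).loc (q.get i))) :=
    hs.pos.prodMk (measurable_pi_lambda _ fun i => (hs.time.sub (hw.arr _)).prodMk (hw.loc _))
  exact hm (hpl q.length π)

theorem IsMeasurable.fragment_eq (hw : IsMeasurable w) (hpl : pl.IsMeasurable) (η : ℝ)
    (hs : IsMeasurableState s) (l : List ℕ) :
    MeasurableSet {ω | (w ω).fragment pl η (s ω) = l} :=
  measurableSet_comp_eq (c := fun ω => ((w ω).queue (s ω), (w ω).tour pl (s ω)))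
    (measurableSet_prodMk_eq (hw.queue_eq hs) (hw.tour_eq hpl hs))
    (fun c => c.2.take ⌈η * c.1.length⌉₊) l

theorem IsMeasurable.endTime (hw : IsMeasurable w) {t : Ω → ℝ} (ht : Measurable t)
    {x : Ω → Plane} (hx : Measurable x) (l : List ℕ) :
    Measurable fun ω => (w ω).endTime (t ω) (x ω) l := by
  induction l generalizing t x with
  | nil => exact ht
  | cons j l ih => exact ih ((ht.add (hx.dist (hw.loc j))).add (hw.serv j)) (hw.loc j)

theorem IsMeasurable.endPos (hw : IsMeasurable w) {x : Ω → Plane} (hx : Measurable x)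
    (l : List ℕ) : Measurable fun ω => (w ω).endPos (x ω) l := by
  induction l generalizing x with
  | nil => exact hx
  | cons j l ih => exact ih (hw.loc j)

theorem IsMeasurable.step (hw : IsMeasurable w) (hpl : pl.IsMeasurable) (η : ℝ) (xw : Plane)
    (hs : IsMeasurableState s) : IsMeasurableState fun ω => (w ω).step pl η xw (s ω) := by
  have hn : ∀ n, MeasurableSet {ω | (w ω).numArrived (s ω).time = n} := fun n =>
    hw.numArrived hs.time (measurableSet_singleton n)
  have harr : Measurable fun ω => (w ω).arr ((w ω).numArrived (s ω).time) :=
    measurable_of_countable_cases hn (g := fun n ω => (w ω).arr n) hw.arr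
  have hempty := hw.queue_eq hs []
  have hfrag := hw.fragment_eq hpl η hs
  refine ⟨?_, ?_, fun F => ?_⟩
  · have : (fun ω => ((w ω).step pl η xw (s ω)).time) = fun ω =>
        if (w ω).queue (s ω) = [] then (w ω).arr ((w ω).numArrived (s ω).time) else
          (w ω).endTime (s ω).time (s ω).pos ((w ω).fragment pl η (s ω)) := by
      ext ω; rw [Scenario.step]; split_ifs <;> rfl
    rw [this]
    exact Measurable.ite hempty harr (measurable_of_countable_cases hfrag
      (g := fun l ω => (w ω).endTime (s ω).time (s ω).pos l) fun l => hw.endTime hs.time hs.pos l)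
  · have : (fun ω => ((w ω).step pl η xw (s ω)).pos) = fun ω =>
        if (w ω).queue (s ω) = [] then AffineMap.lineMap (s ω).pos xw
          (min 1 (((w ω).arr ((w ω).numArrived (s ω).time) - (s ω).time) / dist (s ω).pos xw)) else
          (w ω).endPos (s ω).pos ((w ω).fragment pl η (s ω)) := by
      ext1 ω; rw [Scenario.step]; split_ifs <;> rfl
    rw [this]
    refine Measurable.ite hempty ?_ (measurable_of_countable_cases hfrag
      (g := fun l ω => (w ω).endPos (s ω).pos l) fun l => hw.endPos hs.pos l)
    simp only [AffineMap.lineMap_apply_module]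
    have hc : Measurable fun ω => min 1
        (((w ω).arr ((w ω).numArrived (s ω).time) - (s ω).time) / dist (s ω).pos xw) :=
      measurable_const.min ((harr.sub hs.time).div (hs.pos.dist measurable_const))
    exact ((measurable_const.sub hc).smul hs.pos).add (hc.smul measurable_const)
  · refine measurableSet_comp_eq (c := fun ω => (((w ω).queue (s ω), (w ω).fragment pl η (s ω)),
      (s ω).served)) (measurableSet_prodMk_eq (measurableSet_prodMk_eq (hw.queue_eq hs) hfrag)
        hs.served) (fun c => if c.1.1 = [] then c.2 else c.2 ∪ c.1.2.toFinset) F |>.congr ?_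
    ext ω
    simp only [Set.mem_ofPred_eq, Scenario.step]
    split_ifs <;> rfl

theorem IsMeasurable.state (hw : IsMeasurable w) (hpl : pl.IsMeasurable) (η : ℝ) (x₀ xw : Plane)
    (k : ℕ) : IsMeasurableState fun ω => (w ω).state pl η x₀ xw k := by
  induction k with
  | zero =>
    exact ⟨measurable_const, measurable_const, fun F => MeasurableSet.const (∅ = F)⟩
  | succ k ih =>
    simp only [state_succ]
    exact hw.step hpl η xw ih

theorem IsMeasurable.mem_outstanding (hw : IsMeasurable w) (hs : IsMeasurableState s) (j : ℕ) :
    MeasurableSet {ω | j ∈ (w ω).outstanding (s ω)} := by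
  have := measurableSet_comp_eq (hw.queue_eq hs) (fun l => j ∈ l) True
  simpa [outstanding] using this

theorem IsMeasurable.isSmall (hw : IsMeasurable w) (hs : IsMeasurableState s) (p : ℝ) (N : ℕ)
    (c : ℝ) : MeasurableSet {ω | (w ω).IsSmall p N c (s ω)} := by
  have h1 := measurableSet_comp_eq (hw.queue_eq hs) (fun l => l ≠ [] ∧ l.length < N) True
  have h2 : Measurable fun ω => (w ω).weightRoot p (s ω) := by
    refine measurable_of_countable_cases (hw.queue_eq hs) (g := fun l ω =>
      (powSum (p - 1) l.length (l.map ((w ω).data (s ω)))) ^ (1 / p)) fun l => ?_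
    refine Measurable.pow_const ?_ _
    generalize (l.length : ℝ) = a
    induction l with
    | nil => exact measurable_const
    | cons j l ih =>
      simp only [List.map_cons, powSum_cons]
      exact (((hs.time.sub (hw.arr j)).add_const a).pow_const _).add ih
  have h3 := h1.inter (h2 (measurableSet_Iio (a := c)))
  refine h3.congr ?_
  ext ω
  simp [IsSmall, and_assoc]

end Measurable

/-! ### The policy does not anticipate service times -/

/-- Two realizations differ at most in the service time of task `j`. -/
structure AgreeOff (j : ℕ) (w w' : Scenario) : Prop where
  arr : w.arr = w'.arr
  loc : w.loc = w'.loc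
  serv : ∀ i, i ≠ j → w.serv i = w'.serv i

theorem AgreeOff.symm {j : ℕ} {w w' : Scenario} (h : AgreeOff j w w') : AgreeOff j w' w :=
  ⟨h.arr.symm, h.loc.symm, fun i hi => (h.serv i hi).symm⟩

theorem AgreeOff.numArrived_eq {j : ℕ} {w w' : Scenario} (h : AgreeOff j w w') (t : ℝ) :
    w.numArrived t = w'.numArrived t := by
  rw [numArrived, numArrived, h.arr]

theorem AgreeOff.queue_eq {j : ℕ} {w w' : Scenario} (h : AgreeOff j w w') (s : State) :
    w.queue s = w'.queue s := by
  rw [queue, queue, h.numArrived_eq]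

theorem AgreeOff.outstanding_eq {j : ℕ} {w w' : Scenario} (h : AgreeOff j w w') (s : State) :
    w.outstanding s = w'.outstanding s := by
  rw [outstanding, outstanding, h.queue_eq]

theorem AgreeOff.isSmall_iff {j : ℕ} {w w' : Scenario} (h : AgreeOff j w w') (p : ℝ) (N : ℕ)
    (c : ℝ) (s : State) : w.IsSmall p N c s ↔ w'.IsSmall p N c s := by
  have : w.data = w'.data := by ext s j : 2; simp [data, h.arr, h.loc]
  rw [IsSmall, IsSmall, weightRoot, weightRoot, weight, weight, h.queue_eq, this]

theorem AgreeOff.tour_eq {j : ℕ} {w w' : Scenario} (h : AgreeOff j w w') (pl : Planner)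
    (s : State) : w.tour pl s = w'.tour pl s := by
  rw [tour, tour, h.arr, h.loc]
  exact congrArg (fun q : List ℕ => List.ofFn fun i : Fin q.length => q.get (pl q.length s.pos
    (fun i => (s.time - w'.arr (q.get i), w'.loc (q.get i))) i)) (h.queue_eq s)

theorem AgreeOff.endTime_eq {j : ℕ} {w w' : Scenario} (h : AgreeOff j w w') {l : List ℕ}
    (hl : j ∉ l) (t : ℝ) (x : Plane) : w.endTime t x l = w'.endTime t x l := by
  induction l generalizing t x with
  | nil => rfl
  | cons i l ih =>
    rw [List.mem_cons, not_or] at hl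
    rw [endTime, endTime, h.loc, h.serv i (Ne.symm hl.1), ih hl.2]

theorem AgreeOff.endPos_eq {j : ℕ} {w w' : Scenario} (h : AgreeOff j w w') (l : List ℕ)
    (x : Plane) : w.endPos x l = w'.endPos x l := by
  induction l generalizing x with
  | nil => rfl
  | cons i l ih => rw [endPos, endPos, h.loc, ih]

/-- A service time has no influence on the state before the task is served. -/
theorem AgreeOff.state_eq {j : ℕ} {w w' : Scenario} (h : AgreeOff j w w') (pl : Planner) (η : ℝ)
    (x₀ xw : Plane) {k : ℕ} (hj : j ∉ (w.state pl η x₀ xw k).served) :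
    w.state pl η x₀ xw k = w'.state pl η x₀ xw k := by
  induction k with
  | zero => rfl
  | succ k ih =>
    rw [state_succ] at hj
    rw [state_succ, state_succ]
    -- The planner sees only positions, ages and locations, never service times.
    have hfrag : ∀ s, w.fragment pl η s = w'.fragment pl η s := fun s => by
      rw [fragment, fragment, h.tour_eq, h.queue_eq]
    by_cases hq : w.queue (w.state pl η x₀ xw k) = []
    · rw [step, if_pos hq] at hj
      rw [← ih hj, step, step, ← h.queue_eq, if_pos hq, if_pos hq, h.numArrived_eq, h.arr]
    · rw [step, if_neg hq] at hj
      simp only [Finset.mem_union, List.mem_toFinset, not_or] at hj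
      rw [← ih hj.1, step, step, ← h.queue_eq, if_neg hq, if_neg hq, ← hfrag, h.endTime_eq hj.2,
        h.endPos_eq]

end Scenario

end

section

/-! ### Independence of functions of disjoint coordinates -/

section Independence

variable {Ω : Type*} [MeasurableSpace Ω] {P : Measure Ω}

/-- Disjoint subfamilies of an independent family are independent. -/
theorem indepFun_restrict_of_disjoint {ι : Type*} {β : ι → Type*} [∀ i, MeasurableSpace (β i)]
    {f : ∀ i, Ω → β i} (hf : iIndepFun f P) (hm : ∀ i, Measurable (f i)) {S T : Set ι}
    (hST : Disjoint S T) :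
    IndepFun (fun ω (i : S) => f i ω) (fun ω (i : T) => f i ω) P := by
  have key : ∀ S : Set ι, MeasurableSpace.comap (fun ω (i : S) => f i ω) MeasurableSpace.pi =
      ⨆ i ∈ S, MeasurableSpace.comap (f i) inferInstance := fun S => by
    rw [MeasurableSpace.pi, MeasurableSpace.comap_iSup, iSup_subtype']
    simp only [MeasurableSpace.comap_comp]
    rfl
  rw [IndepFun_iff_Indep, key, key]
  exact indep_iSup_of_disjoint (fun i => (hm i).comap_le) hf.iIndep hST

/-- Functions of disjoint subfamilies of an independent family are independent. -/
theorem indepFun_of_dependsOn {ι β γ γ' : Type*} [MeasurableSpace β] [MeasurableSpace γ]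
    [MeasurableSpace γ'] [Inhabited β] {f : ι → Ω → β} (hf : iIndepFun f P)
    (hm : ∀ i, Measurable (f i)) {S T : Set ι} (hST : Disjoint S T) {g : (ι → β) → γ}
    {h : (ι → β) → γ'} (hg : Measurable g) (hh : Measurable h) (hgS : DependsOn g S)
    (hhT : DependsOn h T) :
    IndepFun (fun ω => g fun i => f i ω) (fun ω => h fun i => f i ω) P := by
  classical
  -- Coordinates outside `U` are filled with a default value, which a function depending only on `U`
  -- ignores.
  have hext : ∀ U : Set ι, Measurable fun (y : U → β) (i : ι) =>
      if hi : i ∈ U then y ⟨i, hi⟩ else default := fun U => by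
    refine measurable_pi_lambda _ fun i => ?_
    by_cases hi : i ∈ U
    · simp only [hi, dif_pos]; exact measurable_pi_apply _
    · simp only [hi, dif_neg, not_false_eq_true]; exact measurable_const
  refine ((indepFun_restrict_of_disjoint hf hm hST).comp (hg.comp (hext S))
    (hh.comp (hext T))).congr (ae_of_all _ fun ω => ?_) (ae_of_all _ fun ω => ?_)
  · exact hgS fun i hi => by simp [hi]
  · exact hhT fun i hi => by simp [hi]

theorem iIndepFun_bool {β : Bool → Type*} [∀ i, MeasurableSpace (β i)] [IsProbabilityMeasure P]
    {f : ∀ b, Ω → β b} (h : IndepFun (f true) (f false) P) : iIndepFun f P := by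
  rw [iIndepFun_iff_measure_inter_preimage_eq_mul]
  intro S sets hS
  have h2 : ∀ b, b ∈ S → MeasurableSet (sets b) := hS
  by_cases h1 : true ∈ S <;> by_cases h0 : false ∈ S
  · have hSe : S = {true, false} := by ext b; cases b <;> simp [h1, h0]
    subst hSe
    have := h.measure_inter_preimage_eq_mul _ _ (h2 true (by simp)) (h2 false (by simp))
    rw [Finset.prod_pair (by simp), ← this, Finset.set_biInter_insert, Finset.set_biInter_singleton]
  · have hSe : S = {true} := by ext b; cases b <;> simp [h1, h0]
    subst hSe
    simp
  · have hSe : S = {false} := by ext b; cases b <;> simp [h1, h0]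
    subst hSe
    simp
  · have hSe : S = ∅ := by ext b; cases b <;> simp [h1, h0]
    subst hSe
    simp

end Independence

/-! ### The exponential distribution -/

/-- Tilting the exponential density by `exp (-(θ * x))` gives a multiple of the exponential density
with rate `lam + θ`. -/
theorem lintegral_exp_expMeasure {lam θ : ℝ} (hlam : 0 < lam) (hθ : 0 < θ) :
    ∫⁻ x, ENNReal.ofReal (Real.exp (-(θ * x))) ∂(expMeasure lam) =
      ENNReal.ofReal (lam / (lam + θ)) := by
  have hm : ∀ r : ℝ, Measurable (exponentialPDF r) := fun r =>
    (measurable_exponentialPDFReal r).ennreal_ofReal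
  have h1 : expMeasure lam = volume.withDensity (exponentialPDF lam) := rfl
  rw [h1, lintegral_withDensity_eq_lintegral_mul _ (hm lam) (by fun_prop)]
  have h2 : ∀ x, (exponentialPDF lam * fun x => ENNReal.ofReal (Real.exp (-(θ * x)))) x =
      ENNReal.ofReal (lam / (lam + θ)) * exponentialPDF (lam + θ) x := fun x => by
    rw [Pi.mul_apply, exponentialPDF_eq, exponentialPDF_eq]
    split_ifs with hx
    · rw [← ENNReal.ofReal_mul (by positivity), ← ENNReal.ofReal_mul (by positivity), mul_assoc,
        ← Real.exp_add, ← mul_assoc, div_mul_cancel₀ _ (by positivity)]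
      ring_nf
    · simp
  simp_rw [h2]
  rw [lintegral_const_mul _ (hm _), lintegral_exponentialPDF_eq_one (by positivity), mul_one]

theorem ae_pos_expMeasure (lam : ℝ) : ∀ᵐ x ∂(expMeasure lam), 0 < x := by
  have h1 : expMeasure lam = volume.withDensity (exponentialPDF lam) := rfl
  rw [ae_iff]
  have h2 : {x : ℝ | ¬ 0 < x} = Set.Iic 0 := by ext; simp
  rw [h2, h1, withDensity_apply _ measurableSet_Iic, setLIntegral_congr Iio_ae_eq_Iic.symm]
  exact lintegral_exponentialPDF_of_nonpos le_rfl

/-! ### The Lindley recursion -/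

/-- The Lindley recursion: the reflected random walk with given increments. -/
def lindley : ℕ → (ℕ → ℝ) → ℝ
  | 0, _ => 0
  | b + 1, x => max 0 (lindley b x + x b)

theorem lindley_nonneg (b : ℕ) (x : ℕ → ℝ) : 0 ≤ lindley b x := by
  cases b
  · exact le_rfl
  · exact le_max_left _ _

/-- A single random variable dominates the sums over all windows ending at `b`, so the left end may
be random. -/
theorem sum_Ico_le_lindley {a b : ℕ} (h : a ≤ b) (x : ℕ → ℝ) :
    ∑ i ∈ Finset.Ico a b, x i ≤ lindley b x := by
  induction b, h using Nat.le_induction with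
  | base => simpa using lindley_nonneg a x
  | succ b hb ih =>
    rw [Finset.sum_Ico_succ_top hb]
    exact (add_le_add_left ih _).trans (le_max_right _ _)

theorem lindley_congr {b : ℕ} {x y : ℕ → ℝ} (h : ∀ i < b, x i = y i) :
    lindley b x = lindley b y := by
  induction b with
  | zero => rfl
  | succ b ih =>
    rw [lindley, lindley, ih fun i hi => h i (hi.trans b.lt_succ_self), h b b.lt_succ_self]

/-- The walk on the right makes one more step at the beginning and so enters the common increments
from a nonnegative value instead of zero. For i.i.d. increments this makes the expectations
monotone. -/
theorem lindley_shift_le (b : ℕ) (x : ℕ → ℝ) :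
    lindley b (fun i => x (i + 1)) ≤ lindley (b + 1) x := by
  induction b with
  | zero => exact lindley_nonneg _ _
  | succ b ih => exact max_le_max_left 0 (by gcongr)

@[fun_prop]
theorem measurable_lindley (b : ℕ) : Measurable (lindley b) := by
  induction b with
  | zero => exact measurable_const
  | succ b ih => exact measurable_const.max (ih.add (measurable_pi_apply b))

section Lindley

variable {Ω : Type*} [MeasurableSpace Ω] {P : Measure Ω}

theorem memLp_lindley {X : ℕ → Ω → ℝ} (hX : ∀ i, MemLp (X i) 2 P) (hm : ∀ i, Measurable (X i))
    (b : ℕ) : MemLp (fun ω => lindley b fun i => X i ω) 2 P := by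
  induction b with
  | zero => exact MemLp.zero'
  | succ b ih =>
    refine MemLp.of_le (ih.add (hX b)) ?_ (ae_of_all _ fun ω => ?_)
    · exact ((measurable_lindley (b + 1)).comp
        (measurable_pi_lambda _ hm)).aestronglyMeasurable
    · rw [lindley, Real.norm_of_nonneg (le_max_left _ _), Pi.add_apply]
      exact max_le (norm_nonneg _) (le_abs_self _)

/-- If the increments are i.i.d. with negative mean and finite second moment, then the expectation
of the reflected random walk is bounded. -/
theorem exists_integral_lindley_le [IsProbabilityMeasure P] {X : ℕ → Ω → ℝ} (hind : iIndepFun X P)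
    (hm : ∀ i, Measurable (X i)) {μ : Measure ℝ} (hlaw : ∀ i, P.map (X i) = μ)
    (hμ : MemLp (fun x => x) 2 μ) (hneg : ∫ x, x ∂μ < 0) :
    ∃ C : ℝ, ∀ b, ∫ ω, lindley b (fun i => X i ω) ∂P ≤ C := by
  have hX : ∀ i, MemLp (X i) 2 P := fun i => by
    rw [← hlaw i] at hμ
    exact (memLp_map_measure_iff aestronglyMeasurable_id (hm i).aemeasurable).1 hμ
  set L : ℕ → Ω → ℝ := fun b ω => lindley b fun i => X i ω with hL
  have hLm : ∀ b, Measurable (L b) := fun b =>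
    (measurable_lindley b).comp (measurable_pi_lambda _ hm)
  have hLp : ∀ b, MemLp (L b) 2 P := memLp_lindley hX hm
  have hL1 : ∀ b, Integrable (L b) P := fun b => (hLp b).integrable one_le_two
  have hL2 : ∀ b, Integrable (fun ω => L b ω ^ 2) P := fun b => (hLp b).integrable_sq
  have hX1 : ∀ b, Integrable (X b) P := fun b => (hX b).integrable one_le_two
  have hX2 : ∀ b, Integrable (fun ω => X b ω ^ 2) P := fun b => (hX b).integrable_sq
  set d := -∫ x, x ∂μ with hd
  have hd0 : 0 < d := by linarith
  have hEX : ∀ i, ∫ ω, X i ω ∂P = -d := fun i => by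
    rw [hd, neg_neg, ← hlaw i, integral_map (f := fun x => x) (hm i).aemeasurable aestronglyMeasurable_id]
  set v := ∫ x, x ^ 2 ∂μ with hv
  have hEX2 : ∀ i, ∫ ω, X i ω ^ 2 ∂P = v := fun i => by
    rw [hv, ← hlaw i, integral_map (hm i).aemeasurable (by fun_prop)]
  have hind' : ∀ b, IndepFun (L b) (X b) P := fun b => by
    exact indepFun_of_dependsOn (g := lindley b) (h := fun x : ℕ → ℝ => x b) hind hm
      (show Disjoint (Set.Iio b) {b} by simp) (measurable_lindley b) (measurable_pi_apply b)
      (fun x y hxy => lindley_congr hxy) fun x y hxy => hxy b rfl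
  -- Quadratic Lyapunov function: the current value is independent of the next increment, so the
  -- cross term has mean `-2 * d` times the first moment.
  have hrec : ∀ b, ∫ ω, L (b + 1) ω ^ 2 ∂P ≤
      ∫ ω, L b ω ^ 2 ∂P - 2 * d * ∫ ω, L b ω ∂P + v := fun b => by
    have hmul : Integrable (fun ω => L b ω * X b ω) P := (hLp b).integrable_mul (hX b)
    have h1 : ∫ ω, L b ω * X b ω ∂P = (∫ ω, L b ω ∂P) * -d := by
      rw [← hEX b]
      exact (hind' b).integral_fun_mul_eq_mul_integral (hL1 b).aestronglyMeasurable
        (hX1 b).aestronglyMeasurable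
    calc ∫ ω, L (b + 1) ω ^ 2 ∂P
        ≤ ∫ ω, (L b ω ^ 2 + 2 * (L b ω * X b ω)) + X b ω ^ 2 ∂P := by
          refine integral_mono (hL2 _) (((hL2 b).add (hmul.const_mul 2)).add (hX2 b)) fun ω => ?_
          have h2 : L (b + 1) ω = max 0 (L b ω + X b ω) := rfl
          have h3 : L (b + 1) ω ^ 2 ≤ (L b ω + X b ω) ^ 2 := by
            rw [h2]
            rcases max_cases 0 (L b ω + X b ω) with h | h
            · rw [h.1, zero_pow two_ne_zero]; positivity
            · rw [h.1]
          dsimp only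
          linarith
      _ = _ := by
          rw [integral_add (f := fun ω => L b ω ^ 2 + 2 * (L b ω * X b ω))
            ((hL2 b).add (hmul.const_mul 2)) (hX2 b),
            integral_add (hL2 b) (hmul.const_mul 2), integral_const_mul, h1, hEX2]
          ring
  have hmono : ∀ b, ∫ ω, L b ω ∂P ≤ ∫ ω, L (b + 1) ω ∂P := fun b => by
    have hshift : ∫ ω, lindley b (fun i => X i ω) ∂P = ∫ ω, lindley b (fun i => X (i + 1) ω) ∂P := by
      have h1 := (iIndepFun_iff_map_fun_eq_infinitePi_map hm).1 hind
      have h2 := (iIndepFun_iff_map_fun_eq_infinitePi_map fun i => hm (i + 1)).1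
        (hind.precomp (g := fun i => i + 1) (add_left_injective 1))
      simp only [hlaw] at h1 h2
      rw [← integral_map (φ := fun ω i => X i ω) (measurable_pi_lambda _ hm).aemeasurable
        (measurable_lindley b).aestronglyMeasurable, h1, ← h2,
        integral_map (measurable_pi_lambda _ fun i => hm (i + 1)).aemeasurable
        (measurable_lindley b).aestronglyMeasurable]
    calc ∫ ω, L b ω ∂P = _ := hshift
      _ ≤ _ := by
        refine integral_mono_of_nonneg (ae_of_all _ fun ω => lindley_nonneg _ _) (hL1 _)
          (ae_of_all _ fun ω => lindley_shift_le b fun i => X i ω)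
  have hmono' : Monotone fun b => ∫ ω, L b ω ∂P := monotone_nat_of_le_succ hmono
  have hsum : ∀ b, 2 * d * ∑ i ∈ Finset.range b, ∫ ω, L i ω ∂P + ∫ ω, L b ω ^ 2 ∂P ≤ v * b := by
    intro b
    induction b with
    | zero => simp [hL, lindley]
    | succ b ih =>
      rw [Finset.sum_range_succ]
      push_cast
      linarith [hrec b]
  have hL0 : ∀ b, 0 ≤ ∫ ω, L b ω ∂P := fun b => integral_nonneg fun ω => lindley_nonneg _ _
  have hv0 : 0 ≤ v := integral_nonneg fun x => sq_nonneg x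
  refine ⟨v / d, fun b => ?_⟩
  rcases Nat.eq_zero_or_pos b with rfl | hb
  · simp only [lindley, integral_zero]; positivity
  -- Telescoping bounds only averages of the first moments. Monotonicity turns this into a bound for
  -- each of them, by comparison with the window from `b` to `2 * b`.
  have h1 : (b : ℝ) * ∫ ω, L b ω ∂P ≤ ∑ i ∈ Finset.range (2 * b), ∫ ω, L i ω ∂P := by
    calc (b : ℝ) * ∫ ω, L b ω ∂P = ∑ i ∈ Finset.Ico b (2 * b), ∫ ω, L b ω ∂P := by
          rw [Finset.sum_const, Nat.card_Ico, nsmul_eq_mul, two_mul, Nat.add_sub_cancel]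
      _ ≤ ∑ i ∈ Finset.Ico b (2 * b), ∫ ω, L i ω ∂P :=
          Finset.sum_le_sum fun i hi => hmono' (Finset.mem_Ico.1 hi).1
      _ ≤ _ := Finset.sum_le_sum_of_subset_of_nonneg
          (fun i hi => Finset.mem_range.2 (Finset.mem_Ico.1 hi).2) fun i _ _ => hL0 i
  have h2 := hsum (2 * b)
  have h3 : 0 ≤ ∫ ω, L (2 * b) ω ^ 2 ∂P := integral_nonneg fun ω => sq_nonneg _
  push_cast at h2
  rw [le_div_iff₀ hd0]
  have hb' : (0 : ℝ) < b := by exact_mod_cast hb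
  have h4 : 2 * d * (b * ∫ ω, L b ω ∂P) ≤ v * (2 * b) :=
    (mul_le_mul_of_nonneg_left h1 (by positivity)).trans (by linarith)
  change (∫ ω, L b ω ∂P) * d ≤ v
  nlinarith

end Lindley

end

section

/-! ### The random data of the tasks -/

/-- The independent coordinates of the random data: arrival data and service data. -/
def coord {Ω : Type*} (Z : ℕ → Ω → ℝ × Plane × ℝ) (q : ℕ × Bool) (ω : Ω) : ℝ × Plane :=
  bif q.2 then ((Z q.1 ω).2.2, 0) else ((Z q.1 ω).1, (Z q.1 ω).2.1)

/-- The random data as a function of its independent coordinates. -/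
def ofCoord (y : ℕ × Bool → ℝ × Plane) (i : ℕ) : ℝ × Plane × ℝ :=
  ((y (i, false)).1, (y (i, false)).2, (y (i, true)).1)

theorem measurable_ofCoord : Measurable ofCoord := by
  unfold ofCoord
  fun_prop

variable {n₀ : ℕ} {init : Fin n₀ → ℝ × Plane}

theorem scenario_arr_add (z : ℕ → ℝ × Plane × ℝ) (i : ℕ) :
    (scenario init z).arr (n₀ + i) = ∑ m ∈ Finset.range (i + 1), (z m).1 := by
  simp [scenario]

theorem scenario_arr_of_lt (z : ℕ → ℝ × Plane × ℝ) {j : ℕ} (h : j < n₀) :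
    (scenario init z).arr j = -(init ⟨j, h⟩).1 := by
  simp [scenario, h]

theorem isMeasurable_scenario {Ω : Type*} [MeasurableSpace Ω] {z : Ω → ℕ → ℝ × Plane × ℝ}
    (hz : Measurable z) : Scenario.IsMeasurable fun ω => scenario init (z ω) := by
  have hz' : ∀ i, Measurable fun ω => z ω i := fun i => (measurable_pi_apply i).comp hz
  refine ⟨fun j => ?_, fun j => ?_, fun j => (hz' j).snd.snd⟩
  · by_cases h : j < n₀
    · simp only [scenario, h, dif_pos]; exact measurable_const
    · simp only [scenario, h, dif_neg, not_false_eq_true]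
      exact Finset.measurable_fun_sum _ fun i _ => (hz' i).fst
  · by_cases h : j < n₀
    · simp only [scenario, h, dif_pos]; exact measurable_const
    · simp only [scenario, h, dif_neg, not_false_eq_true]
      exact (hz' _).snd.fst

namespace IsTaskStream

variable {Ω : Type*} [MeasurableSpace Ω] {P : Measure Ω} {lam : ℝ} {φ : Measure Plane}
  {ν : Measure ℝ} {Z : ℕ → Ω → ℝ × Plane × ℝ}

theorem measurable_coord (hZ : IsTaskStream P lam φ ν Z) (q : ℕ × Bool) :
    Measurable (coord Z q) := by
  have := hZ.measurable q.1
  unfold coord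
  rcases q with ⟨i, _ | _⟩
  · exact this.fst.prodMk this.snd.fst
  · exact this.snd.snd.prodMk measurable_const

theorem map_assoc [IsProbabilityMeasure φ] [IsProbabilityMeasure ν] (hZ : IsTaskStream P lam φ ν Z)
    (hlam : 0 < lam) (i : ℕ) :
    P.map (fun ω => (((Z i ω).1, (Z i ω).2.1), (Z i ω).2.2)) =
      ((expMeasure lam).prod φ).prod ν := by
  have := isProbabilityMeasure_expMeasure hlam
  have h : (fun ω => (((Z i ω).1, (Z i ω).2.1), (Z i ω).2.2)) =
      (MeasurableEquiv.prodAssoc : (ℝ × Plane) × ℝ ≃ᵐ ℝ × Plane × ℝ).symm ∘ Z i := rfl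
  rw [h, ← Measure.map_map (MeasurableEquiv.measurable _) (hZ.measurable i), hZ.law,
    ← Measure.prodAssoc_prod, MeasurableEquiv.map_symm_map]

theorem map_arr_loc [IsProbabilityMeasure φ] [IsProbabilityMeasure ν]
    (hZ : IsTaskStream P lam φ ν Z) (hlam : 0 < lam) (i : ℕ) :
    P.map (fun ω => ((Z i ω).1, (Z i ω).2.1)) = (expMeasure lam).prod φ := by
  have hm := hZ.measurable i
  have h := congrArg (Measure.map Prod.fst) (hZ.map_assoc hlam i)
  rw [Measure.map_map measurable_fst ((hm.fst.prodMk hm.snd.fst).prodMk hm.snd.snd),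
    Measure.map_fst_prod, measure_univ, one_smul] at h
  exact h

theorem map_serv [IsProbabilityMeasure φ] [IsProbabilityMeasure ν]
    (hZ : IsTaskStream P lam φ ν Z) (hlam : 0 < lam) (i : ℕ) :
    P.map (fun ω => (Z i ω).2.2) = ν := by
  have := isProbabilityMeasure_expMeasure hlam
  have hm := hZ.measurable i
  have h := congrArg (Measure.map Prod.snd) (hZ.map_assoc hlam i)
  rw [Measure.map_map measurable_snd ((hm.fst.prodMk hm.snd.fst).prodMk hm.snd.snd),
    Measure.map_snd_prod, measure_univ, one_smul] at h
  exact h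

theorem map_arr [IsProbabilityMeasure φ] [IsProbabilityMeasure ν]
    (hZ : IsTaskStream P lam φ ν Z) (hlam : 0 < lam) (i : ℕ) :
    P.map (fun ω => (Z i ω).1) = expMeasure lam := by
  have hm := hZ.measurable i
  have h := congrArg (Measure.map Prod.fst) (hZ.map_arr_loc hlam i)
  rw [Measure.map_map measurable_fst (hm.fst.prodMk hm.snd.fst),
    Measure.map_fst_prod, measure_univ, one_smul] at h
  exact h

theorem map_loc [IsProbabilityMeasure φ] [IsProbabilityMeasure ν]
    (hZ : IsTaskStream P lam φ ν Z) (hlam : 0 < lam) (i : ℕ) :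
    P.map (fun ω => (Z i ω).2.1) = φ := by
  have := isProbabilityMeasure_expMeasure hlam
  have hm := hZ.measurable i
  have h := congrArg (Measure.map Prod.snd) (hZ.map_arr_loc hlam i)
  rw [Measure.map_map measurable_snd (hm.fst.prodMk hm.snd.fst),
    Measure.map_snd_prod, measure_univ, one_smul] at h
  exact h

theorem iIndepFun_coord [IsProbabilityMeasure P] [IsProbabilityMeasure φ] [IsProbabilityMeasure ν]
    (hZ : IsTaskStream P lam φ ν Z) (hlam : 0 < lam) : iIndepFun (coord Z) P := by
  refine iIndepFun_uncurry' (X := fun i b => coord Z (i, b)) (fun i b => hZ.measurable_coord _)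
    ?_ fun i => ?_
  · refine hZ.indep.comp (fun _ z b => bif b then (z.2.2, 0) else (z.1, z.2.1)) fun i => ?_
    refine measurable_pi_lambda _ fun b => ?_
    cases b
    · exact measurable_fst.prodMk measurable_snd.fst
    · exact measurable_snd.snd.prodMk measurable_const
  · refine iIndepFun_bool ?_
    have hm := hZ.measurable i
    have h : IndepFun (fun ω => ((Z i ω).1, (Z i ω).2.1)) (fun ω => (Z i ω).2.2) P := by
      rw [indepFun_iff_map_prod_eq_prod_map_map (hm.fst.prodMk hm.snd.fst).aemeasurable
        hm.snd.snd.aemeasurable, hZ.map_assoc hlam, hZ.map_arr_loc hlam, hZ.map_serv hlam]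
    exact (h.comp measurable_id (measurable_id.prodMk (measurable_const (a := (0 : Plane))))).symm

theorem iIndepFun_arr (hZ : IsTaskStream P lam φ ν Z) : iIndepFun (fun i ω => (Z i ω).1) P :=
  hZ.indep.comp (fun _ z => z.1) fun _ => measurable_fst

theorem iIndepFun_serv (hZ : IsTaskStream P lam φ ν Z) : iIndepFun (fun i ω => (Z i ω).2.2) P :=
  hZ.indep.comp (fun _ z => z.2.2) fun _ => measurable_snd.snd

theorem measurable_stream (hZ : IsTaskStream P lam φ ν Z) : Measurable fun ω i => Z i ω :=
  measurable_pi_lambda _ hZ.measurable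

/-! ### Arrivals -/

/-- Chernoff's bound: the exponential Markov inequality and the Laplace transform of independent
interarrival times. -/
theorem measure_sum_Ico_le [IsProbabilityMeasure φ] [IsProbabilityMeasure ν]
    (hZ : IsTaskStream P lam φ ν Z) (hlam : 0 < lam) {θ : ℝ} (hθ : 0 < θ) (m a : ℕ) (ℓ : ℝ) :
    P {ω | ∑ i ∈ Finset.Ico m (m + a), (Z i ω).1 ≤ ℓ} ≤
      ENNReal.ofReal (Real.exp (θ * ℓ)) * ENNReal.ofReal (lam / (lam + θ)) ^ a := by
  have hmg : Measurable fun x : ℝ => ENNReal.ofReal (Real.exp (-(θ * x))) := by fun_prop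
  have hind := hZ.iIndepFun_arr.comp (fun _ x => ENNReal.ofReal (Real.exp (-(θ * x))))
    fun _ => hmg
  have hm : ∀ i, Measurable fun ω => ENNReal.ofReal (Real.exp (-(θ * (Z i ω).1))) := fun i =>
    hmg.comp (hZ.measurable i).fst
  have hprod : ∀ a, ∫⁻ ω, ∏ i ∈ Finset.Ico m (m + a), ENNReal.ofReal (Real.exp (-(θ * (Z i ω).1))) ∂P
      ≤ ENNReal.ofReal (lam / (lam + θ)) ^ a := by
    intro a
    induction a with
    | zero =>
      have := hZ.indep.isProbabilityMeasure
      simp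
    | succ a ih =>
      have h1 := hind.indepFun_finsetProd_of_notMem hm (s := Finset.Ico m (m + a)) (i := m + a)
        (by simp)
      have h2 := lintegral_mul_eq_lintegral_mul_lintegral_of_indepFun
        (f := ∏ i ∈ Finset.Ico m (m + a), fun ω => ENNReal.ofReal (Real.exp (-(θ * (Z i ω).1))))
        (by simpa only [Finset.prod_fn] using Finset.measurable_prod _ fun i _ => hm i) (hm (m + a)) h1
      have h3 : ∫⁻ ω, ENNReal.ofReal (Real.exp (-(θ * (Z (m + a) ω).1))) ∂P =
          ENNReal.ofReal (lam / (lam + θ)) := by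
        rw [← lintegral_exp_expMeasure hlam hθ, ← hZ.map_arr hlam (m + a),
          lintegral_map hmg (hZ.measurable _).fst]
      calc _ = ∫⁻ ω, ((∏ i ∈ Finset.Ico m (m + a),
              fun ω => ENNReal.ofReal (Real.exp (-(θ * (Z i ω).1)))) *
              fun ω => ENNReal.ofReal (Real.exp (-(θ * (Z (m + a) ω).1)))) ω ∂P := by
            refine lintegral_congr fun ω => ?_
            rw [← add_assoc, Finset.prod_Ico_succ_top (by omega), Pi.mul_apply, Finset.prod_apply]
        _ ≤ _ := by
            rw [show _ = _ from h2, h3, pow_succ]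
            gcongr
            simpa only [Finset.prod_apply] using ih
  calc P {ω | ∑ i ∈ Finset.Ico m (m + a), (Z i ω).1 ≤ ℓ}
      = ∫⁻ ω, Set.indicator {ω | ∑ i ∈ Finset.Ico m (m + a), (Z i ω).1 ≤ ℓ} 1 ω ∂P := by
        rw [lintegral_indicator_one]
        exact measurableSet_le (Finset.measurable_fun_sum _ fun i _ => (hZ.measurable i).fst)
          measurable_const
    _ ≤ ∫⁻ ω, ENNReal.ofReal (Real.exp (θ * ℓ)) *
          ∏ i ∈ Finset.Ico m (m + a), ENNReal.ofReal (Real.exp (-(θ * (Z i ω).1))) ∂P := by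
        refine lintegral_mono fun ω => Set.indicator_apply_le' (fun hω => ?_) fun _ => zero_le
        rw [← ENNReal.ofReal_prod_of_nonneg fun i _ => (Real.exp_pos _).le, ← Real.exp_sum,
          ← ENNReal.ofReal_mul (Real.exp_pos _).le, ← Real.exp_add, Finset.sum_neg_distrib,
          ← Finset.mul_sum, Pi.one_apply, ENNReal.one_le_ofReal, Real.one_le_exp_iff]
        have : ∑ i ∈ Finset.Ico m (m + a), (Z i ω).1 ≤ ℓ := hω
        nlinarith
    _ ≤ _ := by
        rw [lintegral_const_mul _ (Finset.measurable_prod _ fun i _ => hm i)]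
        gcongr
        exact hprod a

theorem ae_arr_pos [IsProbabilityMeasure φ] [IsProbabilityMeasure ν]
    (hZ : IsTaskStream P lam φ ν Z) (hlam : 0 < lam) : ∀ᵐ ω ∂P, ∀ i, 0 < (Z i ω).1 := by
  refine ae_all_iff.2 fun i => ?_
  have h := ae_pos_expMeasure lam
  rw [← hZ.map_arr hlam i] at h
  exact ae_of_ae_map (hZ.measurable i).fst.aemeasurable h

theorem ae_sum_unbounded [IsProbabilityMeasure φ] [IsProbabilityMeasure ν]
    (hZ : IsTaskStream P lam φ ν Z) (hlam : 0 < lam) :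
    ∀ᵐ ω ∂P, ∀ n : ℕ, ∃ a, (n : ℝ) < ∑ i ∈ Finset.range a, (Z i ω).1 := by
  refine ae_all_iff.2 fun n => ?_
  rw [ae_iff]
  have h1 : ∀ a, P {ω | ¬ ∃ a, (n : ℝ) < ∑ i ∈ Finset.range a, (Z i ω).1} ≤
      ENNReal.ofReal (Real.exp (1 * n)) * ENNReal.ofReal (lam / (lam + 1)) ^ a := fun a => by
    refine (measure_mono fun ω hω => ?_).trans (hZ.measure_sum_Ico_le hlam one_pos 0 a n)
    simp only [not_exists, not_lt, Set.mem_ofPred_eq] at hω ⊢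
    simpa using hω a
  have h2 : Filter.Tendsto (fun a : ℕ => ENNReal.ofReal (Real.exp (1 * n)) *
      ENNReal.ofReal (lam / (lam + 1)) ^ a) Filter.atTop (nhds (ENNReal.ofReal (Real.exp (1 * n)) *
        0)) := by
    refine ENNReal.Tendsto.const_mul (ENNReal.tendsto_pow_atTop_nhds_zero_of_lt_one ?_)
      (.inr ENNReal.ofReal_ne_top)
    rw [ENNReal.ofReal_lt_one, div_lt_one (by positivity)]
    linarith
  rw [mul_zero] at h2
  exact le_antisymm (ge_of_tendsto' h2 h1) zero_le

/-- Almost all realizations are regular. -/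
theorem ae_isRegular [IsProbabilityMeasure φ] [IsProbabilityMeasure ν]
    (hZ : IsTaskStream P lam φ ν Z) (hlam : 0 < lam) {A : Set Plane} (hφ : ∀ᵐ y ∂φ, y ∈ A)
    (hν : ∀ᵐ s ∂ν, 0 ≤ s) (hinit : ∀ i, 0 ≤ (init i).1 ∧ (init i).2 ∈ A) :
    ∀ᵐ ω ∂P, (scenario init fun i => Z i ω).IsRegular A := by
  have hloc : ∀ᵐ ω ∂P, ∀ i, (Z i ω).2.1 ∈ A := ae_all_iff.2 fun i => by
    rw [← hZ.map_loc hlam i] at hφ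
    exact ae_of_ae_map (hZ.measurable i).snd.fst.aemeasurable hφ
  have hserv : ∀ᵐ ω ∂P, ∀ i, 0 ≤ (Z i ω).2.2 := ae_all_iff.2 fun i => by
    rw [← hZ.map_serv hlam i] at hν
    exact ae_of_ae_map (hZ.measurable i).snd.snd.aemeasurable hν
  filter_upwards [hloc, hserv, hZ.ae_arr_pos hlam, hZ.ae_sum_unbounded hlam] with ω h1 h2 h3 h4
  have hmono : StrictMono fun a => ∑ i ∈ Finset.range a, (Z i ω).1 :=
    strictMono_nat_of_lt_succ fun a => by
      rw [Finset.sum_range_succ]; linarith [h3 a]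
  refine ⟨h2, fun j => ?_, fun i j hij => ?_, fun t => ?_⟩
  · by_cases h : j < n₀
    · simpa [scenario, h] using (hinit ⟨j, h⟩).2
    · simpa [scenario, h] using h1 _
  · rcases lt_or_ge i n₀ with hi | hi
    · left
      rw [scenario_arr_of_lt _ hi]
      linarith [(hinit ⟨i, hi⟩).1]
    · right
      obtain ⟨i, rfl⟩ := Nat.exists_eq_add_of_le hi
      obtain ⟨j, rfl⟩ := Nat.exists_eq_add_of_le (hi.trans hij.le)
      rw [scenario_arr_add, scenario_arr_add]
      exact hmono (by omega)
  · obtain ⟨n, hn⟩ := exists_nat_gt t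
    obtain ⟨a, ha⟩ := h4 n
    refine (Set.finite_Iio (n₀ + a)).subset fun j hj => ?_
    by_contra h
    obtain ⟨i, rfl⟩ := Nat.exists_eq_add_of_le (show n₀ ≤ j by
      rw [Set.mem_Iio] at h; omega)
    have h5 : (scenario init fun i => Z i ω).arr (n₀ + i) ≤ t := hj
    rw [scenario_arr_add] at h5
    have h6 : a ≤ i + 1 := by
      rw [Set.mem_Iio] at h; omega
    linarith [hmono.monotone h6]

end IsTaskStream

end

section

namespace IsTaskStream

variable {Ω : Type*} [MeasurableSpace Ω] {P : Measure Ω} {lam : ℝ} {φ : Measure Plane}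
  {ν : Measure ℝ} {Z : ℕ → Ω → ℝ × Plane × ℝ} {n₀ : ℕ} {init : Fin n₀ → ℝ × Plane} {A : Set Plane}

theorem measurable_numArrived (hZ : IsTaskStream P lam φ ν Z) (t : ℝ) :
    Measurable fun ω => (scenario init fun i => Z i ω).numArrived t :=
  (isMeasurable_scenario hZ.measurable_stream).numArrived measurable_const

/-- Exponential bound for the number of arrivals in an interval. -/
theorem measure_lt_numArrived_sub_le [IsProbabilityMeasure P] [IsProbabilityMeasure φ]
    [IsProbabilityMeasure ν] (hZ : IsTaskStream P lam φ ν Z) (hlam : 0 < lam)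
    (hinit : ∀ i, 0 ≤ (init i).1)
    (hreg : ∀ᵐ ω ∂P, (scenario init fun i => Z i ω).IsRegular A) {θ : ℝ} (hθ : 0 < θ) {u ℓ : ℝ}
    (hu : 0 ≤ u) (hℓ : 0 ≤ ℓ) (a : ℕ) :
    P {ω | a < (scenario init fun i => Z i ω).numArrived (u + ℓ) -
        (scenario init fun i => Z i ω).numArrived u} ≤
      ENNReal.ofReal (Real.exp (θ * ℓ)) * ENNReal.ofReal (lam / (lam + θ)) ^ a := by
  set T : ℕ → Ω → ℝ := fun m ω => ∑ i ∈ Finset.range m, (Z i ω).1 with hT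
  have hTm : ∀ m, Measurable (T m) := fun m =>
    Finset.measurable_fun_sum _ fun i _ => (hZ.measurable i).fst
  -- Split by the number `J` of interarrival times completed by time `u`. This event involves the
  -- first `J + 1` of them, so the following `a` are independent of it. The one straddling `u` is
  -- discarded, which is why more than `a` arrivals are assumed.
  set E : ℕ → Set Ω := fun J => {ω | T J ω ≤ u ∧ u < T (J + 1) ω} with hE
  have hEm : ∀ J, MeasurableSet (E J) := fun J =>
    (measurableSet_le (hTm J) measurable_const).inter (measurableSet_lt measurable_const (hTm _))
  set F : ℕ → Set Ω := fun J => {ω | ∑ i ∈ Finset.Ico (J + 1) (J + 1 + a), (Z i ω).1 ≤ ℓ} with hF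
  have hEF : ∀ J, P (E J ∩ F J) = P (E J) * P (F J) := fun J => by
    have hsum : ∀ s : Finset ℕ, Measurable fun x : ℕ → ℝ => ∑ i ∈ s, x i := fun s =>
      Finset.measurable_fun_sum _ fun i _ => measurable_pi_apply i
    have h := indepFun_of_dependsOn
      (g := fun x : ℕ → ℝ => (∑ i ∈ Finset.range J, x i, ∑ i ∈ Finset.range (J + 1), x i))
      (h := fun x : ℕ → ℝ => ∑ i ∈ Finset.Ico (J + 1) (J + 1 + a), x i)
      hZ.iIndepFun_arr (fun i => (hZ.measurable i).fst)
      (show Disjoint (Set.Iio (J + 1)) (Set.Ici (J + 1)) from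
        Set.disjoint_left.2 fun i hi hi' => absurd (Set.mem_Iio.1 hi) (not_lt.2 (Set.mem_Ici.1 hi')))
      ((hsum _).prodMk (hsum _)) (hsum _)
      (fun x y hxy => by
        have h1 : ∀ i < J + 1, x i = y i := fun i hi => hxy i hi
        have h2 : ∑ i ∈ Finset.range J, x i = ∑ i ∈ Finset.range J, y i :=
          Finset.sum_congr rfl fun i hi => h1 i ((Finset.mem_range.1 hi).trans J.lt_succ_self)
        have h3 : ∑ i ∈ Finset.range (J + 1), x i = ∑ i ∈ Finset.range (J + 1), y i :=
          Finset.sum_congr rfl fun i hi => h1 i (Finset.mem_range.1 hi)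
        simp only [h2, h3])
      (fun x y hxy => Finset.sum_congr rfl fun i hi => hxy i (Finset.mem_Ico.1 hi).1)
    exact h.measure_inter_preimage_eq_mul _ _
      ((measurableSet_Iic (a := u)).prod (measurableSet_Ioi (a := u))) (measurableSet_Iic (a := ℓ))
  have hdisj : Pairwise (Function.onFun (AEDisjoint P) E) := by
    have key : ∀ J K, J < K → AEDisjoint P (E J) (E K) := fun J K hJK => by
      have h0 : ∀ᵐ ω ∂P, ω ∉ E J ∩ E K := by
        filter_upwards [hZ.ae_arr_pos hlam] with ω hω
        rintro ⟨h1, h2⟩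
        have h3 : T (J + 1) ω ≤ T K ω := Finset.sum_le_sum_of_subset_of_nonneg
          (Finset.range_mono hJK) fun i _ _ => (hω i).le
        linarith [h1.2, h2.1]
      exact measure_eq_zero_iff_ae_notMem.2 h0
    intro J K hJK
    rcases hJK.lt_or_gt with h | h
    · exact key J K h
    · exact (key K J h).symm
  have hsub : {ω | a < (scenario init fun i => Z i ω).numArrived (u + ℓ) -
        (scenario init fun i => Z i ω).numArrived u} ≤ᵐ[P] ⋃ J, E J ∩ F J := by
    filter_upwards [hreg] with ω hω h
    have h' : a < (scenario init fun i => Z i ω).numArrived (u + ℓ) -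
        (scenario init fun i => Z i ω).numArrived u := h
    have h1 : n₀ ≤ (scenario init fun i => Z i ω).numArrived u := by
      by_contra! hlt
      have h2 := hω.lt_arr_numArrived hu
      rw [scenario_arr_of_lt _ hlt] at h2
      linarith [hinit ⟨_, hlt⟩]
    obtain ⟨J, hJ⟩ := Nat.exists_eq_add_of_le h1
    have hTJ : T J ω ≤ u := by
      rcases Nat.eq_zero_or_pos J with rfl | hpos
      · simpa [hT] using hu
      · have h2 := (hω.arr_le_iff hu (n₀ + (J - 1))).2 (by omega)
        rwa [scenario_arr_add, Nat.sub_add_cancel hpos] at h2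
    have hTJ' : u < T (J + 1) ω := by
      have h2 := hω.lt_arr_numArrived hu
      rwa [hJ, scenario_arr_add] at h2
    have h3 := (hω.arr_le_iff (add_nonneg hu hℓ) (n₀ + (J + a))).2 (by omega)
    rw [scenario_arr_add] at h3
    refine Set.mem_iUnion.2 ⟨J, ⟨hTJ, hTJ'⟩, ?_⟩
    have h4 := Finset.sum_range_add_sum_Ico (fun i => (Z i ω).1) (show J + 1 ≤ J + 1 + a by omega)
    have h5 : T (J + 1) ω = ∑ i ∈ Finset.range (J + 1), (Z i ω).1 := rfl
    rw [show J + 1 + a = J + a + 1 by omega] at h4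
    change ∑ i ∈ Finset.Ico (J + 1) (J + 1 + a), (Z i ω).1 ≤ ℓ
    rw [show J + 1 + a = J + a + 1 by omega]
    linarith
  calc _ ≤ P (⋃ J, E J ∩ F J) := measure_mono_ae hsub
    _ ≤ ∑' J, P (E J ∩ F J) := measure_iUnion_le _
    _ ≤ ∑' J, P (E J) * (ENNReal.ofReal (Real.exp (θ * ℓ)) *
          ENNReal.ofReal (lam / (lam + θ)) ^ a) := by
        refine ENNReal.tsum_le_tsum fun J => ?_
        rw [hEF]
        gcongr
        exact hZ.measure_sum_Ico_le hlam hθ _ _ _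
    _ = (∑' J, P (E J)) * (ENNReal.ofReal (Real.exp (θ * ℓ)) *
          ENNReal.ofReal (lam / (lam + θ)) ^ a) := ENNReal.tsum_mul_right
    _ ≤ 1 * _ := by
        gcongr
        exact (tsum_meas_le_meas_iUnion_of_disjoint₀ P (fun J => (hEm J).nullMeasurableSet)
          hdisj).trans prob_le_one
    _ = _ := one_mul _

/-- A sum with random upper limit is a series of tail indicators, whose probabilities decay
geometrically. -/
theorem lintegral_sum_range_numArrived_le [IsProbabilityMeasure P] [IsProbabilityMeasure φ]
    [IsProbabilityMeasure ν] (hZ : IsTaskStream P lam φ ν Z) (hlam : 0 < lam)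
    (hinit : ∀ i, 0 ≤ (init i).1)
    (hreg : ∀ᵐ ω ∂P, (scenario init fun i => Z i ω).IsRegular A) {θ : ℝ} (hθ : 0 < θ) {u ℓ : ℝ}
    (hu : 0 ≤ u) (hℓ : 0 ≤ ℓ) (h : ℕ → ℝ≥0∞) :
    ∫⁻ ω, ∑ a ∈ Finset.range ((scenario init fun i => Z i ω).numArrived (u + ℓ) -
        (scenario init fun i => Z i ω).numArrived u), h a ∂P ≤
      ∑' a, h a * (ENNReal.ofReal (Real.exp (θ * ℓ)) *
        ENNReal.ofReal (lam / (lam + θ)) ^ a) := by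
  set X : Ω → ℕ := fun ω => (scenario init fun i => Z i ω).numArrived (u + ℓ) -
        (scenario init fun i => Z i ω).numArrived u with hX
  have hXm : Measurable X := (hZ.measurable_numArrived _).sub (hZ.measurable_numArrived _)
  have hS : ∀ a, MeasurableSet {ω | a < X ω} := fun a => hXm measurableSet_Ioi
  calc ∫⁻ ω, ∑ a ∈ Finset.range (X ω), h a ∂P
      = ∫⁻ ω, ∑' a, {ω | a < X ω}.indicator (fun _ => h a) ω ∂P := by
        refine lintegral_congr fun ω => ?_
        have h1 : ∑' a, {ω | a < X ω}.indicator (fun _ => h a) ω =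
            ∑ a ∈ Finset.range (X ω), {ω | a < X ω}.indicator (fun _ => h a) ω :=
          tsum_eq_sum fun a ha => Set.indicator_of_notMem (s := {ω | a < X ω})
            (fun hω => ha (Finset.mem_range.2 hω)) _
        rw [h1]
        exact Finset.sum_congr rfl fun a ha =>
          (Set.indicator_of_mem (s := {ω | a < X ω}) (Finset.mem_range.1 ha) fun _ => h a).symm
    _ = ∑' a, h a * P {ω | a < X ω} := by
        rw [lintegral_tsum fun a => (measurable_const.indicator (hS a)).aemeasurable]
        simp_rw [lintegral_indicator_const (hS _)]
    _ ≤ _ := ENNReal.tsum_le_tsum fun a => by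
        gcongr
        exact hZ.measure_lt_numArrived_sub_le hlam hinit hreg hθ hu hℓ a

/-- The expected number of arrivals in an interval of unit length is bounded. -/
theorem exists_lintegral_numArrived_le [IsProbabilityMeasure P] [IsProbabilityMeasure φ]
    [IsProbabilityMeasure ν] (hZ : IsTaskStream P lam φ ν Z) (hlam : 0 < lam)
    (hinit : ∀ i, 0 ≤ (init i).1)
    (hreg : ∀ᵐ ω ∂P, (scenario init fun i => Z i ω).IsRegular A) :
    ∃ K : ℝ≥0∞, K < ⊤ ∧ ∀ u : ℝ, 0 ≤ u →
      ∫⁻ ω, ((scenario init fun i => Z i ω).numArrived (u + 1) -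
        (scenario init fun i => Z i ω).numArrived u : ℕ) ∂P ≤ K := by
  refine ⟨∑' a : ℕ, 1 * (ENNReal.ofReal (Real.exp (1 * 1)) * ENNReal.ofReal (lam / (lam + 1)) ^ a),
    ?_, fun u hu => ?_⟩
  · simp_rw [one_mul]
    rw [ENNReal.tsum_mul_left, ENNReal.tsum_geometric]
    refine ENNReal.mul_lt_top ENNReal.ofReal_lt_top (ENNReal.inv_lt_top.2 ?_)
    rw [tsub_pos_iff_lt, ENNReal.ofReal_lt_one, div_lt_one (by positivity)]
    linarith
  · refine le_trans (le_of_eq ?_) (hZ.lintegral_sum_range_numArrived_le hlam hinit hreg one_pos hu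
      zero_le_one fun _ => 1)
    simp

/-- A term is at least `b` once `b * (a + 1)` exceeds `c`, and from there on the left side grows by
`b` per step. The exponentials fit the geometric tails. -/
theorem mul_sub_le_sum_exp {b c γ : ℝ} (hb : 0 ≤ b) (hc : 0 ≤ c) (hγ : 0 ≤ γ) (n : ℕ) :
    b * n - c ≤ ∑ a ∈ Finset.range n, b * Real.exp (γ * (b * (a + 1) - c)) := by
  induction n with
  | zero => simpa using hc
  | succ n ih =>
    rw [Finset.sum_range_succ]
    push_cast
    rcases le_or_gt (b * (n + 1) - c) 0 with h | h
    · refine h.trans (add_nonneg (Finset.sum_nonneg fun a _ => ?_) ?_) <;> positivity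
    · have h1 : 1 ≤ Real.exp (γ * (b * (n + 1) - c)) := Real.one_le_exp (by positivity)
      nlinarith

/-- The excess of the number of arrivals over a larger linear function, summed over all intervals
with a given right end point. -/
theorem exists_tsum_lintegral_numArrived_sub_le [IsProbabilityMeasure P] [IsProbabilityMeasure φ]
    [IsProbabilityMeasure ν] (hZ : IsTaskStream P lam φ ν Z) (hlam : 0 < lam)
    (hinit : ∀ i, 0 ≤ (init i).1)
    (hreg : ∀ᵐ ω ∂P, (scenario init fun i => Z i ω).IsRegular A) {b c : ℝ} (hb : 0 < b)
    (hbc : lam * b < c) :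
    ∃ K : ℝ≥0∞, K < ⊤ ∧ ∀ u : ℕ → ℝ, (∀ l, 0 ≤ u l) →
      ∑' l : ℕ, ∫⁻ ω, ENNReal.ofReal (b * ((scenario init fun i => Z i ω).numArrived (u l + (l + 1)) -
        (scenario init fun i => Z i ω).numArrived (u l) : ℕ) - c * l) ∂P ≤ K := by
  have hlb : 0 < lam * b := by positivity
  have hc : 0 < c := hlb.trans hbc
  obtain ⟨y, hy0, hy⟩ : ∃ y : ℝ, 0 < y ∧ lam * b * (1 + y) < c := by
    refine ⟨(c - lam * b) / (2 * (lam * b)), div_pos (by linarith) (by positivity), ?_⟩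
    have : lam * b * (1 + (c - lam * b) / (2 * (lam * b))) = lam * b + (c - lam * b) / 2 := by
      field_simp
    linarith
  -- The lower bound on `γ` makes the series over `l` converge. The upper bound does so for the
  -- series over `a`, because `log (1 + y) ≥ y / (1 + y)`.
  obtain ⟨γ, hγ1, hγ2⟩ : ∃ γ, lam * y / c < γ ∧ γ < y / ((1 + y) * b) := by
    refine exists_between ?_
    rw [div_lt_div_iff₀ hc (by positivity)]
    nlinarith
  have hγ0 : 0 < γ := lt_trans (by positivity) hγ1
  set θ := lam * y with hθ
  have hθ0 : 0 < θ := by positivity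
  have hr : Real.exp (θ - γ * c) < 1 := by
    rw [Real.exp_lt_one_iff]
    rw [div_lt_iff₀ hc] at hγ1
    linarith
  have hr' : Real.exp (γ * b) * (lam / (lam + θ)) < 1 := by
    have h1 : lam / (lam + θ) = (1 + y)⁻¹ := by
      rw [hθ]; field_simp
    rw [h1, ← div_eq_mul_inv, div_lt_one (by positivity), ← Real.lt_log_iff_exp_lt (by positivity)]
    have h2 := Real.one_sub_inv_le_log_of_pos (show 0 < 1 + y by positivity)
    have h3 : 1 - (1 + y)⁻¹ = y / (1 + y) := by field_simp; ring
    have h4 : γ * b < y / (1 + y) := by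
      rw [lt_div_iff₀ (by positivity)] at hγ2 ⊢
      linarith
    linarith
  set M := b * Real.exp (γ * b) * Real.exp θ with hM
  have hterm : ∀ l a : ℕ, ENNReal.ofReal (b * Real.exp (γ * (b * (a + 1) - c * l))) *
      (ENNReal.ofReal (Real.exp (θ * (l + 1))) * ENNReal.ofReal (lam / (lam + θ)) ^ a) =
      ENNReal.ofReal M * ENNReal.ofReal (Real.exp (θ - γ * c)) ^ l *
        ENNReal.ofReal (Real.exp (γ * b) * (lam / (lam + θ))) ^ a := fun l a => by
    have h0 : 0 ≤ lam / (lam + θ) := by positivity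
    rw [← ENNReal.ofReal_pow h0, ← ENNReal.ofReal_pow (Real.exp_pos _).le,
      ← ENNReal.ofReal_pow (by positivity), ← ENNReal.ofReal_mul (Real.exp_pos _).le,
      ← ENNReal.ofReal_mul (by positivity), ← ENNReal.ofReal_mul (by positivity),
      ← ENNReal.ofReal_mul (by positivity)]
    congr 1
    rw [hM, mul_pow, ← Real.exp_nat_mul, ← Real.exp_nat_mul,
      show γ * (b * (a + 1) - c * l) = γ * b + a * (γ * b) + -(l * (γ * c)) by ring,
      show θ * ((l : ℝ) + 1) = θ + l * θ by ring,
      show (l : ℝ) * (θ - γ * c) = l * θ + -(l * (γ * c)) by ring]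
    simp only [Real.exp_add]
    ring
  refine ⟨∑' l : ℕ, ∑' a : ℕ, ENNReal.ofReal M * ENNReal.ofReal (Real.exp (θ - γ * c)) ^ l *
        ENNReal.ofReal (Real.exp (γ * b) * (lam / (lam + θ))) ^ a, ?_, fun u hu => ?_⟩
  · simp_rw [ENNReal.tsum_mul_left, ENNReal.tsum_mul_right, ENNReal.tsum_mul_left,
      ENNReal.tsum_geometric]
    refine ENNReal.mul_lt_top (ENNReal.mul_lt_top ENNReal.ofReal_lt_top ?_) ?_ <;>
      rw [ENNReal.inv_lt_top, tsub_pos_iff_lt, ENNReal.ofReal_lt_one]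
    exacts [hr, hr']
  · refine ENNReal.tsum_le_tsum fun l => ?_
    simp_rw [← hterm]
    refine le_trans (lintegral_mono fun ω => ?_) (hZ.lintegral_sum_range_numArrived_le hlam hinit
      hreg hθ0 (hu l) (by positivity) _)
    rw [← ENNReal.ofReal_sum_of_nonneg fun a _ => by positivity]
    exact ENNReal.ofReal_le_ofReal (mul_sub_le_sum_exp hb.le (by positivity) hγ0.le _)

/-! ### Services of the tasks that have arrived -/

/-- The number of arrivals depends on arrival coordinates and the walk on service coordinates only.
Splitting by the value of the random index therefore preserves the uniform bound. -/
theorem exists_lintegral_lindley_le [IsProbabilityMeasure P] [IsProbabilityMeasure φ]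
    [IsProbabilityMeasure ν] (hZ : IsTaskStream P lam φ ν Z) (hlam : 0 < lam)
    (hν2 : MemLp (fun s => s) 2 ν) {c : ℝ} (hc : ∫ s, s ∂ν < c) :
    ∃ K : ℝ≥0∞, K < ⊤ ∧ ∀ t : ℝ, ∫⁻ ω, ENNReal.ofReal (lindley
      ((scenario init fun i => Z i ω).numArrived t) fun i => (Z i ω).2.2 - c) ∂P ≤ K := by
  have hsm : ∀ i, Measurable fun ω => (Z i ω).2.2 := fun i => (hZ.measurable i).snd.snd
  have hcm : Measurable fun x : ℝ => x - c := measurable_id.sub_const c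
  set X : ℕ → Ω → ℝ := fun i ω => (Z i ω).2.2 - c with hX
  have hXm : ∀ i, Measurable (X i) := fun i => (hsm i).sub_const c
  have hν1 : Integrable (fun s => s) ν := hν2.integrable one_le_two
  obtain ⟨C, hC⟩ := exists_integral_lindley_le (X := X) (μ := ν.map fun x => x - c)
    (hZ.iIndepFun_serv.comp (fun _ x => x - c) fun _ => hcm) hXm
    (fun i => by
      rw [← hZ.map_serv hlam i, Measure.map_map hcm (hsm i)]
      rfl)
    ((memLp_map_measure_iff (g := fun x => x) aestronglyMeasurable_id hcm.aemeasurable).2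
      (hν2.sub (memLp_const c)))
    (by
      rw [integral_map (f := fun x => x) hcm.aemeasurable aestronglyMeasurable_id,
        integral_sub hν1 (integrable_const c)]
      simpa using hc)
  have hXp : ∀ i, MemLp (X i) 2 P := fun i => by
    have h1 : MemLp (fun s => s) 2 (P.map fun ω => (Z i ω).2.2) := by rwa [hZ.map_serv hlam i]
    exact ((memLp_map_measure_iff aestronglyMeasurable_id (hsm i).aemeasurable).1 h1).sub
      (memLp_const c)
  have hlint : ∀ b, ∫⁻ ω, ENNReal.ofReal (lindley b fun i => X i ω) ∂P ≤ ENNReal.ofReal C :=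
    fun b => by
      rw [← ofReal_integral_eq_lintegral_ofReal ((memLp_lindley hXp hXm b).integrable one_le_two)
        (ae_of_all _ fun ω => lindley_nonneg _ _)]
      exact ENNReal.ofReal_le_ofReal (hC b)
  refine ⟨ENNReal.ofReal C, ENNReal.ofReal_lt_top, fun t => ?_⟩
  set N : Ω → ℕ := fun ω => (scenario init fun i => Z i ω).numArrived t with hN
  have hNm : Measurable N := hZ.measurable_numArrived t
  have hS : ∀ b, MeasurableSet {ω | N ω = b} := fun b => hNm (measurableSet_singleton b)
  have hLm : ∀ b, Measurable fun ω => ENNReal.ofReal (lindley b fun i => X i ω) := fun b =>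
    ((measurable_lindley b).comp (measurable_pi_lambda _ hXm)).ennreal_ofReal
  have hind : ∀ b, IndepFun N (fun ω => lindley b fun i => X i ω) P := fun b => by
    refine indepFun_of_dependsOn
      (g := fun y => (scenario init (ofCoord y)).numArrived t)
      (h := fun y : ℕ × Bool → ℝ × Plane => lindley b fun i => (y (i, true)).1 - c)
      (hZ.iIndepFun_coord hlam) hZ.measurable_coord
      (S := {q | q.2 = false}) (T := {q | q.2 = true})
      (Set.disjoint_left.2 fun q h h' => by simp_all)
      ((isMeasurable_scenario measurable_ofCoord).numArrived measurable_const)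
      ((measurable_lindley b).comp (measurable_pi_lambda _ fun i =>
        (measurable_pi_apply _).fst.sub_const c))
      (fun x y hxy => ?_) (fun x y hxy => lindley_congr fun i _ => by rw [hxy (i, true) rfl])
    have : (scenario init (ofCoord x)).arr = (scenario init (ofCoord y)).arr := by
      ext j
      simp only [scenario, ofCoord]
      split_ifs
      · rfl
      · exact Finset.sum_congr rfl fun i _ => by rw [hxy (i, false) rfl]
    simp only [Scenario.numArrived, this]
  calc ∫⁻ ω, ENNReal.ofReal (lindley (N ω) fun i => X i ω) ∂P
      = ∫⁻ ω, ∑' b, {ω | N ω = b}.indicator 1 ω * ENNReal.ofReal (lindley b fun i => X i ω) ∂P := by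
        refine lintegral_congr fun ω => ?_
        rw [tsum_eq_single (N ω) fun b hb => by
          rw [Set.indicator_of_notMem (fun h => hb h.symm), zero_mul]]
        rw [Set.indicator_of_mem (by simp), Pi.one_apply, one_mul]
    _ = ∑' b, ∫⁻ ω, {ω | N ω = b}.indicator 1 ω * ENNReal.ofReal (lindley b fun i => X i ω) ∂P :=
        lintegral_tsum fun b => ((measurable_one.indicator (hS b)).mul (hLm b)).aemeasurable
    _ ≤ ∑' b, P {ω | N ω = b} * ENNReal.ofReal C := by
        refine ENNReal.tsum_le_tsum fun b => ?_
        have h1 := (hind b).comp (φ := fun n => ({b} : Set ℕ).indicator (1 : ℕ → ℝ≥0∞) n)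
          (ψ := ENNReal.ofReal) (measurable_one.indicator (measurableSet_singleton b))
          ENNReal.measurable_ofReal
        have h2 := lintegral_mul_eq_lintegral_mul_lintegral_of_indepFun
          (f := {ω | N ω = b}.indicator (1 : Ω → ℝ≥0∞))
          (measurable_one.indicator (hS b)) (hLm b) h1
        refine (le_of_eq (show _ = _ from h2)).trans ?_
        rw [lintegral_indicator_one (hS b)]
        gcongr
        exact hlint b
    _ = (∑' b, P {ω | N ω = b}) * ENNReal.ofReal C := ENNReal.tsum_mul_right
    _ ≤ 1 * ENNReal.ofReal C := by
        gcongr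
        refine (tsum_meas_le_meas_iUnion_of_disjoint P hS fun b b' hbb' => ?_).trans prob_le_one
        exact Set.disjoint_left.2 fun ω h h' => hbb' (h.symm.trans h')
    _ = _ := one_mul _

end IsTaskStream

end

section

/-! ### Iterations with few outstanding tasks -/

namespace Scenario

variable {w : Scenario} {pl : Planner} {η p c : ℝ} {xw x₀ : Plane} {A : Set Plane} {N : ℕ}

/-- The realizations for which few tasks are outstanding at the beginning of iteration `k`, which
falls in `(a, b]`, and for which `j` is one of these tasks. -/
def smallEvent (pl : Planner) (η : ℝ) (x₀ xw : Plane) (p : ℝ) (N : ℕ) (c a b : ℝ) (k j : ℕ) :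
    Set Scenario :=
  {w | w.IsSmall p N c (w.state pl η x₀ xw k) ∧ (w.state pl η x₀ xw k).time ∈ Set.Ioc a b ∧
    j ∈ w.outstanding (w.state pl η x₀ xw k)}

/-- On this event task `j` has not been served yet, so its service time cannot have influenced the
state. -/
theorem AgreeOff.mem_smallEvent {a b : ℝ} {k j : ℕ} {w' : Scenario} (h : AgreeOff j w w')
    (hw : w ∈ smallEvent pl η x₀ xw p N c a b k j) : w' ∈ smallEvent pl η x₀ xw p N c a b k j := by
  obtain ⟨h1, h2, h3⟩ := hw
  have h4 : w.state pl η x₀ xw k = w'.state pl η x₀ xw k := h.state_eq pl η x₀ xw fun h5 =>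
    (Finset.mem_sdiff.1 (w.outstanding_eq _ ▸ h3)).2 h5
  rw [h.isSmall_iff, h4] at h1
  rw [h4] at h2
  rw [h.outstanding_eq, h4] at h3
  exact ⟨h1, h2, h3⟩

theorem IsMeasurable.mem_smallEvent {Ω : Type*} [MeasurableSpace Ω] {w : Ω → Scenario}
    (hw : IsMeasurable w) (hpl : pl.IsMeasurable) (a b : ℝ) (k j : ℕ) :
    MeasurableSet {ω | w ω ∈ smallEvent pl η x₀ xw p N c a b k j} := by
  have hs := hw.state hpl η x₀ xw k
  exact (hw.isSmall hs p N c).inter ((hs.time measurableSet_Ioc).inter (hw.mem_outstanding hs j))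

theorem IsRegular.card_served (hw : w.IsRegular A) {s : State} (hs : w.IsValid A s) :
    s.served.card + (w.queue s).length = w.numArrived s.time := by
  have h : s.served ⊆ Finset.range (w.numArrived s.time) := fun j hj =>
    Finset.mem_range.2 ((hw.arr_le_iff hs.time_nonneg j).1 (hs.arr_le j hj))
  rw [← w.card_outstanding, outstanding_eq, add_comm, Finset.card_sdiff_add_card_eq_card h,
    Finset.card_range]

/-- The number of iterations with few outstanding tasks that begin in a given interval. -/
theorem IsRegular.card_le_of_isSmall (hw : w.IsRegular A) (hcv : Convex ℝ A) (hxw : xw ∈ A)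
    (hx₀ : x₀ ∈ A) (hη : 0 < η) {u v : ℝ} (F : Finset ℕ)
    (hF : ∀ k ∈ F, w.IsSmall p N c (w.state pl η x₀ xw k) ∧
      u ≤ (w.state pl η x₀ xw k).time ∧ (w.state pl η x₀ xw k).time ≤ v) :
    F.card ≤ N + (w.numArrived v - w.numArrived u) := by
  set S := w.state pl η x₀ xw with hS
  have hv : ∀ k, w.IsValid A (S k) := hw.isValid_state hcv hxw hx₀
  have hmono : Monotone fun k => (S k).served.card := monotone_nat_of_le_succ fun k =>
    Finset.card_le_card (by rw [hS, state_succ]; exact w.served_subset_step pl η xw _)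
  have hlt : ∀ k ∈ F, ∀ k', k < k' → (S k).served.card < (S k').served.card := fun k hk k' h => by
    have h1 := hw.card_served_lt_step (pl := pl) (xw := xw) hη (hv k) (hF k hk).1.1
    rw [← w.state_succ] at h1
    exact h1.trans_le (hmono h)
  -- The number of served tasks strictly increases from one such iteration to any later one, and it
  -- differs from the number of arrivals by less than `N`.
  have hcard : F.card ≤ (Finset.Ico (w.numArrived u - N) (w.numArrived v)).card := by
    refine Finset.card_le_card_of_injOn (fun k => (S k).served.card) (fun k hk => ?_)
      fun k hk k' hk' h => ?_
    · obtain ⟨⟨h1, h2, -⟩, h3, h4⟩ := hF k hk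
      have h5 := hw.card_served (hv k)
      have h6 := hw.numArrived_mono h3
      have h7 := hw.numArrived_mono h4
      have h8 := List.length_pos_iff.2 h1
      simp only [Finset.coe_Ico, Set.mem_Ico]
      change w.numArrived u ≤ w.numArrived (S k).time at h6
      change w.numArrived (S k).time ≤ w.numArrived v at h7
      change 0 < (w.queue (S k)).length at h8
      change (w.queue (S k)).length < N at h2
      omega
    · rcases lt_trichotomy k k' with hlt' | rfl | hlt'
      · exact absurd h (hlt k hk k' hlt').ne
      · rfl
      · exact absurd h.symm (hlt k' hk' k hlt').ne
  rw [Nat.card_Ico] at hcard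
  omega

open Classical in
theorem tsum_indicator_outstanding_le (w : Scenario) (k : ℕ) {a b : ℝ} :
    ∑' j, (smallEvent pl η x₀ xw p N c a b k j).indicator (1 : Scenario → ℝ≥0∞) w ≤
      if w.IsSmall p N c (w.state pl η x₀ xw k) ∧ (w.state pl η x₀ xw k).time ∈ Set.Ioc a b
        then (N : ℝ≥0∞) else 0 := by
  split_ifs with h
  · have h1 : ∑' j, (smallEvent pl η x₀ xw p N c a b k j).indicator (1 : Scenario → ℝ≥0∞) w =
        ∑ j ∈ w.outstanding (w.state pl η x₀ xw k),
          (smallEvent pl η x₀ xw p N c a b k j).indicator (1 : Scenario → ℝ≥0∞) w :=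
      tsum_eq_sum fun j hj => Set.indicator_of_notMem (fun h' => hj h'.2.2) _
    rw [h1]
    calc _ ≤ ∑ _j ∈ w.outstanding (w.state pl η x₀ xw k), (1 : ℝ≥0∞) :=
          Finset.sum_le_sum fun j _ => Set.indicator_le_self' (fun _ _ => zero_le) w
      _ = (w.queue (w.state pl η x₀ xw k)).length := by
          rw [Finset.sum_const, nsmul_one, w.card_outstanding]
      _ ≤ N := by exact_mod_cast h.1.2.1.le
  · refine le_of_eq (ENNReal.tsum_eq_zero.2 fun j => ?_)
    exact Set.indicator_of_notMem (fun h' => h ⟨h'.1, h'.2.1⟩) _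

/-- Each small iteration contributes fewer than `N` tasks, and the number of small iterations is at
most `N` plus the arrivals. The interval is moved to nonnegative times, where arrivals have bounded
expectation. -/
theorem IsRegular.tsum_tsum_indicator_le (hw : w.IsRegular A) (hcv : Convex ℝ A) (hxw : xw ∈ A)
    (hx₀ : x₀ ∈ A) (hη : 0 < η) (b : ℝ) :
    ∑' k, ∑' j, (smallEvent pl η x₀ xw p N c (b - 1) b k j).indicator (1 : Scenario → ℝ≥0∞) w ≤
      N * (N + (w.numArrived (max (b - 1) 0 + 1) - w.numArrived (max (b - 1) 0) : ℕ)) := by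
  classical
  refine (ENNReal.tsum_le_tsum fun k => w.tsum_indicator_outstanding_le k).trans ?_
  rw [ENNReal.tsum_eq_iSup_sum]
  refine iSup_le fun F => ?_
  set G := F.filter fun k => w.IsSmall p N c (w.state pl η x₀ xw k) ∧
        (w.state pl η x₀ xw k).time ∈ Set.Ioc (b - 1) b with hG
  have h1 := hw.card_le_of_isSmall (pl := pl) (p := p) (N := N) (c := c) hcv hxw hx₀ hη
    (u := max (b - 1) 0) (v := max (b - 1) 0 + 1) G fun k hk => by
      obtain ⟨-, h1, h2, h3⟩ := Finset.mem_filter.1 hk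
      refine ⟨h1, max_le h2.le (hw.isValid_state hcv hxw hx₀ k).time_nonneg, ?_⟩
      linarith [le_max_left (b - 1) 0]
  rw [← Finset.sum_filter, Finset.sum_const, ← hG, nsmul_eq_mul, mul_comm]
  gcongr
  exact_mod_cast h1

end Scenario

namespace IsTaskStream

variable {Ω : Type*} [MeasurableSpace Ω] {P : Measure Ω} {lam : ℝ} {φ : Measure Plane}
  {ν : Measure ℝ} {Z : ℕ → Ω → ℝ × Plane × ℝ} {n₀ : ℕ} {init : Fin n₀ → ℝ × Plane} {A : Set Plane}
  {pl : Planner} {η p c : ℝ} {xw x₀ : Plane} {N : ℕ}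

/-- A service time is independent of an event that the service time does not influence. -/
theorem lintegral_indicator_mul_serv [IsProbabilityMeasure P] [IsProbabilityMeasure φ]
    [IsProbabilityMeasure ν] (hZ : IsTaskStream P lam φ ν Z) (hlam : 0 < lam) {B : Set Scenario}
    {j : ℕ} (hB : ∀ w w', Scenario.AgreeOff j w w' → w ∈ B → w' ∈ B)
    (hBm : MeasurableSet {z | scenario init z ∈ B})
    {f : ℝ → ℝ≥0∞} (hf : Measurable f) :
    ∫⁻ ω, B.indicator 1 (scenario init fun i => Z i ω) * f (Z j ω).2.2 ∂P =
      (∫⁻ ω, B.indicator 1 (scenario init fun i => Z i ω) ∂P) * ∫⁻ x, f x ∂ν := by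
  -- Overwriting the service time of `j` by zero does not change membership in `B`, so the indicator
  -- is a function of the other coordinates.
  have hmod : Measurable fun (y : ℕ × Bool → ℝ × Plane) =>
      ofCoord (Function.update y (j, true) 0) :=
    measurable_ofCoord.comp (measurable_pi_lambda _ fun q => by
      by_cases h : q = (j, true)
      · subst h
        simp only [Function.update_self]
        exact measurable_const
      · simp only [Function.update_of_ne h]
        exact measurable_pi_apply q)
  have hagree : ∀ y : ℕ × Bool → ℝ × Plane, Scenario.AgreeOff j (scenario init (ofCoord y))
      (scenario init (ofCoord (Function.update y (j, true) 0))) := fun y => by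
    refine ⟨?_, ?_, fun i hi => ?_⟩
    · simp [scenario, ofCoord]
    · simp [scenario, ofCoord]
    · simp [scenario, ofCoord, hi]
  have hind := indepFun_of_dependsOn
    (g := fun y => B.indicator (1 : Scenario → ℝ≥0∞)
      (scenario init (ofCoord (Function.update y (j, true) 0))))
    (h := fun y : ℕ × Bool → ℝ × Plane => f (y (j, true)).1)
    (hZ.iIndepFun_coord hlam) hZ.measurable_coord (S := {(j, true)}ᶜ) (T := {(j, true)})
    disjoint_compl_left
    ((measurable_one.indicator hBm).comp hmod) (hf.comp (measurable_pi_apply _).fst)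
    (fun x y hxy => by
      have : Function.update x (j, true) 0 = Function.update y (j, true) 0 := by
        ext1 q
        by_cases h : q = (j, true)
        · subst h; simp
        · simp only [Function.update_of_ne h]
          exact hxy q h
      simp only [this])
    (fun x y hxy => congrArg (fun a => f a.1) (hxy (j, true) rfl))
  have hB' : ∀ ω, B.indicator (1 : Scenario → ℝ≥0∞) (scenario init (ofCoord
      (Function.update (fun q => coord Z q ω) (j, true) 0))) =
      B.indicator 1 (scenario init fun i => Z i ω) := fun ω => by
    have h := hagree fun q => coord Z q ω
    by_cases h1 : scenario init (fun i => Z i ω) ∈ B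
    · rw [Set.indicator_of_mem h1, Set.indicator_of_mem (hB _ _ h h1)]
      rfl
    · rw [Set.indicator_of_notMem h1, Set.indicator_of_notMem fun h2 => h1 (hB _ _ h.symm h2)]
  simp only [hB'] at hind
  have h1 := lintegral_mul_eq_lintegral_mul_lintegral_of_indepFun
    ((measurable_one.indicator hBm).comp hZ.measurable_stream)
    (hf.comp (hZ.measurable j).snd.snd) hind
  refine (show _ = _ from h1).trans ?_
  congr 1
  rw [← hZ.map_serv hlam j, lintegral_map hf (hZ.measurable j).snd.snd]
  rfl

/-- About `x / d` terms are nonzero and each is at most `x`. The quadratic growth is what calls for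
a second moment. -/
theorem tsum_ofReal_sub_mul_le {d x : ℝ} (hd : 0 < d) (hx : 0 ≤ x) :
    ∑' l : ℕ, ENNReal.ofReal (x - d * l) ≤ ENNReal.ofReal ((x / d + 1) * x) := by
  have h1 : ∑' l : ℕ, ENNReal.ofReal (x - d * l) =
      ∑ l ∈ Finset.range ⌈x / d⌉₊, ENNReal.ofReal (x - d * l) :=
    tsum_eq_sum fun l hl => by
      rw [Finset.mem_range, not_lt, Nat.ceil_le, div_le_iff₀ hd] at hl
      exact ENNReal.ofReal_of_nonpos (by linarith)
  rw [h1]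
  calc _ ≤ ∑ _l ∈ Finset.range ⌈x / d⌉₊, ENNReal.ofReal x :=
        Finset.sum_le_sum fun l _ => ENNReal.ofReal_le_ofReal (by
          have : 0 ≤ d * l := by positivity
          linarith)
    _ = ENNReal.ofReal (⌈x / d⌉₊ * x) := by
        rw [Finset.sum_const, Finset.card_range, nsmul_eq_mul, ENNReal.ofReal_mul (by positivity),
          ENNReal.ofReal_natCast]
    _ ≤ _ := ENNReal.ofReal_le_ofReal (by
        gcongr
        exact (Nat.ceil_lt_add_one (by positivity)).le)

theorem tsum_lintegral_ofReal_sub_mul_lt_top [IsProbabilityMeasure ν] (hν : ∀ᵐ s ∂ν, 0 ≤ s)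
    (hν2 : MemLp (fun s => s) 2 ν) {d : ℝ} (hd : 0 < d) :
    ∑' l : ℕ, ∫⁻ x, ENNReal.ofReal (x - d * l) ∂ν < ⊤ := by
  rw [← lintegral_tsum fun l => by fun_prop]
  have hint : Integrable (fun x : ℝ => (x / d + 1) * x) ν := by
    have h1 : (fun x : ℝ => (x / d + 1) * x) = fun x => d⁻¹ * x ^ 2 + x := by
      ext x; ring
    rw [h1]
    exact (hν2.integrable_sq.const_mul _).add (hν2.integrable one_le_two)
  refine lt_of_le_of_lt (lintegral_mono_ae ?_) hint.lintegral_lt_top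
  filter_upwards [hν] with x hx using tsum_ofReal_sub_mul_le hd hx

/-- The services of the outstanding tasks, summed over all iterations with few outstanding tasks,
discounted by the time since the beginning of the iteration. -/
theorem exists_tsum_lintegral_smallEvent_le [IsProbabilityMeasure P] [IsProbabilityMeasure φ]
    [IsProbabilityMeasure ν] (hZ : IsTaskStream P lam φ ν Z) (hlam : 0 < lam)
    (hν : ∀ᵐ s ∂ν, 0 ≤ s) (hν2 : MemLp (fun s => s) 2 ν)
    (hinit : ∀ i, 0 ≤ (init i).1) (hreg : ∀ᵐ ω ∂P, (scenario init fun i => Z i ω).IsRegular A)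
    (hcv : Convex ℝ A) (hxw : xw ∈ A) (hx₀ : x₀ ∈ A) (hη : 0 < η) (hplm : pl.IsMeasurable)
    {d : ℝ} (hd : 0 < d) (p : ℝ) (N : ℕ) (c : ℝ) :
    ∃ K : ℝ≥0∞, K < ⊤ ∧ ∀ t : ℝ, ∑' l : ℕ, ∑' k, ∑' j, ∫⁻ ω,
      (Scenario.smallEvent pl η x₀ xw p N c (t - l - 1) (t - l) k j).indicator 1
        (scenario init fun i => Z i ω) * ENNReal.ofReal ((Z j ω).2.2 - d * l) ∂P ≤ K := by
  obtain ⟨K, hK, hKb⟩ := hZ.exists_lintegral_numArrived_le hlam hinit hreg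
  refine ⟨∑' l : ℕ, N * (N + K) * ∫⁻ x, ENNReal.ofReal (x - d * l) ∂ν, ?_, fun t => ?_⟩
  · rw [ENNReal.tsum_mul_left]
    exact ENNReal.mul_lt_top (ENNReal.mul_lt_top (ENNReal.natCast_lt_top _)
      (ENNReal.add_lt_top.2 ⟨ENNReal.natCast_lt_top _, hK⟩))
      (tsum_lintegral_ofReal_sub_mul_lt_top hν hν2 hd)
  · refine ENNReal.tsum_le_tsum fun l => ?_
    have hBm : ∀ k j, MeasurableSet {z | scenario init z ∈
        Scenario.smallEvent pl η x₀ xw p N c (t - l - 1) (t - l) k j} := fun k j =>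
      (isMeasurable_scenario measurable_id).mem_smallEvent hplm _ _ k j
    have hm : ∀ k j, Measurable fun ω =>
        (Scenario.smallEvent pl η x₀ xw p N c (t - l - 1) (t - l) k j).indicator
          (1 : Scenario → ℝ≥0∞) (scenario init fun i => Z i ω) := fun k j =>
      (measurable_one.indicator (hBm k j)).comp hZ.measurable_stream
    simp_rw [fun k j => hZ.lintegral_indicator_mul_serv hlam
      (B := Scenario.smallEvent pl η x₀ xw p N c (t - l - 1) (t - l) k j) (j := j)
      (fun w w' h hw => h.mem_smallEvent hw) (hBm k j)
      (show Measurable fun x : ℝ => ENNReal.ofReal (x - d * l) by fun_prop),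
      ENNReal.tsum_mul_right]
    gcongr
    simp_rw [← lintegral_tsum fun j => (hm _ j).aemeasurable]
    rw [← lintegral_tsum fun k => (Measurable.tsum fun j => hm k j).aemeasurable]
    calc _ ≤ ∫⁻ ω, N * (N + ((scenario init fun i => Z i ω).numArrived
            (max (t - l - 1) 0 + 1) - (scenario init fun i => Z i ω).numArrived
            (max (t - l - 1) 0) : ℕ)) ∂P := by
          refine lintegral_mono_ae ?_
          filter_upwards [hreg] with ω hω using hω.tsum_tsum_indicator_le hcv hxw hx₀ hη (t - l)
      _ = N * (N + ∫⁻ ω, ((scenario init fun i => Z i ω).numArrived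
            (max (t - l - 1) 0 + 1) - (scenario init fun i => Z i ω).numArrived
            (max (t - l - 1) 0) : ℕ) ∂P) := by
          rw [lintegral_const_mul' _ _ (ENNReal.natCast_ne_top _),
            lintegral_add_left measurable_const, lintegral_const, measure_univ, mul_one]
      _ ≤ _ := by
          gcongr
          exact hKb _ (le_max_right _ _)

end IsTaskStream

end

/-! ### Stability -/

/-- Centring the services at `a` separates their fluctuations, dominated uniformly in the left end
by the reflected walk, from a multiple of the arrival count. -/
theorem Scenario.newWork_le_lindley (w : Scenario) {a b t t' : ℝ}
    (h : w.numArrived t ≤ w.numArrived t') :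
    w.newWork b t t' ≤ lindley (w.numArrived t') (fun i => w.serv i - a) +
      (a + b) * (w.numArrived t' - w.numArrived t : ℕ) := by
  have h1 := sum_Ico_le_lindley h fun i => w.serv i - a
  rw [Finset.sum_sub_distrib, Finset.sum_const, Nat.card_Ico, nsmul_eq_mul] at h1
  rw [newWork, Finset.sum_add_distrib, Finset.sum_const, Nat.card_Ico, nsmul_eq_mul]
  linarith

theorem exists_weightRoot_state_zero_le {n₀ : ℕ} (init : Fin n₀ → ℝ × Plane) {A : Set Plane}
    (hinit : ∀ i, 0 ≤ (init i).1) (p : ℝ) :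
    ∃ c₀ : ℝ, ∀ z : ℕ → ℝ × Plane × ℝ, (scenario init z).IsRegular A → 0 < (z 0).1 →
      ∀ (pl : Planner) (η : ℝ) (x₀ xw : Plane),
      ((scenario init z).queue ((scenario init z).state pl η x₀ xw 0)).length ≤ n₀ ∧
        (scenario init z).weightRoot p ((scenario init z).state pl η x₀ xw 0) ≤ c₀ := by
  -- The arrival times of the initial tasks do not depend on the random data, so any stream, here
  -- zero, gives the constant.
  refine ⟨(∑ j ∈ Finset.range n₀, (0 - (scenario init 0).arr j + n₀) ^ (p - 1)) ^ (1 / p),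
    fun z hw hz pl η x₀ xw => ?_⟩
  have hn : (scenario init z).numArrived 0 = n₀ := by
    refine le_antisymm ?_ ?_
    · by_contra! h
      have h1 := (hw.arr_le_iff le_rfl n₀).2 h
      have h2 := scenario_arr_add (init := init) z 0
      rw [add_zero, zero_add, Finset.sum_range_one] at h2
      linarith
    · by_contra! h
      have h1 := hw.lt_arr_numArrived le_rfl
      rw [scenario_arr_of_lt _ h] at h1
      linarith [hinit ⟨_, h⟩]
  have hout : (scenario init z).outstanding ((scenario init z).state pl η x₀ xw 0) =
      Finset.range n₀ := by
    simp [Scenario.outstanding_eq, Scenario.state, hn]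
  refine ⟨?_, le_of_eq ?_⟩
  · rw [← Scenario.card_outstanding, hout, Finset.card_range]
  · rw [Scenario.weightRoot, Scenario.weight_eq_sum, hout, Finset.card_range]
    congr 1
    refine Finset.sum_congr rfl fun j hj => ?_
    rw [scenario_arr_of_lt _ (Finset.mem_range.1 hj), scenario_arr_of_lt _ (Finset.mem_range.1 hj)]
    rfl

end DVRP

end

theorem theorem3 {Ω : Type*} [MeasurableSpace Ω] (P : Measure Ω) [IsProbabilityMeasure P]
    -- the bounded planar region, and the law of the task locations
    (E : Set DVRP.Plane) (hE : Bornology.IsBounded E)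
    (φ : Measure DVRP.Plane) [IsProbabilityMeasure φ] (hφ : ∀ᵐ y ∂φ, y ∈ E)
    -- the arrival rate, and the law of the service times
    (lam : ℝ) (hlam : 0 < lam)
    (ν : Measure ℝ) [IsProbabilityMeasure ν] (hν : ∀ᵐ s ∂ν, 0 ≤ s) (hν2 : MemLp (fun s => s) 2 ν)
    (sbar : ℝ) (hsbar : sbar = ∫ s, s ∂ν) (hsbar_pos : 0 < sbar)
    -- the load factor
    (hload : lam * sbar < 1)
    -- the parameters of the policy
    (p : ℝ) (hp : 1 ≤ p) (η : ℝ) (hη : 0 < η)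
    (pl : DVRP.Planner) (hpl : pl.Minimizes p sbar) (hplm : pl.IsMeasurable)
    -- the waiting position, the initial position and the initial tasks
    (xw x₀ : DVRP.Plane) (n₀ : ℕ) (init : Fin n₀ → ℝ × DVRP.Plane)
    (hinit : ∀ i, 0 ≤ (init i).1 ∧ (init i).2 ∈ E)
    -- the random arrivals, locations and service times
    (Z : ℕ → Ω → ℝ × DVRP.Plane × ℝ) (hZ : DVRP.IsTaskStream P lam φ ν Z) :
    DVRP.IsStable P fun t ω =>
      (DVRP.scenario init fun i => Z i ω).numOutstanding pl η x₀ xw t := by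
  -- A ball is convex, so the vehicle stays in it while heading for the waiting position.
  obtain ⟨R, hR⟩ := ((hE.insert x₀).insert xw).subset_closedBall 0
  set A : Set DVRP.Plane := Metric.closedBall 0 R with hA
  have hEA : ∀ y ∈ E, y ∈ A := fun y hy => hR (.inr (.inr hy))
  have hxw : xw ∈ A := hR (.inl rfl)
  have hx₀ : x₀ ∈ A := hR (.inr (.inl rfl))
  have hAb : Bornology.IsBounded A := Metric.isBounded_closedBall
  have hcv : Convex ℝ A := convex_closedBall 0 R
  have hinit' : ∀ i, 0 ≤ (init i).1 := fun i => (hinit i).1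
  have hreg := hZ.ae_isRegular hlam (hφ.mono hEA) hν fun i => ⟨hinit' i, hEA _ (hinit i).2⟩
  -- The drift `1 - ε` is split: `1 - 2 * ε` has to beat the arrivals, and `ε` discounts the
  -- services present at the small state.
  obtain ⟨ε, hε, hεb⟩ : ∃ ε : ℝ, 0 < ε ∧ lam * (sbar + ε + 2 * ε) < 1 - 2 * ε := by
    refine ⟨(1 - lam * sbar) / (3 * lam + 3), div_pos (by linarith) (by linarith), ?_⟩
    have h1 : (1 - lam * sbar) / (3 * lam + 3) * (3 * lam + 3) = 1 - lam * sbar :=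
      div_mul_cancel₀ _ (by linarith)
    have h2 : 0 < (1 - lam * sbar) / (3 * lam + 3) := div_pos (by linarith) (by linarith)
    nlinarith
  set b := sbar + ε + 2 * ε with hb
  have hb0 : 0 < b := by positivity
  have hc0 : 0 < 1 - 2 * ε := lt_trans (by positivity) hεb
  obtain ⟨c₀, hc₀⟩ := DVRP.exists_weightRoot_state_zero_le init (A := A) hinit' p
  obtain ⟨N, c, C, hC, hpath⟩ := DVRP.Scenario.exists_pathwise_bound hAb hcv hp hsbar_pos hpl hη
    hxw hx₀ hε n₀ c₀
  -- Fewer than `N` tasks are outstanding at a small state; each receives this share of the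
  -- discount.
  have hd : 0 < ε / (N + 1) := by positivity
  obtain ⟨K₁, hK₁, hK₁b⟩ := hZ.exists_tsum_lintegral_smallEvent_le hlam hν hν2 hinit' hreg hcv hxw
    hx₀ hη hplm hd p N c
  obtain ⟨K₂, hK₂, hK₂b⟩ := hZ.exists_lintegral_lindley_le (init := init) hlam hν2
    (c := sbar + ε) (by linarith)
  obtain ⟨K₃, hK₃, hK₃b⟩ := hZ.exists_tsum_lintegral_numArrived_sub_le hlam hinit' hreg hb0 hεb
  have hε2 : ENNReal.ofReal (ε / 2) ≠ 0 := by simpa using hε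
  refine ⟨(ENNReal.ofReal (ε / 2))⁻¹ * (ENNReal.ofReal C + K₁ + K₂ + K₃),
    ENNReal.mul_lt_top (ENNReal.inv_lt_top.2 (pos_iff_ne_zero.2 hε2))
      (by simp [hK₁, hK₂, hK₃]), fun t ht => ?_⟩
  set w : Ω → DVRP.Scenario := fun ω => DVRP.scenario init fun i => Z i ω with hw
  set H : ℕ → ℕ → ℕ → Ω → ENNReal := fun l k j ω =>
    (DVRP.Scenario.smallEvent pl η x₀ xw p N c (t - l - 1) (t - l) k j).indicator 1 (w ω) *
      ENNReal.ofReal ((Z j ω).2.2 - ε / (N + 1) * l) with hH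
  set L : Ω → ENNReal := fun ω => ENNReal.ofReal (DVRP.lindley ((w ω).numArrived t)
    fun i => (Z i ω).2.2 - (sbar + ε)) with hL
  -- If the elapsed time has integer part `l`, the interval of length `l + 1` starting at `u l`
  -- covers it.
  set u : ℕ → ℝ := fun l => max (t - (l + 1)) 0 with hu
  set Q : ℕ → Ω → ENNReal := fun l ω => ENNReal.ofReal (b * ((w ω).numArrived (u l + (l + 1)) -
    (w ω).numArrived (u l) : ℕ) - (1 - 2 * ε) * l) with hQ
  have hwm : DVRP.Scenario.IsMeasurable w := DVRP.isMeasurable_scenario hZ.measurable_stream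
  have hHm : ∀ l k j, Measurable (H l k j) := fun l k j =>
    Measurable.mul (((measurable_one.indicator (hwm.mem_smallEvent hplm _ _ k j))))
      ((hZ.measurable j).snd.snd.sub_const _).ennreal_ofReal
  have hQm : ∀ l, Measurable (Q l) := fun l => by
    have h := fun s => hZ.measurable_numArrived (init := init) s
    refine Measurable.ennreal_ofReal (Measurable.sub_const (Measurable.const_mul ?_ _) _)
    exact measurable_from_nat.comp ((h _).sub (h _))
  -- Nonnegative series over all `l`, `k` and `j` dominate the contribution of the random small
  -- iteration.
  have hbound : ∀ᵐ ω ∂P, ENNReal.ofReal (ε / 2) * ((w ω).numOutstanding pl η x₀ xw t : ENNReal) ≤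
      ENNReal.ofReal C + (∑' l, ∑' k, ∑' j, H l k j ω) + ∑' l, Q l ω + L ω := by
    filter_upwards [hreg, hZ.ae_arr_pos hlam] with ω hω hpos
    obtain ⟨h01, h02⟩ := hc₀ _ hω (hpos 0) pl η x₀ xw
    rcases hpath _ hω h01 h02 t ht with h0 | ⟨n, k, hn, hsmall, hkt, hbd⟩
    · rw [h0]; simp
    change (w ω).IsSmall p N c ((w ω).state pl η x₀ xw k) at hsmall
    change ((w ω).state pl η x₀ xw k).time ≤ t at hkt
    set S := (w ω).state pl η x₀ xw k with hS
    have hS0 : 0 ≤ S.time := (hω.isValid_state hcv hxw hx₀ k).time_nonneg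
    set l := ⌊t - S.time⌋₊ with hl
    have hl1 : (l : ℝ) ≤ t - S.time := Nat.floor_le (sub_nonneg.2 hkt)
    have hl2 : t - S.time < l + 1 := Nat.lt_floor_add_one _
    have hN : ((w ω).outstanding S).card ≤ (N : ℝ) + 1 := by
      rw [DVRP.Scenario.card_outstanding]
      have : (((w ω).queue S).length : ℝ) ≤ N := by exact_mod_cast hsmall.2.1.le
      linarith
    -- the outstanding tasks
    have h1 : ENNReal.ofReal (∑ j ∈ (w ω).outstanding S, (w ω).serv j - ε * l) ≤
        ∑' l, ∑' k, ∑' j, H l k j ω := by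
      calc ENNReal.ofReal (∑ j ∈ (w ω).outstanding S, (w ω).serv j - ε * l)
          ≤ ENNReal.ofReal (∑ j ∈ (w ω).outstanding S, ((w ω).serv j - ε / (N + 1) * l)) := by
            refine ENNReal.ofReal_le_ofReal ?_
            rw [Finset.sum_sub_distrib, Finset.sum_const, nsmul_eq_mul]
            have : ((w ω).outstanding S).card * (ε / (N + 1) * l) ≤
                (N + 1) * (ε / (N + 1) * l) := by gcongr
            have h2 : ((N : ℝ) + 1) * (ε / (N + 1) * l) = ε * l := by field_simp
            linarith
        _ ≤ ∑ j ∈ (w ω).outstanding S, ENNReal.ofReal ((w ω).serv j - ε / (N + 1) * l) :=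
            Finset.le_sum_of_subadditive _ ENNReal.ofReal_zero.le
              (fun _ _ => ENNReal.ofReal_add_le) _ _
        _ = ∑ j ∈ (w ω).outstanding S, H l k j ω := by
            refine Finset.sum_congr rfl fun j hj => ?_
            have hmem : w ω ∈ DVRP.Scenario.smallEvent pl η x₀ xw p N c (t - l - 1) (t - l) k j :=
              ⟨hsmall, ⟨by linarith, by linarith⟩, hj⟩
            simp only [hH, Set.indicator_of_mem hmem, Pi.one_apply, one_mul]
            rfl
        _ ≤ ∑' j, H l k j ω := ENNReal.sum_le_tsum _
        _ ≤ ∑' k, ∑' j, H l k j ω := ENNReal.le_tsum k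
        _ ≤ _ := ENNReal.le_tsum l
    have hmono := hω.numArrived_mono
    have h2 : b * ((w ω).numArrived t - (w ω).numArrived S.time : ℕ) -
        (1 - 2 * ε) * (t - S.time) ≤ b * ((w ω).numArrived (u l + (l + 1)) -
          (w ω).numArrived (u l) : ℕ) - (1 - 2 * ε) * l := by
      have h3 : (w ω).numArrived t ≤ (w ω).numArrived (u l + (l + 1)) :=
        hmono (by linarith [le_max_left (t - ((l : ℝ) + 1)) 0])
      have h4 : (w ω).numArrived (u l) ≤ (w ω).numArrived S.time :=
        hmono (max_le (by linarith) hS0)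
      have h5 : (((w ω).numArrived t - (w ω).numArrived S.time : ℕ) : ℝ) ≤
          ((w ω).numArrived (u l + (l + 1)) - (w ω).numArrived (u l) : ℕ) := by
        exact Nat.cast_le.2 (Nat.sub_le_sub_right h3 _ |>.trans (Nat.sub_le_sub_left h4 _))
      gcongr
    have h3 := (w ω).newWork_le_lindley (a := sbar + ε) (b := 2 * ε)
      (show (w ω).numArrived S.time ≤ (w ω).numArrived t from hmono hkt)
    have h4 : ε / 2 * n ≤ C + (∑ j ∈ (w ω).outstanding S, (w ω).serv j - ε * l) +
        (b * ((w ω).numArrived (u l + (l + 1)) - (w ω).numArrived (u l) : ℕ) - (1 - 2 * ε) * l) +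
        DVRP.lindley ((w ω).numArrived t) (fun i => (w ω).serv i - (sbar + ε)) := by
      have h5 := mul_le_mul_of_nonneg_left hl1 hε.le
      have h6 : ε / 2 * n ≤ C + ∑ j ∈ (w ω).outstanding S, (w ω).serv j +
        (w ω).newWork (2 * ε) S.time t - (1 - ε) * (t - S.time) := hbd
      linarith
    calc ENNReal.ofReal (ε / 2) * ((w ω).numOutstanding pl η x₀ xw t : ENNReal)
        ≤ ENNReal.ofReal (ε / 2) * (n : ENNReal) := by
          gcongr
          rw [← ENat.toENNReal_coe]
          exact ENat.toENNReal_le.2 hn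
      _ = ENNReal.ofReal (ε / 2 * n) := by
          rw [ENNReal.ofReal_mul (by positivity), ENNReal.ofReal_natCast]
      _ ≤ ENNReal.ofReal _ := ENNReal.ofReal_le_ofReal h4
      _ ≤ ENNReal.ofReal C + ENNReal.ofReal _ + Q l ω + L ω :=
          ENNReal.ofReal_add_le.trans (add_le_add_left (ENNReal.ofReal_add_le.trans
            (add_le_add_left ENNReal.ofReal_add_le _)) _)
      _ ≤ _ := by
          gcongr
          exact ENNReal.le_tsum l
  have hint : ∫⁻ ω, ENNReal.ofReal (ε / 2) * ((w ω).numOutstanding pl η x₀ xw t : ENNReal) ∂P ≤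
      ENNReal.ofReal C + K₁ + K₂ + K₃ := by
    refine (lintegral_mono_ae hbound).trans ?_
    have hHm' : Measurable fun ω => ∑' l, ∑' k, ∑' j, H l k j ω :=
      .tsum fun l => .tsum fun k => .tsum fun j => hHm l k j
    have hQm' : Measurable fun ω => ∑' l, Q l ω := .tsum hQm
    have h1 : Measurable fun ω => ENNReal.ofReal C + ∑' l, ∑' k, ∑' j, H l k j ω :=
      measurable_const.add hHm'
    rw [lintegral_add_left (by exact h1.add hQm'), lintegral_add_left h1,
      lintegral_add_left measurable_const,
      lintegral_const, measure_univ, mul_one, add_right_comm (_ + K₁)]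
    gcongr
    · rw [lintegral_tsum fun l => (Measurable.tsum fun k => .tsum (hHm l k)).aemeasurable]
      simp_rw [lintegral_tsum fun k => (Measurable.tsum (hHm _ k)).aemeasurable,
        lintegral_tsum fun j => (hHm _ _ j).aemeasurable]
      exact hK₁b t
    · rw [lintegral_tsum fun l => (hQm l).aemeasurable]
      exact hK₃b u fun l => le_max_right _ _
    · exact hK₂b t
  -- The constant is finite, so it can be pulled out without measurability of the number of
  -- outstanding tasks.
  rw [lintegral_const_mul' _ _ ENNReal.ofReal_ne_top] at hint
  exact (ENNReal.mul_le_iff_le_inv hε2 ENNReal.ofReal_ne_top).1 hint
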